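/- **Setting.** Let $D\subset\mathbb R^d$ be a bounded open set (for instance a bounded Lipschitz domain), write $\langle f,h\rangle_D=\int_D f h\,dx$, and let $L$ be the generator of a strongly continuous contraction semigroup on $L^2(D)$, with adjoint $L^*$. Let $(\Omega,\mathcal F,(\mathcal F_t)_{t\ge0},\mathbb P)$ be a filtered probability space carrying an $(\mathcal F_t)$-Brownian motion $B$ and an adapted fractional Brownian motion $B^H$ with Hurst parameter $H\in(1/2,1)$ (no assumption is made on their dependence). Let $k$ have locally integrable square on $[0,\infty)$, let $a$ be continuous and $b$ locally Hölder continuous of some order $\alpha>1-H$ on $[0,\infty)$, and let $$N_t=\int_0^t a(s)\,dB_s+\int_0^t b(s)\,dB^H_s$$ be the (continuous) mixed process, with an Itô and a pathwise Riemann–Stieltjes (fractional) integral. Let $\varphi\in L^\infty(D)$, $\varphi\ge0$, and let $g:\mathbb R\to[0,\infty)$ be locally Lipschitz. Consider, with $L$ encoding the boundary condition, $$(1)\quad du=\Big[\tfrac12k^2(t)Lu+g(u)\Big]dt+u\,dN_t,\qquad u(\cdot,0)=\varphi,$$ $$(2)\quad \frac{\partial v}{\partial t}=\tfrac12k^2(t)Lv-\tfrac12a^2(t)v+e^{-N_t}g(e^{N_t}v),\qquad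 v(\cdot,0)=\varphi .$$ For a stopping time $\tau$ with values in $(0,\infty]$, a *weak solution up to $\tau$* is an adapted, jointly measurable $L^2(D)$-valued random field such that for every $t\ge0$ and every $f\in\mathrm{Dom}(L^*)$, almost surely on $\{t<\tau\}$, all integrals below are well defined and, for (2), $$\langle v(t),f\rangle_D=\langle\varphi,f\rangle_D+\int_0^t\Big(\tfrac12k^2(s)\langle v(s),L^*f\rangle_D-\tfrac12a^2(s)\langle v(s),f\rangle_D\Big)ds+\int_0^te^{-N_s}\langle g(e^{N_s}v(s)),f\rangle_D\,ds,$$ respectively, for (1), $$\langle u(t),f\rangle_D=\langle\varphi,f\rangle_D+\int_0^t\Big(\tfrac12k^2(s)\langle u(s),L^*f\rangle_D+\langle g(u(s)),f\rangle_D\Big)ds+\int_0^t\langle u(s),f\rangle_D\,dN_s,$$ where for (1) it is also required that $\int_0^ta^2(s)(1+\langle u(s),f\rangle_D^2)ds<\infty$ and that $b\,\langle u,f\rangle_D$ is Hölder continuous on $[0,t]$ of some order larger than $1-H$. Such a $\tau$ is a *blowup time* of $w\in\{u,v\}$ if almost surely on $\{\tau<\infty\}$ one has $\limsup_{t\nearrow\tau}\|w(t)\|_{L^\infty(D)}=\infty$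 ($\tau=\infty$ meaning no blowup in finite time). **Theorem 3.1.** Assume that there are $\lambda_0>0$ and $\phi_0\in\mathrm{Dom}(L^*)$ with $\phi_0>0$ a.e. on $D$, $\int_D\phi_0\,dx=1$ and $L^*\phi_0=-\lambda_0\phi_0$, and that $g(z)\ge Cz^{1+\beta}$ for all $z>0$, with constants $C,\beta>0$. Put $K(t)=\frac12\int_0^tk^2(r)dr$, $A(t)=\frac12\int_0^ta^2(r)dr$ and $$\tau^*=\inf\Big\{t>0:\int_0^t\exp\big[-\beta(\lambda_0K(r)+A(r))+\beta N_r\big]dr\ \ge\ \frac1{C\beta}\langle\varphi,\phi_0\rangle_D^{-\beta}\Big\}$$ ($\inf\emptyset=\infty$, and $0^{-\beta}=\infty$). Then: * every weak solution $v$ of (2) up to a stopping time $\tau$ satisfies $\tau\le\tau^*$ almost surely; if $\tau$ is a blowup time of $v$, then almost surely on $\{\tau^*<\infty\}$ one has $\tau<\infty$, and both $v$ and $e^{N}v$ blow up at $\tau$; * every weak solution $u$ of (1) up to a stopping time $\tau$ satisfies $\tau\le\tau^*$ almost surely; if $\tau$ is a blowup time of $u$, then almost surely on $\{\tau^*<\infty\}$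 one has $\tau<\infty$, and both $u$ and $e^{-N}u$ blow up at $\tau$. -/

import Mathlib

open MeasureTheory ProbabilityTheory Filter Topology
open scoped ENNReal NNReal

noncomputable section

namespace MixedSPDE

/-- The Hilbert space `L²(D)` of real functions, `D ⊆ ℝ^d` with Lebesgue measure. -/
abbrev L2 {d : ℕ} (D : Set (EuclideanSpace ℝ (Fin d))) : Type :=
  Lp ℝ 2 ((volume : Measure (EuclideanSpace ℝ (Fin d))).restrict D)

/-- `⟨f, h⟩_D = ∫_D f(x) h(x) dx`. -/
def pairing {d : ℕ} (D : Set (EuclideanSpace ℝ (Fin d)))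
    (f h : EuclideanSpace ℝ (Fin d) → ℝ) : ℝ :=
  ∫ x in D, f x * h x

/-! ### Contraction semigroups and their generators -/

/-- Strongly continuous semigroup of contractions. -/
structure IsContractionSemigroup {E : Type*} [NormedAddCommGroup E] [NormedSpace ℝ E]
    (S : ℝ≥0 → E →L[ℝ] E) : Prop where
  zero : S 0 = ContinuousLinearMap.id ℝ E
  add : ∀ s t, S (s + t) = (S s).comp (S t)
  contraction : ∀ t, ‖S t‖ ≤ 1
  cont : ∀ f, Continuous fun t => S t f

/-- `L` is the infinitesimal generator of `S`: `f ∈ Dom(L)` and `L f = h` hold exactly when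
`(S t f - f) / t → h` as `t ↓ 0`. -/
def IsGenerator {E : Type*} [NormedAddCommGroup E] [NormedSpace ℝ E]
    (S : ℝ≥0 → E →L[ℝ] E) (L : E →ₗ.[ℝ] E) : Prop :=
  ∀ f h : E, (f, h) ∈ L.graph ↔
    Tendsto (fun t : ℝ≥0 => (t : ℝ)⁻¹ • (S t f - f)) (𝓝[>] 0) (𝓝 h)

/-! ### Driving processes -/

/-- `B` is a standard Brownian motion relative to the filtration `𝓕`. -/
structure IsFilteredBrownian {Ω : Type*} {m : MeasurableSpace Ω} (P : Measure Ω)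
    (𝓕 : Filtration ℝ≥0 m) (B : ℝ≥0 → Ω → ℝ) : Prop where
  brownian : IsBrownianReal B P
  adapted : StronglyAdapted 𝓕 B
  indep : ∀ s t, s ≤ t →
    Indep (MeasurableSpace.comap (fun ω => B t ω - B s ω) inferInstance) (𝓕 s) P

/-- `X` is a fractional Brownian motion with Hurst parameter `H`, adapted to `𝓕`. -/
structure IsFractionalBrownian {Ω : Type*} {m : MeasurableSpace Ω} (P : Measure Ω)
    (𝓕 : Filtration ℝ≥0 m) (H : ℝ) (X : ℝ≥0 → Ω → ℝ) : Prop where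
  gaussian : IsGaussianProcess X P
  mean : ∀ t, ∫ ω, X t ω ∂P = 0
  covariance : ∀ s t : ℝ≥0, cov[X s, X t; P] =
    ((t : ℝ) ^ (2 * H) + (s : ℝ) ^ (2 * H) - |(t : ℝ) - (s : ℝ)| ^ (2 * H)) / 2
  cont : ∀ᵐ ω ∂P, Continuous fun t => X t ω
  adapted : StronglyAdapted 𝓕 X

/-! ### Itô integrals and pathwise (Riemann–Stieltjes) integrals -/

/-- Elementary adapted process `∑_{i<n} ξ_i 1_{(t_i, t_{i+1}]}` with bounded
`𝓕 (t_i)`-measurable `ξ_i`. -/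
structure ElementaryProcess {Ω : Type*} {m : MeasurableSpace Ω} (𝓕 : Filtration ℝ≥0 m) where
  n : ℕ
  time : ℕ → ℝ≥0
  time_mono : Monotone time
  coeff : ℕ → Ω → ℝ
  coeff_meas : ∀ i, Measurable[𝓕 (time i)] (coeff i)
  coeff_bdd : ∀ i, ∃ M : ℝ, ∀ ω, |coeff i ω| ≤ M

/-- Value of an elementary process at time `s`. -/
def ElementaryProcess.val {Ω : Type*} {m : MeasurableSpace Ω} {𝓕 : Filtration ℝ≥0 m}
    (Y : ElementaryProcess 𝓕) (s : ℝ≥0) (ω : Ω) : ℝ :=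
  ∑ i ∈ Finset.range Y.n,
    (Set.Ioc (Y.time i) (Y.time (i + 1))).indicator (fun _ => Y.coeff i ω) s

/-- `∫_0^t Y dB` for an elementary process `Y`. -/
def ElementaryProcess.integral {Ω : Type*} {m : MeasurableSpace Ω} {𝓕 : Filtration ℝ≥0 m}
    (Y : ElementaryProcess 𝓕) (B : ℝ≥0 → Ω → ℝ) (t : ℝ≥0) (ω : Ω) : ℝ :=
  ∑ i ∈ Finset.range Y.n,
    Y.coeff i ω * (B (min (Y.time (i + 1)) t) ω - B (min (Y.time i) t) ω)

/-- On the event `A`, the random variable `J` is the Itô integral `∫_0^t X_s dB_s`: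
there are elementary processes `Y_n` with `∫_0^t |Y_n - X|² ds → 0` and
`∫_0^t Y_n dB → J`, both in probability on `A`. (On `A` this determines `J` almost surely;
`A` is the whole space, or `{t < τ}` when `X` is only given before the time `τ`.) -/
def HasItoIntegralOn {Ω : Type*} {m : MeasurableSpace Ω} (P : Measure Ω)
    (𝓕 : Filtration ℝ≥0 m) (B X : ℝ≥0 → Ω → ℝ) (t : ℝ≥0) (A : Set Ω) (J : Ω → ℝ) : Prop :=
  ∃ Y : ℕ → ElementaryProcess 𝓕,
    (∀ ε : ℝ, 0 < ε → Tendsto (fun n => P {ω | ω ∈ A ∧ ENNReal.ofReal ε ≤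
        ∫⁻ s in Set.Icc (0 : ℝ) t,
          ENNReal.ofReal (((Y n).val s.toNNReal ω - X s.toNNReal ω) ^ 2)}) atTop (𝓝 0)) ∧
    (∀ ε : ℝ, 0 < ε → Tendsto (fun n => P {ω | ω ∈ A ∧
        ε ≤ |(Y n).integral B t ω - J ω|}) atTop (𝓝 0))

/-- `J = ∫_0^t f dh` as a Riemann–Stieltjes integral: the tagged sums converge to `J` as the
mesh tends to zero. For Hölder functions whose exponents add up to more than one this is the
fractional (Zähle) integral. -/
def HasStieltjesIntegral (f h : ℝ≥0 → ℝ) (t : ℝ≥0) (J : ℝ) : Prop :=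
  ∀ ε : ℝ, 0 < ε → ∃ δ : ℝ≥0, 0 < δ ∧ ∀ (n : ℕ) (x ξ : ℕ → ℝ≥0), Monotone x →
    x 0 = 0 → x n = t →
    (∀ i < n, x (i + 1) < x i + δ ∧ ξ i ∈ Set.Icc (x i) (x (i + 1))) →
    |∑ i ∈ Finset.range n, f (ξ i) * (h (x (i + 1)) - h (x i)) - J| < ε

/-- `N` is the continuous process `N_t = ∫_0^t a dB + ∫_0^t b dB^H`. -/
structure IsMixedNoise {Ω : Type*} {m : MeasurableSpace Ω} (P : Measure Ω)
    (𝓕 : Filtration ℝ≥0 m) (a b : ℝ → ℝ) (B BH N : ℝ≥0 → Ω → ℝ) : Prop where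
  cont : ∀ᵐ ω ∂P, Continuous fun t => N t ω
  eq_integrals : ∀ t : ℝ≥0, ∃ I J : Ω → ℝ,
    HasItoIntegralOn P 𝓕 B (fun s _ => a s) t Set.univ I ∧
    (∀ᵐ ω ∂P, HasStieltjesIntegral (fun s => b s) (fun s => BH s ω) t (J ω)) ∧
    ∀ᵐ ω ∂P, N t ω = I ω + J ω

/-! ### Weak solutions -/

/-- Adapted, jointly measurable `L²(D)`-valued random field, together with a stopping time
`τ > 0` up to which it is considered. Values after `τ` are irrelevant. -/
structure IsFieldUpTo {Ω : Type*} {m : MeasurableSpace Ω} (P : Measure Ω)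
    (𝓕 : Filtration ℝ≥0 m) {d : ℕ} (D : Set (EuclideanSpace ℝ (Fin d)))
    (v : ℝ≥0 → Ω → L2 D) (τ : Ω → ℝ≥0∞) : Prop where
  adapted : StronglyAdapted 𝓕 v
  measurable : StronglyMeasurable (Function.uncurry v)
  stopping : IsStoppingTime 𝓕 τ
  pos : ∀ᵐ ω ∂P, 0 < τ ω

/-- `v` is a weak solution up to `τ` of the random equation
`∂v/∂t = ½ k² L v - ½ a² v + e^{-N} g(e^N v)`, `v(0) = φ`. -/
structure IsWeakSolutionRPDE {Ω : Type*} {m : MeasurableSpace Ω} (P : Measure Ω)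
    (𝓕 : Filtration ℝ≥0 m) {d : ℕ} (D : Set (EuclideanSpace ℝ (Fin d)))
    (L : L2 D →ₗ.[ℝ] L2 D) (k a : ℝ → ℝ) (g : ℝ → ℝ) (φ : EuclideanSpace ℝ (Fin d) → ℝ)
    (N : ℝ≥0 → Ω → ℝ) (v : ℝ≥0 → Ω → L2 D) (τ : Ω → ℝ≥0∞) : Prop
    extends IsFieldUpTo P 𝓕 D v τ where
  weak : ∀ (t : ℝ≥0) (f : L.adjoint.domain), ∀ᵐ ω ∂P, (t : ℝ≥0∞) < τ ω →
    -- the integrals below are well defined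
    IntervalIntegrable
      (fun s => k s ^ 2 * pairing D (v s.toNNReal ω) (L.adjoint f)) volume 0 t ∧
    IntervalIntegrable
      (fun s => a s ^ 2 * pairing D (v s.toNNReal ω) (f : L2 D)) volume 0 t ∧
    (∀ᵐ s ∂(volume.restrict (Set.Icc (0 : ℝ) t)), IntegrableOn
      (fun x => g (Real.exp (N s.toNNReal ω) * v s.toNNReal ω x) * (f : L2 D) x) D) ∧
    IntervalIntegrable
      (fun s => Real.exp (-N s.toNNReal ω) * pairing D
        (fun x => g (Real.exp (N s.toNNReal ω) * v s.toNNReal ω x)) (f : L2 D)) volume 0 t ∧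
    -- the weak equation
    pairing D (v t ω) (f : L2 D) = pairing D φ (f : L2 D)
      + (∫ s in (0 : ℝ)..t, (1 / 2 * k s ^ 2 * pairing D (v s.toNNReal ω) (L.adjoint f)
          - 1 / 2 * a s ^ 2 * pairing D (v s.toNNReal ω) (f : L2 D)))
      + ∫ s in (0 : ℝ)..t, Real.exp (-N s.toNNReal ω) * pairing D
          (fun x => g (Real.exp (N s.toNNReal ω) * v s.toNNReal ω x)) (f : L2 D)

/-- `u` is a weak solution up to `τ` of the stochastic equation
`du = [½ k² L u + g(u)] dt + u dN`, `u(0) = φ`, with `dN = a dB + b dB^H`. -/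
structure IsWeakSolutionSPDE {Ω : Type*} {m : MeasurableSpace Ω} (P : Measure Ω)
    (𝓕 : Filtration ℝ≥0 m) {d : ℕ} (D : Set (EuclideanSpace ℝ (Fin d)))
    (L : L2 D →ₗ.[ℝ] L2 D) (k a b : ℝ → ℝ) (H : ℝ) (g : ℝ → ℝ)
    (φ : EuclideanSpace ℝ (Fin d) → ℝ)
    (B BH : ℝ≥0 → Ω → ℝ) (u : ℝ≥0 → Ω → L2 D) (τ : Ω → ℝ≥0∞) : Prop
    extends IsFieldUpTo P 𝓕 D u τ where
  weak : ∀ (t : ℝ≥0) (f : L.adjoint.domain), ∃ I J : Ω → ℝ,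
    -- `I = ∫_0^t ⟨u, f⟩ a dB` on `{t < τ}`
    HasItoIntegralOn P 𝓕 B (fun s ω => pairing D (u s ω) (f : L2 D) * a s) t
      {ω | (t : ℝ≥0∞) < τ ω} I ∧
    ∀ᵐ ω ∂P, (t : ℝ≥0∞) < τ ω →
      -- conditions under which the Itô and the fractional integral are defined
      IntervalIntegrable
        (fun s => a s ^ 2 * (1 + pairing D (u s.toNNReal ω) (f : L2 D) ^ 2)) volume 0 t ∧
      (∃ γ M : ℝ≥0, 1 - H < γ ∧ HolderOnWith M γ
        (fun s : ℝ≥0 => b s * pairing D (u s ω) (f : L2 D)) (Set.Icc 0 t)) ∧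
      -- conditions under which the Lebesgue integrals are defined
      IntervalIntegrable
        (fun s => k s ^ 2 * pairing D (u s.toNNReal ω) (L.adjoint f)) volume 0 t ∧
      (∀ᵐ s ∂(volume.restrict (Set.Icc (0 : ℝ) t)), IntegrableOn
        (fun x => g (u s.toNNReal ω x) * (f : L2 D) x) D) ∧
      IntervalIntegrable
        (fun s => pairing D (fun x => g (u s.toNNReal ω x)) (f : L2 D)) volume 0 t ∧
      -- `J = ∫_0^t ⟨u, f⟩ b dB^H`
      HasStieltjesIntegral (fun s : ℝ≥0 => b s * pairing D (u s ω) (f : L2 D))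
        (fun s => BH s ω) t (J ω) ∧
      -- the weak equation
      pairing D (u t ω) (f : L2 D) = pairing D φ (f : L2 D)
        + (∫ s in (0 : ℝ)..t, (1 / 2 * k s ^ 2 * pairing D (u s.toNNReal ω) (L.adjoint f)
            + pairing D (fun x => g (u s.toNNReal ω x)) (f : L2 D)))
        + (I ω + J ω)

/-! ### Blowup -/

/-- The trajectory `t ↦ v t` blows up at the finite time `T`:
`limsup_{t ↗ T} ‖v t‖_∞ = ∞`, with the essential supremum over `D`. -/
def BlowsUpAt {d : ℕ} (D : Set (EuclideanSpace ℝ (Fin d))) (v : ℝ≥0 → L2 D) (T : ℝ≥0) : Prop :=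
  limsup (fun t : ℝ≥0 => eLpNorm (v t) ⊤ (volume.restrict D)) (𝓝[<] T) = ⊤

/-- `τ` is a blowup time of `v`: blowup takes place at `τ` wherever `τ` is finite
(and `τ = ∞` stands for no blowup in finite time). -/
def IsBlowupTime {Ω : Type*} {m : MeasurableSpace Ω} (P : Measure Ω)
    {d : ℕ} (D : Set (EuclideanSpace ℝ (Fin d)))
    (v : ℝ≥0 → Ω → L2 D) (τ : Ω → ℝ≥0∞) : Prop :=
  ∀ᵐ ω ∂P, τ ω < ⊤ → BlowsUpAt D (fun t => v t ω) (τ ω).toNNReal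

/-- `½ ∫_0^t c(r)² dr`; this is `K(t)` for `c = k` and `A(t)` for `c = a`. -/
def halfSq (c : ℝ → ℝ) (t : ℝ) : ℝ := 1 / 2 * ∫ r in (0 : ℝ)..t, c r ^ 2

/-- `τ* = inf {t > 0 : ∫_0^t exp(-β(λ₀ K(r) + A(r)) + β N_r) dr ≥ (Cβ)⁻¹ p^{-β}}` (with
`inf ∅ = ∞`), where `p` stands for `⟨φ, φ₀⟩ ≥ 0`; the threshold is `∞` if `p = 0`. -/
def tauStar {Ω : Type*} (k a : ℝ → ℝ) (C β lam p : ℝ) (N : ℝ≥0 → Ω → ℝ) (ω : Ω) : ℝ≥0∞ :=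
  ⨅ (t : ℝ≥0) (_ : 0 < t ∧
    ENNReal.ofReal (1 / (C * β)) * (ENNReal.ofReal p) ^ (-β) ≤
      ∫⁻ r in Set.Icc (0 : ℝ) t, ENNReal.ofReal
        (Real.exp (-β * (lam * halfSq k r + halfSq a r) + β * N r.toNNReal ω))),
    (t : ℝ≥0∞)

end MixedSPDE

end

noncomputable section

namespace MixedSPDE

/-! ### A comparison lemma for absolutely continuous functions -/

/-! Testing with the eigenfunction `φ₀` turns the equation into a scalar one. Since `L*φ₀ = -λ₀φ₀`,
the function `w = ⟨v, φ₀⟩` satisfies `w' = -(λ₀k²/2 + a²/2) w + Γ` with `Γ = e^{-N}⟨g(e^N v), φ₀⟩`.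
As `φ₀` is a probability density and `g ≥ 0` dominates the convex function `C z₊^{1+β}`, Jensen's
inequality gives `Γ ≥ C e^{βN} w₊^{1+β}` (`rpow_integral_le_integral_comp`). Then `Z = e^{λ₀K + A}
w` is nondecreasing from `p = ⟨φ, φ₀⟩`, and `(Z^{-β})' ≤ -Cβ e^{-β(λ₀K + A) + βN}`. Because `Z^{-β}`
stays positive, the integral defining `τ*` remains below its threshold as long as the solution lives
(`integral_exp_lt_of_riccati`, `le_tauStar_of_integral_lt`). Blowup transfers between a solution and
its transform because `e^{±N}` is continuous and positive in time.

For the stochastic equation `y = ⟨u, φ₀⟩` satisfies `dy = F dt + y dN`. Itô's formula shows that `w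
= e^{-N} y` obeys the same scalar equation, the term `-a²w/2` coming from the quadratic variation of
the Brownian part; both cases then end in `ae_le_tauStar`. Most of the file proves this formula
(`ae_exp_neg_mul_eq`) by expanding the increments of `e^{-N} y` along dyadic grids: - Itô remainders
(`itoRem`) are small in probability, both in their sum of squares and when summed against adapted
weights. This rests on Lenglart-type inequalities for discrete stochastic integrals
(`measure_max_le`, `measure_blocks_le`). - Young remainders (`youngRem`) are absolutely summable
with sum tending to zero, because the expected dyadic variation of fractional Brownian motion at
level `l` is of order `2^{l(1-H)}` and the integrands are Hölder of order larger than `1-H`. - The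
quadratic variation of `B^H` vanishes since `H > 1/2`, and weighted quadratic sums of `B` converge
to time integrals. These facts are pathwise or use adaptedness only, so the joint law of `B` and
`B^H` plays no role. A subsequence of grids makes all limits almost sure, and
`exp_neg_mul_eq_of_tendsto` concludes path by path.

A recurring difficulty is that the weak equation holds at each fixed time off a null set depending
on that time. Dyadic times share one null set, and joint measurability with Fubini shows that almost
every path agrees with its continuous version at almost every time (`ae_ae_tendsto_dfloor`), which
is enough under time integrals. -/

theorem _root_.LipschitzOnWith.comp_absolutelyContinuousOnInterval {F f : ℝ → ℝ} {s : Set ℝ}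
    {K : ℝ≥0} {a b : ℝ} (hF : LipschitzOnWith K F s) (hf : AbsolutelyContinuousOnInterval f a b)
    (hfs : Set.MapsTo f (Set.uIcc a b) s) :
    AbsolutelyContinuousOnInterval (fun x => F (f x)) a b := by
  rw [absolutelyContinuousOnInterval_iff] at hf ⊢
  intro ε hε
  obtain ⟨δ, hδ, h⟩ := hf (ε / (K + 1)) (by positivity)
  refine ⟨δ, hδ, fun E hE hlen => ?_⟩
  have h1 := h E hE hlen
  calc ∑ i ∈ Finset.range E.1, dist (F (f (E.2 i).1)) (F (f (E.2 i).2))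
      ≤ ∑ i ∈ Finset.range E.1, (K + 1) * dist (f (E.2 i).1) (f (E.2 i).2) := by
        refine Finset.sum_le_sum fun i hi => ?_
        have hm := hE.1 i hi
        refine (hF.dist_le_mul _ (hfs hm.1) _ (hfs hm.2)).trans ?_
        gcongr
        linarith
    _ = (K + 1) * ∑ i ∈ Finset.range E.1, dist (f (E.2 i).1) (f (E.2 i).2) := by
        rw [Finset.mul_sum]
    _ < (K + 1) * (ε / (K + 1)) := by gcongr
    _ = ε := by field_simp

/-- For `exp` and negative powers, which are Lipschitz only on suitable compact intervals; `k²` is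
merely integrable, so absolute continuity is the best regularity at hand. -/
theorem _root_.AbsolutelyContinuousOnInterval.comp_contDiffOn {F f : ℝ → ℝ} {a b m M : ℝ}
    (hF : ContDiffOn ℝ 1 F (Set.Icc m M)) (hf : AbsolutelyContinuousOnInterval f a b)
    (hfs : Set.MapsTo f (Set.uIcc a b) (Set.Icc m M)) :
    AbsolutelyContinuousOnInterval (fun x => F (f x)) a b := by
  obtain ⟨K, hK⟩ := hF.exists_lipschitzOnWith (by decide) (convex_Icc _ _) isCompact_Icc
  exact hK.comp_absolutelyContinuousOnInterval hf hfs

/-- If `Φ' = -κ Φ + Γ` with `Γ ≥ C e^{β N} Φ₊^{1+β}` and `Φ 0 = p > 0` on `[0, T]`, then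
`T` lies before the explosion time of the comparison equation. -/
theorem integral_exp_lt_of_riccati {T p C β : ℝ} {κ Γ N Φ : ℝ → ℝ} (hT : 0 ≤ T) (hp : 0 < p)
    (hC : 0 < C) (hβ : 0 < β) (hκ : IntervalIntegrable κ volume 0 T)
    (hΓ : IntervalIntegrable Γ volume 0 T) (hN : ContinuousOn N (Set.Icc 0 T))
    (hΦc : ContinuousOn Φ (Set.Icc 0 T))
    (hΦ : ∀ t ∈ Set.Icc 0 T, Φ t = p - (∫ s in (0 : ℝ)..t, κ s * Φ s) + ∫ s in (0 : ℝ)..t, Γ s)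
    (hle : ∀ᵐ s, s ∈ Set.Icc 0 T → C * Real.exp (β * N s) * (max (Φ s) 0) ^ (1 + β) ≤ Γ s) :
    C * β * ∫ s in (0 : ℝ)..T, Real.exp (-β * (∫ r in (0 : ℝ)..s, κ r) + β * N s) <
      p ^ (-β) := by
  have hu : Set.uIcc 0 T = Set.Icc 0 T := Set.uIcc_of_le hT
  have h0 : (0 : ℝ) ∈ Set.uIcc 0 T := by simp
  set k : ℝ → ℝ := fun t => ∫ r in (0 : ℝ)..t, κ r with hk
  have hkac : AbsolutelyContinuousOnInterval k 0 T :=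
    hκ.absolutelyContinuousOnInterval_intervalIntegral h0
  have hkc : ContinuousOn k (Set.Icc 0 T) := hu ▸ hkac.continuousOn
  have hκΦ : IntervalIntegrable (fun s => κ s * Φ s) volume 0 T :=
    hκ.mul_continuousOn (hu ▸ hΦc)
  -- `Φ` is known only on `[0, T]`. The right-hand side makes sense on the whole line, so two-sided
  -- derivatives can be taken of it instead.
  set Ψ : ℝ → ℝ := fun t =>
    p - (∫ s in (0 : ℝ)..t, κ s * Φ s) + ∫ s in (0 : ℝ)..t, Γ s with hΨ
  have hΨΦ : ∀ t ∈ Set.Icc 0 T, Ψ t = Φ t := fun t ht => (hΦ t ht).symm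
  have hΨac : AbsolutelyContinuousOnInterval Ψ 0 T := by
    have h1 := hκΦ.absolutelyContinuousOnInterval_intervalIntegral h0
    have h2 := hΓ.absolutelyContinuousOnInterval_intervalIntegral h0
    have h3 : AbsolutelyContinuousOnInterval (fun _ : ℝ => p) 0 T :=
      (contDiff_const (n := 1)).contDiffOn.absolutelyContinuousOnInterval
    exact (h3.sub h1).add h2
  obtain ⟨Mk, hMk⟩ := hkac.exists_bound
  have heac : AbsolutelyContinuousOnInterval (fun t => Real.exp (k t)) 0 T :=
    AbsolutelyContinuousOnInterval.comp_contDiffOn (m := -Mk) (M := Mk)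
      Real.contDiff_exp.contDiffOn hkac fun t ht => abs_le.1 (hMk t ht)
  -- The integrating factor removes the linear term, so that `Z' = Γ e^k ≥ 0` almost everywhere.
  set Z : ℝ → ℝ := fun t => Ψ t * Real.exp (k t) with hZ
  have hZac : AbsolutelyContinuousOnInterval Z 0 T := hΨac.mul heac
  have hZd : ∀ᵐ s, s ∈ Set.Icc 0 T → HasDerivAt Z (Γ s * Real.exp (k s)) s := by
    filter_upwards [hκ.ae_hasDerivAt_integral, hκΦ.ae_hasDerivAt_integral,
      hΓ.ae_hasDerivAt_integral] with s h1 h2 h3 hs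
    have hs' : s ∈ Set.uIcc 0 T := hu ▸ hs
    have d1 := h1 hs' 0 h0
    have d2 := h2 hs' 0 h0
    have d3 := h3 hs' 0 h0
    have dΨ : HasDerivAt Ψ (-(κ s * Φ s) + Γ s) s := by
      exact (d2.const_sub p).add d3
    have := dΨ.mul d1.exp
    refine this.congr_deriv ?_
    rw [hΨΦ s hs]
    ring
  have hZ0 : Z 0 = p := by simp [hZ, hΨ, hk]
  have hZp : ∀ t ∈ Set.Icc 0 T, p ≤ Z t := by
    intro t ht
    have hsub : Set.uIcc 0 t ⊆ Set.uIcc 0 T := by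
      rw [hu, Set.uIcc_of_le ht.1]; exact Set.Icc_subset_Icc_right ht.2
    have h1 := (hZac.mono hsub).integral_deriv_eq_sub
    have h2 : 0 ≤ ∫ x in (0 : ℝ)..t, deriv Z x := by
      refine intervalIntegral.integral_nonneg_of_ae_restrict ht.1 ?_
      refine (ae_restrict_iff' measurableSet_Icc).2 ?_
      filter_upwards [hZd, hle] with s h3 h4 hs
      have hs' : s ∈ Set.Icc 0 T := ⟨hs.1, hs.2.trans ht.2⟩
      rw [(h3 hs').deriv]
      have : 0 ≤ Γ s := le_trans (by positivity) (h4 hs')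
      simp only [Pi.zero_apply]
      positivity
    linarith
  obtain ⟨M, hM⟩ := hZac.exists_bound
  have hmaps : Set.MapsTo Z (Set.uIcc 0 T) (Set.Icc p M) := fun t ht =>
    ⟨hZp t (hu ▸ ht), (le_abs_self _).trans (hM t ht)⟩
  have hhac : AbsolutelyContinuousOnInterval (fun t => Z t ^ (-β)) 0 T := by
    refine AbsolutelyContinuousOnInterval.comp_contDiffOn (F := fun x : ℝ => x ^ (-β)) (m := p)
      (M := M) ?_ hZac hmaps
    intro x hx
    exact (Real.contDiffAt_rpow_const_of_ne (hp.trans_le hx.1).ne').contDiffWithinAt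
  have hint := hhac.integral_deriv_eq_sub
  have hcont : ContinuousOn (fun s => Real.exp (-β * k s + β * N s)) (Set.uIcc 0 T) := by
    rw [hu]
    exact ((continuousOn_const.mul hkc).add (continuousOn_const.mul hN)).rexp
  -- The derivative is `-β Z^{-β-1} Γ e^k`. Inserting the lower bound for `Γ` with `Φ = Z e^{-k}`,
  -- the powers of `Z` cancel and `e^{-(1+β)k} e^k = e^{-βk}` remains.
  have hmono : ∫ s in (0 : ℝ)..T, deriv (fun t => Z t ^ (-β)) s ≤
      ∫ s in (0 : ℝ)..T, -(C * β) * Real.exp (-β * k s + β * N s) := by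
    refine intervalIntegral.integral_mono_ae_restrict hT hhac.intervalIntegrable_deriv
      (hcont.intervalIntegrable.const_mul _) ?_
    refine (ae_restrict_iff' measurableSet_Icc).2 ?_
    filter_upwards [hZd, hle] with s h3 h4 hs
    have hZs : 0 < Z s := hp.trans_le (hZp s hs)
    have hΦZ : Φ s = Z s * Real.exp (-k s) := by
      rw [← hΨΦ s hs, hZ, mul_assoc, ← Real.exp_add]; simp
    have hd := ((h3 hs).rpow_const (p := -β) (Or.inl hZs.ne')).deriv
    have h5 := h4 hs
    have hmax : max (Φ s) 0 = Z s * Real.exp (-k s) := by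
      rw [hΦZ]; exact max_eq_left (by positivity)
    rw [hmax, Real.mul_rpow hZs.le (Real.exp_pos _).le, ← Real.exp_mul] at h5
    change deriv (fun t => Z t ^ (-β)) s ≤ _
    rw [hd]
    have h6 : Real.exp (-β * k s + β * N s) =
        Real.exp (β * N s) * Real.exp (-k s * (1 + β)) * Real.exp (k s) := by
      rw [← Real.exp_add, ← Real.exp_add]; ring_nf
    have h7 : Z s ^ (1 + β) * Z s ^ (-β - 1) = 1 := by
      rw [← Real.rpow_add hZs, show 1 + β + (-β - 1) = 0 by ring, Real.rpow_zero]
    have h8 : 0 < β * Real.exp (k s) * Z s ^ (-β - 1) := by positivity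
    have h9 := mul_le_mul_of_nonneg_left h5 h8.le
    rw [h6]
    calc Γ s * Real.exp (k s) * -β * Z s ^ (-β - 1)
        = -(β * Real.exp (k s) * Z s ^ (-β - 1) * Γ s) := by ring
      _ ≤ -(β * Real.exp (k s) * Z s ^ (-β - 1) *
          (C * Real.exp (β * N s) * (Z s ^ (1 + β) * Real.exp (-k s * (1 + β))))) := by linarith
      _ = -(C * β) * (Real.exp (β * N s) * Real.exp (-k s * (1 + β)) * Real.exp (k s)) *
          (Z s ^ (1 + β) * Z s ^ (-β - 1)) := by ring
      _ = _ := by rw [h7, mul_one]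
  rw [intervalIntegral.integral_const_mul, hint, hZ0] at hmono
  -- The strict inequality comes from the positivity of this endpoint value.
  have hZT : 0 < Z T ^ (-β) := Real.rpow_pos_of_pos (hp.trans_le (hZp T ⟨hT, le_rfl⟩)) _
  linarith

/-! ### Convexity -/

/-- The tangent line of `z ↦ C z₊^{1+β}` at `m > 0` lies below any `g ≥ 0` dominating `C z^{1+β}`
for `z > 0`. -/
theorem tangent_le_of_rpow_le {g : ℝ → ℝ} {C β m : ℝ} (hC : 0 < C) (hβ : 0 < β)
    (hg0 : ∀ z, 0 ≤ g z) (hgC : ∀ z, 0 < z → C * z ^ (1 + β) ≤ g z) (hm : 0 < m) (x : ℝ) :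
    C * (m ^ (1 + β) + (1 + β) * m ^ β * (x - m)) ≤ g x := by
  have hmm : m ^ (1 + β) = m * m ^ β := by rw [Real.rpow_add hm, Real.rpow_one]
  have hpos : 0 < m ^ β := Real.rpow_pos_of_pos hm _
  rcases le_or_gt x 0 with hx | hx
  · refine le_trans ?_ (hg0 x)
    have : m ^ (1 + β) + (1 + β) * m ^ β * (x - m) = m ^ β * ((1 + β) * x - β * m) := by
      rw [hmm]; ring
    rw [this]
    have h2 : (1 + β) * x - β * m ≤ 0 := by nlinarith [mul_pos hβ hm]
    nlinarith [mul_nonneg hC.le (mul_nonneg hpos.le (neg_nonneg.2 h2))]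
  · refine le_trans ?_ (hgC x hx)
    gcongr
    -- Bernoulli's inequality for `(x / m)^{1+β}`; multiplied by `m^{1+β}` it is the tangent line
    -- bound.
    have h1 := one_add_mul_self_le_rpow_one_add (s := x / m - 1)
      (by have := div_pos hx hm; linarith) (p := 1 + β) (by linarith)
    have h2 : 1 + (x / m - 1) = x / m := by ring
    rw [h2, Real.div_rpow hx.le hm.le, le_div_iff₀ (Real.rpow_pos_of_pos hm _)] at h1
    refine le_trans (le_of_eq ?_) h1
    rw [hmm]
    field_simp

/-- Jensen's inequality for the probability density `ψ`. -/
theorem rpow_integral_le_integral_comp {X : Type*} [MeasurableSpace X] {ν : Measure X}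
    {g : ℝ → ℝ} {C β : ℝ} (hC : 0 < C) (hβ : 0 < β)
    (hg0 : ∀ z, 0 ≤ g z) (hgC : ∀ z, 0 < z → C * z ^ (1 + β) ≤ g z) {h ψ : X → ℝ}
    (hψ : ∀ᵐ x ∂ν, 0 ≤ ψ x) (hψi : Integrable ψ ν) (hψ1 : ∫ x, ψ x ∂ν = 1)
    (hhψ : Integrable (fun x => h x * ψ x) ν) (hghψ : Integrable (fun x => g (h x) * ψ x) ν) :
    C * (max (∫ x, h x * ψ x ∂ν) 0) ^ (1 + β) ≤ ∫ x, g (h x) * ψ x ∂ν := by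
  set m := ∫ x, h x * ψ x ∂ν
  rcases le_or_gt m 0 with hm | hm
  · rw [max_eq_right hm, Real.zero_rpow (by positivity), mul_zero]
    refine integral_nonneg_of_ae ?_
    filter_upwards [hψ] with x hx
    exact mul_nonneg (hg0 _) hx
  · rw [max_eq_left hm.le]
    -- `g` itself need not be convex, so its minorant is linearized at the mean `m`; after
    -- integration against `ψ` the two terms in `(1 + β) m^β` cancel.
    have hi : Integrable (fun x => C * (m ^ (1 + β) - (1 + β) * m ^ β * m) * ψ x +
        C * ((1 + β) * m ^ β) * (h x * ψ x)) ν := (hψi.const_mul _).add (hhψ.const_mul _)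
    have h1 : ∫ x, (C * (m ^ (1 + β) - (1 + β) * m ^ β * m) * ψ x +
        C * ((1 + β) * m ^ β) * (h x * ψ x)) ∂ν ≤ ∫ x, g (h x) * ψ x ∂ν := by
      refine integral_mono_ae hi hghψ ?_
      filter_upwards [hψ] with x hx
      have := mul_le_mul_of_nonneg_right (tangent_le_of_rpow_le hC hβ hg0 hgC hm (h x)) hx
      refine le_trans (le_of_eq ?_) this
      ring
    rw [integral_add (hψi.const_mul _) (hhψ.const_mul _), integral_const_mul,
      integral_const_mul, hψ1] at h1
    change C * (m ^ (1 + β) - (1 + β) * m ^ β * m) * 1 + C * ((1 + β) * m ^ β) * m ≤ _ at h1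
    linarith


/-! ### Dyadic grids -/

/-- The `i`-th point of the partition of `[0, T]` into `2 ^ n` intervals of equal length. -/
def grid (T : ℝ≥0) (n i : ℕ) : ℝ≥0 := T * i / 2 ^ n

theorem grid_zero (T : ℝ≥0) (n : ℕ) : grid T n 0 = 0 := by simp [grid]

theorem grid_last (T : ℝ≥0) (n : ℕ) : grid T n (2 ^ n) = T := by simp [grid]

theorem grid_mono (T : ℝ≥0) (n : ℕ) : Monotone (grid T n) := by
  intro i j hij
  unfold grid
  gcongr

theorem grid_le {T : ℝ≥0} {n i : ℕ} (hi : i ≤ 2 ^ n) : grid T n i ≤ T :=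
  (grid_mono T n hi).trans_eq (grid_last T n)

theorem grid_succ (T : ℝ≥0) (n i : ℕ) : grid T n (i + 1) = grid T n i + T / 2 ^ n := by
  simp only [grid, Nat.cast_add, Nat.cast_one]
  ring

theorem grid_double (T : ℝ≥0) (n i : ℕ) : grid T (n + 1) (2 * i) = grid T n i := by
  simp only [grid, Nat.cast_mul, pow_succ]
  push_cast
  rw [show T * (2 * (i : ℝ≥0)) = (T * i) * 2 by ring, mul_div_mul_right _ _ two_ne_zero]

/-- The largest point of the `n`-th dyadic grid below `s`. -/
def dfloor (T : ℝ≥0) (n : ℕ) (s : ℝ≥0) : ℝ≥0 := grid T n ⌊s * 2 ^ n / T⌋₊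

theorem dfloor_le {T : ℝ≥0} (hT : 0 < T) (n : ℕ) (s : ℝ≥0) : dfloor T n s ≤ s := by
  have h := Nat.floor_le (zero_le (a := s * 2 ^ n / T))
  rw [le_div_iff₀ hT] at h
  rw [dfloor, grid, div_le_iff₀ (by positivity), mul_comm]
  exact h

theorem lt_dfloor_add {T : ℝ≥0} (hT : 0 < T) (n : ℕ) (s : ℝ≥0) :
    s < dfloor T n s + T / 2 ^ n := by
  have h := Nat.lt_floor_add_one (s * 2 ^ n / T)
  rw [div_lt_iff₀ hT] at h
  rw [dfloor, grid, ← add_div, lt_div_iff₀ (by positivity)]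
  calc _ < _ := h
    _ = _ := by ring

theorem dfloor_eq_grid {T : ℝ≥0} (hT : 0 < T) {n i : ℕ} {s : ℝ≥0} (h1 : grid T n i ≤ s)
    (h2 : s < grid T n (i + 1)) : dfloor T n s = grid T n i := by
  rw [dfloor]
  congr 1
  rw [Nat.floor_eq_iff (zero_le)]
  rw [grid, div_le_iff₀ (by positivity)] at h1
  rw [grid, lt_div_iff₀ (by positivity)] at h2
  rw [le_div_iff₀ hT, div_lt_iff₀ hT]
  constructor
  · rwa [mul_comm]
  · calc _ < _ := h2
      _ = _ := by push_cast; ring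

theorem tendsto_mesh (T : ℝ≥0) : Tendsto (fun n : ℕ => T / 2 ^ n) atTop (𝓝 0) := by
  have h0 : Tendsto (fun n : ℕ => (2⁻¹ : ℝ≥0) ^ n) atTop (𝓝 0) :=
    NNReal.tendsto_pow_atTop_nhds_zero_of_lt_one (inv_lt_one_of_one_lt₀ one_lt_two)
  have h : Tendsto (fun n : ℕ => T * (2⁻¹ : ℝ≥0) ^ n) atTop (𝓝 (T * 0)) := h0.const_mul T
  simpa [div_eq_mul_inv] using h

theorem tendsto_dfloor {T : ℝ≥0} (hT : 0 < T) (s : ℝ≥0) :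
    Tendsto (fun n => dfloor T n s) atTop (𝓝 s) := by
  have h : Tendsto (fun n : ℕ => s - T / 2 ^ n) atTop (𝓝 (s - 0)) :=
    tendsto_const_nhds.sub (tendsto_mesh T)
  rw [tsub_zero] at h
  refine tendsto_of_tendsto_of_tendsto_of_le_of_le h tendsto_const_nhds (fun n => ?_)
    fun n => dfloor_le hT n s
  exact tsub_le_iff_right.2 (lt_dfloor_add hT n s).le

theorem measurable_dfloor (T : ℝ≥0) (n : ℕ) : Measurable (dfloor T n) := by
  have h1 : Measurable fun s : ℝ≥0 => ⌊s * 2 ^ n / T⌋₊ :=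
    Nat.measurable_floor.comp ((measurable_id.mul_const _).div_const _)
  exact (measurable_from_nat (f := grid T n)).comp h1

/-- If each fixed time is almost surely a limit of dyadic values, then almost every path is almost
everywhere the limit of its dyadic values. -/
theorem ae_ae_tendsto_dfloor {Ω : Type*} {m : MeasurableSpace Ω} {P : Measure Ω} [SFinite P]
    {y : ℝ≥0 → Ω → ℝ} (hy : Measurable (Function.uncurry y)) {T : ℝ≥0} {A : Set Ω}
    (hA : MeasurableSet A)
    (h : ∀ s ≤ T, ∀ᵐ ω ∂P, ω ∈ A →
      Tendsto (fun n => y (dfloor T n s) ω) atTop (𝓝 (y s ω))) :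
    ∀ᵐ ω ∂P, ω ∈ A → ∀ᵐ s ∂(volume.restrict (Set.Icc (0 : ℝ) T)),
      Tendsto (fun n => y (dfloor T n s.toNNReal) ω) atTop (𝓝 (y s.toNNReal ω)) := by
  -- This event involves only `y` and its own dyadic values. Fubini therefore applies without joint
  -- measurability of the right-hand side of the equation for `y`.
  have hm : MeasurableSet {q : ℝ × Ω | Tendsto (fun n => y (dfloor T n q.1.toNNReal) q.2) atTop
      (𝓝 (y q.1.toNNReal q.2))} := by
    refine measurableSet_tendsto_fun (fun n => ?_) ?_
    · exact hy.comp (((measurable_dfloor T n).comp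
        (measurable_real_toNNReal.comp measurable_fst)).prodMk measurable_snd)
    · exact hy.comp ((measurable_real_toNNReal.comp measurable_fst).prodMk measurable_snd)
  have hm2 : MeasurableSet {q : ℝ × Ω | q.2 ∈ A →
      Tendsto (fun n => y (dfloor T n q.1.toNNReal) q.2) atTop (𝓝 (y q.1.toNNReal q.2))} :=
    (measurable_snd hA).imp hm
  have h1 : ∀ᵐ s ∂(volume.restrict (Set.Icc (0 : ℝ) T)), ∀ᵐ ω ∂P, ω ∈ A →
      Tendsto (fun n => y (dfloor T n s.toNNReal) ω) atTop (𝓝 (y s.toNNReal ω)) := by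
    refine (ae_restrict_iff' measurableSet_Icc).2 (ae_of_all _ fun s hs => h _ ?_)
    exact Real.toNNReal_le_iff_le_coe.2 hs.2
  have h2 := (Measure.ae_ae_comm (μ := volume.restrict (Set.Icc (0 : ℝ) T)) (ν := P)
    (p := fun s ω => ω ∈ A →
      Tendsto (fun n => y (dfloor T n s.toNNReal) ω) atTop (𝓝 (y s.toNNReal ω))) hm2).1 h1
  filter_upwards [h2] with ω hω hωA
  filter_upwards [hω] with s hs using hs hωA

/-! ### The upper bound for the explosion time -/

theorem integral_eq_halfSq {k a : ℝ → ℝ} {lam t : ℝ}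
    (hk : IntervalIntegrable (fun r => k r ^ 2) volume 0 t)
    (ha : IntervalIntegrable (fun r => a r ^ 2) volume 0 t) :
    ∫ r in (0 : ℝ)..t, (1 / 2 * lam * k r ^ 2 + 1 / 2 * a r ^ 2) =
      lam * halfSq k t + halfSq a t := by
  rw [intervalIntegral.integral_add (hk.const_mul _) (ha.const_mul _),
    intervalIntegral.integral_const_mul, intervalIntegral.integral_const_mul, halfSq, halfSq]
  ring

/-- If `τ*` were smaller than `τ`, the threshold would be reached at some `t < τ`, hence, the
integrand being positive, also at a rational between `t` and `τ`, against `h`. Rational times allow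
`h` to be secured off a single null set. For `p = 0` the threshold is infinite, while the integral
over a bounded interval is finite. -/
theorem le_tauStar_of_integral_lt {Ω : Type*} {k a : ℝ → ℝ} {C β lam p : ℝ} (hC : 0 < C)
    (hβ : 0 < β) (hp : 0 ≤ p) {N : ℝ≥0 → Ω → ℝ} {ω : Ω}
    (hk : ∀ t : ℝ, 0 ≤ t → IntervalIntegrable (fun r => k r ^ 2) volume 0 t)
    (ha : ∀ t : ℝ, 0 ≤ t → IntervalIntegrable (fun r => a r ^ 2) volume 0 t)
    (hN : Continuous fun t => N t ω) {τ : ℝ≥0∞}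
    (h : ∀ q : ℚ, 0 ≤ q → ((q : ℝ).toNNReal : ℝ≥0∞) < τ → 0 < p →
      C * β * ∫ s in (0 : ℝ)..((q : ℝ).toNNReal : ℝ),
        Real.exp (-β * (∫ r in (0 : ℝ)..s, (1 / 2 * lam * k r ^ 2 + 1 / 2 * a r ^ 2)) +
          β * N s.toNNReal ω) < p ^ (-β)) :
    τ ≤ tauStar k a C β lam p N ω := by
  by_contra hlt
  rw [not_le] at hlt
  unfold tauStar at hlt
  simp only [iInf_lt_iff] at hlt
  obtain ⟨t, ⟨-, ht⟩, htτ⟩ := hlt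
  obtain ⟨q, hq0, htq, hqτ⟩ := ENNReal.lt_iff_exists_rat_btwn.1 htτ
  set T : ℝ≥0 := (q : ℝ).toNNReal with hTdef
  have htT : t ≤ T := (ENNReal.coe_lt_coe.1 htq).le
  have hT : (0 : ℝ) ≤ T := T.2
  have hu : Set.uIcc (0 : ℝ) T = Set.Icc (0 : ℝ) T := Set.uIcc_of_le hT
  set F : ℝ → ℝ := fun s => Real.exp (-β * (∫ r in (0 : ℝ)..s,
    (1 / 2 * lam * k r ^ 2 + 1 / 2 * a r ^ 2)) + β * N s.toNNReal ω) with hF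
  have hκ : IntervalIntegrable (fun r => 1 / 2 * lam * k r ^ 2 + 1 / 2 * a r ^ 2) volume 0 T :=
    ((hk T hT).const_mul _).add ((ha T hT).const_mul _)
  have hFc : ContinuousOn F (Set.Icc (0 : ℝ) T) := by
    have h1 : ContinuousOn (fun s => ∫ r in (0 : ℝ)..s,
        (1 / 2 * lam * k r ^ 2 + 1 / 2 * a r ^ 2)) (Set.Icc (0 : ℝ) T) :=
      hu ▸ (hκ.absolutelyContinuousOnInterval_intervalIntegral (by simp)).continuousOn
    have h2 : Continuous fun s : ℝ => N s.toNNReal ω := hN.comp continuous_real_toNNReal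
    exact ((continuousOn_const.mul h1).add (continuousOn_const.mul h2.continuousOn)).rexp
  have hFi : IntegrableOn F (Set.Icc (0 : ℝ) T) := hFc.integrableOn_compact isCompact_Icc
  have hbound : ENNReal.ofReal (1 / (C * β)) * ENNReal.ofReal p ^ (-β) ≤
      ENNReal.ofReal (∫ s in (0 : ℝ)..T, F s) := by
    refine ht.trans ?_
    rw [intervalIntegral.integral_of_le hT, ← integral_Icc_eq_integral_Ioc,
      ofReal_integral_eq_lintegral_ofReal hFi (ae_of_all _ fun s => (Real.exp_pos _).le)]
    refine (lintegral_mono_set (Set.Icc_subset_Icc_right (by exact_mod_cast htT))).trans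
      (le_of_eq ?_)
    refine setLIntegral_congr_fun measurableSet_Icc fun s hs => ?_
    simp only [hF]
    rw [integral_eq_halfSq (hk s hs.1) (ha s hs.1)]
  rcases hp.eq_or_lt with hp0 | hp0
  · rw [← hp0, ENNReal.ofReal_zero, ENNReal.zero_rpow_of_neg (by linarith), ENNReal.mul_top
      (by simp only [ne_eq, ENNReal.ofReal_eq_zero, not_le]; positivity)] at hbound
    exact ENNReal.ofReal_ne_top (top_le_iff.1 hbound)
  · rw [ENNReal.ofReal_rpow_of_pos hp0, ← ENNReal.ofReal_mul (by positivity),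
      ENNReal.ofReal_le_ofReal_iff
        (intervalIntegral.integral_nonneg hT fun s _ => (Real.exp_pos _).le)] at hbound
    have h1 := h q hq0 hqτ hp0
    rw [one_div, inv_mul_le_iff₀ (by positivity)] at hbound
    exact absurd h1 (not_lt.2 hbound)

/-- A process `w` satisfying at each fixed time the integrated linear equation with a
superlinear source does not live beyond `τ*`. -/
theorem ae_le_tauStar {Ω : Type*} {m : MeasurableSpace Ω} {P : Measure Ω} [SFinite P]
    {k a : ℝ → ℝ} {C β lam p : ℝ} (hC : 0 < C) (hβ : 0 < β) (hp : 0 ≤ p)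
    (hk : ∀ t : ℝ, 0 ≤ t → IntervalIntegrable (fun r => k r ^ 2) volume 0 t)
    (ha : ∀ t : ℝ, 0 ≤ t → IntervalIntegrable (fun r => a r ^ 2) volume 0 t)
    {N w y : ℝ≥0 → Ω → ℝ} {Γ : ℝ → Ω → ℝ} (hN : ∀ᵐ ω ∂P, Continuous fun t => N t ω)
    (hy : Measurable (Function.uncurry y))
    (hyw : ∀ᵐ ω ∂P, ∃ c : ℝ≥0 → ℝ, Continuous c ∧ (∀ t, 0 < c t) ∧ ∀ t, y t ω = c t * w t ω)
    {τ : Ω → ℝ≥0∞} (hτ : ∀ t : ℝ≥0, MeasurableSet {ω | (t : ℝ≥0∞) < τ ω})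
    (hw : ∀ t : ℝ≥0, ∀ᵐ ω ∂P, (t : ℝ≥0∞) < τ ω →
      IntervalIntegrable (fun s => (1 / 2 * lam * k s ^ 2 + 1 / 2 * a s ^ 2) * w s.toNNReal ω)
        volume 0 t ∧
      IntervalIntegrable (fun s => Γ s ω) volume 0 t ∧
      (∀ᵐ s ∂(volume.restrict (Set.Icc (0 : ℝ) t)),
        C * Real.exp (β * N s.toNNReal ω) * (max (w s.toNNReal ω) 0) ^ (1 + β) ≤ Γ s ω) ∧
      w t ω = p - (∫ s in (0 : ℝ)..t,
          (1 / 2 * lam * k s ^ 2 + 1 / 2 * a s ^ 2) * w s.toNNReal ω) +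
        ∫ s in (0 : ℝ)..t, Γ s ω) :
    ∀ᵐ ω ∂P, τ ω ≤ tauStar k a C β lam p N ω := by
  have key : ∀ q : ℚ, ∀ᵐ ω ∂P, ((q : ℝ).toNNReal : ℝ≥0∞) < τ ω → 0 < p →
      C * β * ∫ s in (0 : ℝ)..((q : ℝ).toNNReal : ℝ),
        Real.exp (-β * (∫ r in (0 : ℝ)..s, (1 / 2 * lam * k r ^ 2 + 1 / 2 * a r ^ 2)) +
          β * N s.toNNReal ω) < p ^ (-β) := by
    intro q
    set T : ℝ≥0 := (q : ℝ).toNNReal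
    rcases eq_zero_or_pos T with hT0 | hT
    · refine ae_of_all _ fun ω _ hp0 => ?_
      rw [hT0]
      simpa using Real.rpow_pos_of_pos hp0 _
    have hT' : (0 : ℝ) ≤ T := T.2
    have hu : Set.uIcc (0 : ℝ) T = Set.Icc (0 : ℝ) T := Set.uIcc_of_le hT'
    set κ : ℝ → ℝ := fun s => 1 / 2 * lam * k s ^ 2 + 1 / 2 * a s ^ 2 with hκ
    have hκi : IntervalIntegrable κ volume 0 T :=
      ((hk T hT').const_mul _).add ((ha T hT').const_mul _)
    -- The continuous version of `w`. At each fixed time it equals `w` off a null set depending on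
    -- the time; the comparison lemma needs the equality for almost every time of one path.
    set Φ : Ω → ℝ → ℝ := fun ω t => p - (∫ s in (0 : ℝ)..t, κ s * w s.toNNReal ω) +
      ∫ s in (0 : ℝ)..t, Γ s ω with hΦ
    have hΦc : ∀ᵐ ω ∂P, (T : ℝ≥0∞) < τ ω → ContinuousOn (Φ ω) (Set.Icc 0 T) := by
      filter_upwards [hw T] with ω h1 h2
      obtain ⟨h3, h4, -, -⟩ := h1 h2
      have h5 := (h3.absolutelyContinuousOnInterval_intervalIntegral
        (c := 0) (by simp)).continuousOn
      have h6 := (h4.absolutelyContinuousOnInterval_intervalIntegral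
        (c := 0) (by simp)).continuousOn
      rw [hu] at h5 h6
      exact (continuousOn_const.sub h5).add h6
    have heq : ∀ s ≤ T, ∀ᵐ ω ∂P, (T : ℝ≥0∞) < τ ω → w s ω = Φ ω s := by
      intro s hs
      filter_upwards [hw s] with ω h1 h2
      exact (h1 (lt_of_le_of_lt (by exact_mod_cast hs) h2)).2.2.2
    have hgrid : ∀ᵐ ω ∂P, ∀ n i, i ≤ 2 ^ n → (T : ℝ≥0∞) < τ ω →
        w (grid T n i) ω = Φ ω (grid T n i) := by
      rw [ae_all_iff]; intro n
      rw [ae_all_iff]; intro i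
      by_cases hi : i ≤ 2 ^ n
      · filter_upwards [heq _ (grid_le hi)] with ω h _ using h
      · exact ae_of_all _ fun ω h => absurd h hi
    have hfl : ∀ᵐ ω ∂P, (T : ℝ≥0∞) < τ ω → ∀ s ≤ T,
        Tendsto (fun n => w (dfloor T n s) ω) atTop (𝓝 (Φ ω s)) := by
      filter_upwards [hΦc, hgrid] with ω h1 h2 h3 s hs
      have h4 : Tendsto (fun n => Φ ω (dfloor T n s)) atTop (𝓝 (Φ ω s)) := by
        refine ((h1 h3) s ⟨s.2, by exact_mod_cast hs⟩).tendsto.comp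
          (tendsto_nhdsWithin_iff.2 ⟨?_, Eventually.of_forall fun n => ⟨NNReal.coe_nonneg _, ?_⟩⟩)
        · exact (NNReal.continuous_coe.tendsto s).comp (tendsto_dfloor hT s)
        · exact_mod_cast (dfloor_le hT n s).trans hs
      refine h4.congr fun n => (h2 n _ ?_ h3).symm
      refine Nat.floor_le_of_le ?_
      rw [div_le_iff₀ hT]
      push_cast
      rw [mul_comm]
      gcongr
    -- The Fubini argument runs with `y`, since `w = y / c` need not be jointly measurable: for the
    -- stochastic equation `c = e^N`, and no joint measurability of `N` is assumed.
    have hyfl : ∀ᵐ ω ∂P, ω ∈ {ω | (T : ℝ≥0∞) < τ ω} →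
        ∀ᵐ s ∂(volume.restrict (Set.Icc (0 : ℝ) T)),
        Tendsto (fun n => y (dfloor T n s.toNNReal) ω) atTop (𝓝 (y s.toNNReal ω)) := by
      refine ae_ae_tendsto_dfloor hy (hτ T) fun s hs => ?_
      filter_upwards [hfl, heq s hs, hyw] with ω h1 h2 ⟨c, hc, _, hcw⟩ h3
      simp only [hcw]
      rw [h2 h3]
      exact ((hc.tendsto s).comp (tendsto_dfloor hT s)).mul (h1 h3 s hs)
    filter_upwards [hyfl, hfl, hΦc, hw T, hN, hyw] with ω h1 h2 h3 h4 h5 hcω hTτ hp0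
    obtain ⟨c, hc, hc0, hcw⟩ := hcω
    obtain ⟨hwi, hΓi, hΓle, -⟩ := h4 hTτ
    -- Both `c w` and `c Φ` are limits of the same dyadic values of `y`, and `c > 0` can be
    -- cancelled.
    have hae : ∀ᵐ s ∂(volume.restrict (Set.Icc (0 : ℝ) T)), w s.toNNReal ω = Φ ω s := by
      filter_upwards [h1 hTτ, ae_restrict_mem measurableSet_Icc] with s hs hsT
      simp only [hcw] at hs
      have hsT' : s.toNNReal ≤ T := Real.toNNReal_le_iff_le_coe.2 hsT.2
      have h6 := ((hc.tendsto s.toNNReal).comp (tendsto_dfloor hT s.toNNReal)).mul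
        (h2 hTτ s.toNNReal hsT')
      rw [Real.coe_toNNReal s hsT.1] at h6
      exact mul_left_cancel₀ (hc0 _).ne' (tendsto_nhds_unique hs h6)
    refine integral_exp_lt_of_riccati (Φ := Φ ω) (Γ := fun s => Γ s ω) hT' hp0 hC hβ hκi hΓi
      (h5.comp continuous_real_toNNReal).continuousOn (h3 hTτ) (fun t ht => ?_) ?_
    · simp only [hΦ]
      congr 2
      refine intervalIntegral.integral_congr_ae_restrict ?_
      rw [Set.uIoc_of_le ht.1]
      have hsub : Set.Ioc 0 t ⊆ Set.Icc (0 : ℝ) T :=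
        fun s hs => ⟨hs.1.le, hs.2.trans ht.2⟩
      filter_upwards [ae_mono (Measure.restrict_mono hsub le_rfl) hae] with s hs
      rw [hs]
    · refine (ae_restrict_iff' measurableSet_Icc).1 ?_
      filter_upwards [hae, hΓle] with s hs1 hs2
      rwa [hs1] at hs2
  rw [← ae_all_iff] at key
  filter_upwards [key, hN] with ω h1 h2
  exact le_tauStar_of_integral_lt hC hβ hp hk ha h2 fun q _ => h1 q


/-! ### The pairing -/

section Pairing

variable {d : ℕ} {D : Set (EuclideanSpace ℝ (Fin d))}

theorem pairing_eq_inner (h f : L2 D) : pairing D h f = inner ℝ h f := by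
  rw [L2.inner_def, pairing]
  refine integral_congr_ae (ae_of_all _ fun x => ?_)
  simp [mul_comm]

theorem pairing_neg_smul (h f : L2 D) (c : ℝ) :
    pairing D h (-(c • f) : L2 D) = -(c * pairing D h f) := by
  rw [pairing_eq_inner, pairing_eq_inner, inner_neg_right, inner_smul_right]

theorem continuous_pairing (f : L2 D) : Continuous fun h : L2 D => pairing D h f := by
  simp_rw [pairing_eq_inner]
  fun_prop

theorem integrable_mul_L2 (h f : L2 D) : Integrable (fun x => h x * f x) (volume.restrict D) :=
  (Lp.memLp h).integrable_mul (Lp.memLp f)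

theorem pairing_nonneg {f h : EuclideanSpace ℝ (Fin d) → ℝ}
    (hf : ∀ᵐ x ∂(volume.restrict D), 0 ≤ f x) (hh : ∀ᵐ x ∂(volume.restrict D), 0 < h x) :
    0 ≤ pairing D f h := by
  refine integral_nonneg_of_ae ?_
  filter_upwards [hf, hh] with x h1 h2 using mul_nonneg h1 h2.le

theorem integrable_of_integral_eq_one {X : Type*} [MeasurableSpace X] {ν : Measure X} {f : X → ℝ}
    (h : ∫ x, f x ∂ν = 1) : Integrable f ν := by
  by_contra hf
  rw [integral_undef hf] at h
  exact zero_ne_one h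

end Pairing

/-! ### Blowup -/

section Blowup

variable {d : ℕ} {D : Set (EuclideanSpace ℝ (Fin d))}

/-- Near `T` the factor `c` exceeds the positive constant `c T / 2`, which cannot make an infinite
upper limit finite. -/
theorem BlowsUpAt.smul_of_continuous {v : ℝ≥0 → L2 D} {T : ℝ≥0} (hv : BlowsUpAt D v T)
    {c : ℝ≥0 → ℝ} (hc : Continuous c) (hc0 : ∀ t, 0 < c t) :
    BlowsUpAt D (fun t => c t • v t) T := by
  unfold BlowsUpAt at hv ⊢
  obtain ⟨ε, hε0, hε⟩ : ∃ ε : ℝ≥0, 0 < ε ∧ (ε : ℝ) < c T := by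
    refine ⟨⟨c T / 2, by have := hc0 T; positivity⟩, ?_, ?_⟩
    · exact_mod_cast half_pos (hc0 T)
    · exact half_lt_self (hc0 T)
  have h1 : ∀ᶠ t in 𝓝[<] T, (ε : ℝ) < c t :=
    nhdsWithin_le_nhds ((hc.tendsto T).eventually (eventually_gt_nhds hε))
  have h2 : limsup (fun t : ℝ≥0 => (ε : ℝ≥0∞) * eLpNorm (v t) ⊤ (volume.restrict D)) (𝓝[<] T) ≤
      limsup (fun t : ℝ≥0 => eLpNorm (c t • v t : L2 D) ⊤ (volume.restrict D)) (𝓝[<] T) := by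
    refine limsup_le_limsup ?_
    filter_upwards [h1] with t ht
    rw [eLpNorm_congr_ae (Lp.coeFn_smul (c t) (v t)), eLpNorm_const_smul]
    gcongr
    rw [← ofReal_norm, Real.norm_of_nonneg (hc0 t).le]
    rw [← ENNReal.ofReal_coe_nnreal]
    exact ENNReal.ofReal_le_ofReal ht.le
  rw [ENNReal.limsup_const_mul_of_ne_top ENNReal.coe_ne_top, hv,
    ENNReal.mul_top (by exact_mod_cast hε0.ne')] at h2
  exact top_le_iff.1 h2

variable {Ω : Type*} {m : MeasurableSpace Ω} {P : Measure Ω}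

theorem blowup_of_le_tauStar {v : ℝ≥0 → Ω → L2 D} {τ τs : Ω → ℝ≥0∞}
    {N : ℝ≥0 → Ω → ℝ} (hN : ∀ᵐ ω ∂P, Continuous fun t => N t ω) (h : ∀ᵐ ω ∂P, τ ω ≤ τs ω)
    (hτ : IsBlowupTime P D v τ) :
    ∀ᵐ ω ∂P, τs ω < ⊤ →
        τ ω < ⊤ ∧
        BlowsUpAt D (fun t => v t ω) (τ ω).toNNReal ∧
        BlowsUpAt D (fun t => Real.exp (N t ω) • v t ω) (τ ω).toNNReal := by
  filter_upwards [hN, h, hτ] with ω h1 h2 h3 h4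
  have h5 := lt_of_le_of_lt h2 h4
  exact ⟨h5, h3 h5, (h3 h5).smul_of_continuous h1.rexp fun t => Real.exp_pos _⟩

end Blowup

/-! ### The random equation -/

section Random

variable {d : ℕ} {D : Set (EuclideanSpace ℝ (Fin d))} {Ω : Type*} {m : MeasurableSpace Ω}
  {P : Measure Ω} {𝓕 : Filtration ℝ≥0 m}

theorem IsFieldUpTo.measurableSet_lt {v : ℝ≥0 → Ω → L2 D} {τ : Ω → ℝ≥0∞}
    (hv : IsFieldUpTo P 𝓕 D v τ) (t : ℝ≥0) : MeasurableSet {ω | (t : ℝ≥0∞) < τ ω} := by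
  have h := 𝓕.le t _ (hv.stopping t)
  have h2 : {ω | (t : ℝ≥0∞) < τ ω} = {ω | τ ω ≤ (t : ℝ≥0∞)}ᶜ := by
    ext ω; simp
  rw [h2]
  exact h.compl

theorem IsFieldUpTo.measurable_pairing {v : ℝ≥0 → Ω → L2 D} {τ : Ω → ℝ≥0∞}
    (hv : IsFieldUpTo P 𝓕 D v τ) (f : L2 D) :
    Measurable (Function.uncurry fun t ω => pairing D (v t ω) f) :=
  ((continuous_pairing f).comp_stronglyMeasurable hv.measurable).measurable

theorem IsFieldUpTo.adapted_pairing {v : ℝ≥0 → Ω → L2 D} {τ : Ω → ℝ≥0∞}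
    (hv : IsFieldUpTo P 𝓕 D v τ) (f : L2 D) (t : ℝ≥0) :
    Measurable[𝓕 t] fun ω => pairing D (v t ω) f :=
  ((continuous_pairing f).comp_stronglyMeasurable (hv.adapted t)).measurable

theorem intervalIntegrable_sq_of_continuousOn {a : ℝ → ℝ} (ha : ContinuousOn a (Set.Ici 0))
    (t : ℝ) (ht : 0 ≤ t) : IntervalIntegrable (fun r => a r ^ 2) volume 0 t := by
  refine ContinuousOn.intervalIntegrable ?_
  rw [Set.uIcc_of_le ht]
  exact (ha.pow 2).mono Set.Icc_subset_Ici_self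

/-- The equation tested with `φ₀` is already the scalar equation. Jensen's inequality for `e^N v`
gives `Γ ≥ C e^{-N} (e^N w)₊^{1+β} = C e^{βN} w₊^{1+β}`. -/
theorem IsWeakSolutionRPDE.ae_le_tauStar [SFinite P] {L : L2 D →ₗ.[ℝ] L2 D}
    {lam : ℝ} (hlam : 0 < lam) {φ₀ : L.adjoint.domain}
    (hφ₀eig : L.adjoint φ₀ = -(lam • (φ₀ : L2 D)))
    (hφ₀pos : ∀ᵐ x ∂(volume.restrict D), 0 < (φ₀ : L2 D) x)
    (hφ₀int : ∫ x in D, (φ₀ : L2 D) x = 1)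
    {φ : EuclideanSpace ℝ (Fin d) → ℝ} (hφ0 : ∀ᵐ x ∂(volume.restrict D), 0 ≤ φ x)
    {g : ℝ → ℝ} (hg0 : ∀ z, 0 ≤ g z)
    {C β : ℝ} (hC : 0 < C) (hβ : 0 < β) (hgC : ∀ z, 0 < z → C * z ^ (1 + β) ≤ g z)
    {k a : ℝ → ℝ} (hk : ∀ t : ℝ, 0 ≤ t → IntervalIntegrable (fun r => k r ^ 2) volume 0 t)
    (ha : ContinuousOn a (Set.Ici 0))
    {N : ℝ≥0 → Ω → ℝ} (hN : ∀ᵐ ω ∂P, Continuous fun t => N t ω)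
    {v : ℝ≥0 → Ω → L2 D} {τ : Ω → ℝ≥0∞} (hv : IsWeakSolutionRPDE P 𝓕 D L k a g φ N v τ) :
    ∀ᵐ ω ∂P, τ ω ≤ tauStar k a C β lam (pairing D φ (φ₀ : L2 D)) N ω := by
  refine MixedSPDE.ae_le_tauStar (w := fun t ω => pairing D (v t ω) (φ₀ : L2 D))
    (y := fun t ω => pairing D (v t ω) (φ₀ : L2 D))
    (Γ := fun s ω => Real.exp (-N s.toNNReal ω) * pairing D
        (fun x => g (Real.exp (N s.toNNReal ω) * v s.toNNReal ω x)) (φ₀ : L2 D))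
    hC hβ (pairing_nonneg hφ0 hφ₀pos) hk
    (intervalIntegrable_sq_of_continuousOn ha) hN (hv.measurable_pairing _)
    (ae_of_all _ fun ω => ⟨fun _ => 1, continuous_const, fun _ => one_pos, fun t => by simp⟩)
    hv.measurableSet_lt fun t => ?_
  filter_upwards [hv.weak t φ₀] with ω h1 htτ
  obtain ⟨hi1, hi2, hi3, hi4, heq⟩ := h1 htτ
  simp only [hφ₀eig, pairing_neg_smul] at hi1 heq
  -- Integrability is given for the pairing with `L*φ₀ = -λφ₀`; dividing by `λ > 0` transfers it to
  -- the pairing with `φ₀`.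
  have hk' : IntervalIntegrable
      (fun s => k s ^ 2 * pairing D (v s.toNNReal ω) (φ₀ : L2 D)) volume 0 t := by
    refine (hi1.const_mul (-lam⁻¹)).congr (fun s _ => ?_)
    field_simp
  have hint : IntervalIntegrable (fun s => (1 / 2 * lam * k s ^ 2 + 1 / 2 * a s ^ 2) *
      pairing D (v s.toNNReal ω) (φ₀ : L2 D)) volume 0 t := by
    refine ((hk'.const_mul (1 / 2 * lam)).add (hi2.const_mul (1 / 2))).congr (fun s _ => ?_)
    ring
  refine ⟨hint, hi4, ?_, ?_⟩
  · filter_upwards [hi3] with s hs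
    have h2 := rpow_integral_le_integral_comp (ν := volume.restrict D) hC hβ hg0 hgC
      (h := fun x => Real.exp (N s.toNNReal ω) * v s.toNNReal ω x) (ψ := (φ₀ : L2 D))
      (hφ₀pos.mono fun x hx => hx.le) (integrable_of_integral_eq_one hφ₀int) hφ₀int
      (by simpa only [mul_assoc] using
        (integrable_mul_L2 (v s.toNNReal ω) (φ₀ : L2 D)).const_mul (Real.exp (N s.toNNReal ω)))
      hs
    have h3 : ∫ x in D, Real.exp (N s.toNNReal ω) * v s.toNNReal ω x * (φ₀ : L2 D) x =
        Real.exp (N s.toNNReal ω) * pairing D (v s.toNNReal ω) (φ₀ : L2 D) := by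
      simp only [mul_assoc, integral_const_mul, pairing]
    have h4 : max (Real.exp (N s.toNNReal ω) * pairing D (v s.toNNReal ω) (φ₀ : L2 D)) 0 =
        Real.exp (N s.toNNReal ω) * max (pairing D (v s.toNNReal ω) (φ₀ : L2 D)) 0 := by
      rw [mul_max_of_nonneg _ _ (Real.exp_pos _).le, mul_zero]
    rw [h3, h4, Real.mul_rpow (Real.exp_pos _).le (le_max_right _ _), ← Real.exp_mul] at h2
    have h5 : Real.exp (β * N s.toNNReal ω) =
        Real.exp (-N s.toNNReal ω) * Real.exp (N s.toNNReal ω * (1 + β)) := by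
      rw [← Real.exp_add]; ring_nf
    rw [h5]
    calc _ = Real.exp (-N s.toNNReal ω) * (C * (Real.exp (N s.toNNReal ω * (1 + β)) *
          max (pairing D (v s.toNNReal ω) (φ₀ : L2 D)) 0 ^ (1 + β))) := by ring
      _ ≤ _ := mul_le_mul_of_nonneg_left h2 (Real.exp_pos _).le
  · rw [heq, sub_eq_add_neg, ← intervalIntegral.integral_neg]
    congr 2
    refine intervalIntegral.integral_congr fun s _ => ?_
    ring

end Random


/-! ### Discrete stochastic integrals -/

/-- Square integrable centred innovations `D j`, independent of the past `G j`. -/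
structure IsInnovation {Ω : Type*} {m : MeasurableSpace Ω} (P : Measure Ω)
    (G : Filtration ℕ m) (D : ℕ → Ω → ℝ) (v : ℕ → ℝ) : Prop where
  meas : ∀ j, Measurable[G (j + 1)] (D j)
  indep : ∀ j, Indep (MeasurableSpace.comap (D j) inferInstance) (G j) P
  memLp : ∀ j, MemLp (D j) 2 P
  mean : ∀ j, ∫ ω, D j ω ∂P = 0
  var : ∀ j, ∫ ω, D j ω ^ 2 ∂P = v j

namespace IsInnovation

variable {Ω : Type*} {m : MeasurableSpace Ω} {P : Measure Ω}
  {G : Filtration ℕ m} {D : ℕ → Ω → ℝ} {v : ℕ → ℝ}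

theorem var_nonneg (hD : IsInnovation P G D v) (j : ℕ) : 0 ≤ v j := by
  rw [← hD.var j]; exact integral_nonneg fun ω => sq_nonneg _

theorem indepFun (hD : IsInnovation P G D v) {j : ℕ} {X : Ω → ℝ} (hX : Measurable[G j] X) :
    IndepFun X (D j) P := by
  have h := (hD.indep j).symm
  exact indep_of_indep_of_le_left h hX.comap_le

theorem measurable (hD : IsInnovation P G D v) (j : ℕ) : Measurable (D j) :=
  (hD.meas j).mono (G.le _) le_rfl

theorem integral_sq_mul [IsProbabilityMeasure P] (hD : IsInnovation P G D v) {j : ℕ} {X : Ω → ℝ}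
    (hX : Measurable[G j] X) : ∫ ω, (X ω * D j ω) ^ 2 ∂P = ∫ ω, X ω ^ 2 * v j ∂P := by
  have h1 : IndepFun (fun ω => X ω ^ 2) (fun ω => D j ω ^ 2) P :=
    (hD.indepFun hX).comp (measurable_id.pow_const 2) (measurable_id.pow_const 2)
  have hXm : Measurable X := hX.mono (G.le _) le_rfl
  have h2 := h1.integral_fun_mul_eq_mul_integral (hXm.pow_const 2).aestronglyMeasurable
    ((hD.measurable j).pow_const 2).aestronglyMeasurable
  simp_rw [mul_pow]
  rw [h2, hD.var j, integral_mul_const]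

/-- The coefficient need not be bounded: where `v j = 0` the innovation vanishes almost surely, and
otherwise `X² ≤ δ / v j`. -/
theorem memLp_mul [IsProbabilityMeasure P] (hD : IsInnovation P G D v) {j : ℕ} {X : Ω → ℝ}
    (hX : Measurable[G j] X) {δ : ℝ} (hδ : ∀ ω, X ω ^ 2 * v j ≤ δ) :
    MemLp (fun ω => X ω * D j ω) 2 P := by
  have hXm : Measurable X := hX.mono (G.le _) le_rfl
  refine (memLp_two_iff_integrable_sq (hXm.mul (hD.measurable j)).aestronglyMeasurable).2 ?_
  simp only [Pi.mul_apply, mul_pow]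
  rcases (hD.var_nonneg j).eq_or_lt with h0 | h0
  · have h1 : (fun ω => D j ω ^ 2) =ᵐ[P] 0 := by
      rw [← integral_eq_zero_iff_of_nonneg (fun ω => sq_nonneg _) (hD.memLp j).integrable_sq,
        hD.var j, ← h0]
    refine (integrable_zero Ω ℝ P).congr ?_
    filter_upwards [h1] with ω hω
    simp only [Pi.zero_apply] at hω
    simp [hω]
  · have h1 : IndepFun (fun ω => X ω ^ 2) (fun ω => D j ω ^ 2) P :=
      (hD.indepFun hX).comp (measurable_id.pow_const 2) (measurable_id.pow_const 2)
    refine h1.integrable_mul ?_ (hD.memLp j).integrable_sq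
    refine Integrable.of_bound (hXm.pow_const 2).aestronglyMeasurable (δ / v j)
      (ae_of_all _ fun ω => ?_)
    rw [Real.norm_of_nonneg (sq_nonneg _), le_div_iff₀ h0]
    exact hδ ω

/-- All factors except `D j` are known to the past `G j`, and `D j` is centred and independent of
it. -/
theorem integral_mul_mul_eq_zero [IsProbabilityMeasure P] (hD : IsInnovation P G D v) {ξ : ℕ → Ω → ℝ}
    (hξ : ∀ j, Measurable[G j] (ξ j)) {i j : ℕ} (hij : i < j) :
    ∫ ω, (ξ i ω * D i ω) * (ξ j ω * D j ω) ∂P = 0 := by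
  have h1 : Measurable[G j] fun ω => ξ i ω * D i ω * ξ j ω :=
    (((hξ i).mono (G.mono hij.le) le_rfl).mul ((hD.meas i).mono (G.mono hij) le_rfl)).mul (hξ j)
  have h2 := (hD.indepFun h1).integral_fun_mul_eq_mul_integral
    (h1.mono (G.le _) le_rfl).aestronglyMeasurable (hD.measurable j).aestronglyMeasurable
  rw [hD.mean j, mul_zero] at h2
  rw [← h2]
  simp only [mul_assoc]

theorem integral_sum_sq [IsProbabilityMeasure P] (hD : IsInnovation P G D v) {ξ : ℕ → Ω → ℝ}
    (hξ : ∀ j, Measurable[G j] (ξ j)) {δ : ℝ} (hδ : ∀ j ω, ξ j ω ^ 2 * v j ≤ δ) (J : Finset ℕ) :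
    ∫ ω, (∑ j ∈ J, ξ j ω * D j ω) ^ 2 ∂P = ∑ j ∈ J, ∫ ω, ξ j ω ^ 2 * v j ∂P := by
  have hL := fun j => hD.memLp_mul (hξ j) (hδ j)
  simp_rw [sq (∑ j ∈ J, _), Finset.sum_mul_sum]
  have hI : ∀ i j, Integrable (fun ω => ξ i ω * D i ω * (ξ j ω * D j ω)) P := fun i j =>
    (hL i).integrable_mul (hL j)
  rw [integral_finsetSum _ fun i _ => integrable_finsetSum _ fun j _ => hI i j]
  refine Finset.sum_congr rfl fun i hi => ?_
  rw [integral_finsetSum _ fun j _ => hI i j,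
    Finset.sum_eq_single_of_mem i hi]
  · rw [← hD.integral_sq_mul (hξ i)]
    simp only [sq]
  · intro j _ hji
    rcases lt_or_gt_of_ne hji with h | h
    · rw [← hD.integral_mul_mul_eq_zero hξ h]
      simp only [mul_comm]
    · exact hD.integral_mul_mul_eq_zero hξ h

/-- Bessel-type inequality for disjoint blocks of a discrete stochastic integral. -/
theorem lintegral_blocks_le [IsProbabilityMeasure P] (hD : IsInnovation P G D v) {ξ : ℕ → Ω → ℝ}
    (hξ : ∀ j, Measurable[G j] (ξ j)) {δ : ℝ} {n : ℕ}
    (hδ : ∀ ω, ∑ j ∈ Finset.range n, ξ j ω ^ 2 * v j ≤ δ) {ι : Type*} (I : Finset ι)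
    (J : ι → Finset ℕ) (hJ : ∀ i ∈ I, J i ⊆ Finset.range n)
    (hdisj : Set.PairwiseDisjoint (I : Set ι) J) :
    ∫⁻ ω, ENNReal.ofReal (∑ i ∈ I, (∑ j ∈ J i, ξ j ω * D j ω) ^ 2) ∂P ≤ ENNReal.ofReal δ := by
  classical
  -- The energy bound covers only indices below `n`; cutting off the rest makes every `ζ j * D j`
  -- square integrable.
  set ζ : ℕ → Ω → ℝ := fun j ω => if j < n then ξ j ω else 0 with hζ
  have hζm : ∀ j, Measurable[G j] (ζ j) := by
    intro j
    by_cases hj : j < n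
    · simpa only [hζ, hj, if_true] using hξ j
    · simpa only [hζ, hj, if_false] using measurable_const
  have hnn : ∀ j ω, 0 ≤ ξ j ω ^ 2 * v j := fun j ω => mul_nonneg (sq_nonneg _) (hD.var_nonneg j)
  have hδ0 : ∀ ω : Ω, 0 ≤ δ := fun ω => (Finset.sum_nonneg fun j _ => hnn j ω).trans (hδ ω)
  have hζδ : ∀ j ω, ζ j ω ^ 2 * v j ≤ δ := by
    intro j ω
    by_cases hj : j < n
    · simp only [hζ, hj, if_true]
      exact (Finset.single_le_sum (f := fun j => ξ j ω ^ 2 * v j) (fun j _ => hnn j ω)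
        (Finset.mem_range.2 hj)).trans (hδ ω)
    · simpa [hζ, hj] using hδ0 ω
  have hζξ : ∀ i ∈ I, ∀ ω, ∑ j ∈ J i, ξ j ω * D j ω = ∑ j ∈ J i, ζ j ω * D j ω := by
    intro i hi ω
    refine Finset.sum_congr rfl fun j hj => ?_
    have := Finset.mem_range.1 (hJ i hi hj)
    simp [hζ, this]
  have hL := fun j => hD.memLp_mul (hζm j) (hζδ j)
  have hint : ∀ i, Integrable (fun ω => (∑ j ∈ J i, ζ j ω * D j ω) ^ 2) P := fun i =>
    (memLp_finsetSum (J i) fun j _ => hL j).integrable_sq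
  have hintv : ∀ j, Integrable (fun ω => ζ j ω ^ 2 * v j) P := by
    intro j
    refine Integrable.of_bound
      (((hζm j).mono (G.le _) le_rfl).pow_const 2 |>.mul_const _).aestronglyMeasurable δ
      (ae_of_all _ fun ω => ?_)
    rw [Real.norm_of_nonneg (mul_nonneg (sq_nonneg _) (hD.var_nonneg j))]
    exact hζδ j ω
  calc ∫⁻ ω, ENNReal.ofReal (∑ i ∈ I, (∑ j ∈ J i, ξ j ω * D j ω) ^ 2) ∂P
      = ∫⁻ ω, ENNReal.ofReal (∑ i ∈ I, (∑ j ∈ J i, ζ j ω * D j ω) ^ 2) ∂P := by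
        refine lintegral_congr fun ω => ?_
        congr 1
        exact Finset.sum_congr rfl fun i hi => by rw [hζξ i hi ω]
    _ = ENNReal.ofReal (∫ ω, ∑ i ∈ I, (∑ j ∈ J i, ζ j ω * D j ω) ^ 2 ∂P) := by
        rw [ofReal_integral_eq_lintegral_ofReal (integrable_finsetSum _ fun i _ => hint i)
          (ae_of_all _ fun ω => Finset.sum_nonneg fun i _ => sq_nonneg _)]
    _ = ENNReal.ofReal (∑ i ∈ I, ∑ j ∈ J i, ∫ ω, ζ j ω ^ 2 * v j ∂P) := by
        rw [integral_finsetSum _ fun i _ => hint i]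
        simp_rw [hD.integral_sum_sq hζm hζδ]
    _ ≤ ENNReal.ofReal (∑ j ∈ Finset.range n, ∫ ω, ζ j ω ^ 2 * v j ∂P) := by
        refine ENNReal.ofReal_le_ofReal ?_
        rw [← Finset.sum_biUnion hdisj]
        refine Finset.sum_le_sum_of_subset_of_nonneg (Finset.biUnion_subset.2 hJ) fun j _ _ => ?_
        exact integral_nonneg fun ω => mul_nonneg (sq_nonneg _) (hD.var_nonneg j)
    _ = ENNReal.ofReal (∫ ω, ∑ j ∈ Finset.range n, ζ j ω ^ 2 * v j ∂P) := by
        rw [integral_finsetSum _ fun i _ => hintv i]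
    _ ≤ ENNReal.ofReal (∫ ω, δ ∂P) := by
        refine ENNReal.ofReal_le_ofReal (integral_mono (integrable_finsetSum _ fun i _ => hintv i)
          (integrable_const _) fun ω => ?_)
        refine le_trans (le_of_eq ?_) (hδ ω)
        refine Finset.sum_congr rfl fun j hj => ?_
        simp [hζ, Finset.mem_range.1 hj]
    _ = ENNReal.ofReal δ := by simp

open Classical in
/-- The integrand `ξ` stopped when its energy exceeds `δ` or when `Q` fails. -/
def stoppedCoeff (ξ : ℕ → Ω → ℝ) (v : ℕ → ℝ) (δ : ℝ) (Q : ℕ → Ω → Prop) (j : ℕ) (ω : Ω) : ℝ :=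
  if ∑ i ∈ Finset.range (j + 1), ξ i ω ^ 2 * v i ≤ δ ∧ Q j ω then ξ j ω else 0

/-- At the last index where the test passes, the unstopped energy up to and including that index is
at most `δ`; afterwards the coefficients are zero. -/
theorem sum_stop_le (hD : IsInnovation P G D v) (ξ : ℕ → Ω → ℝ) {δ : ℝ} (hδ : 0 ≤ δ)
    (Q : ℕ → Ω → Prop) (n : ℕ) (ω : Ω) :
    ∑ j ∈ Finset.range n, stoppedCoeff ξ v δ Q j ω ^ 2 * v j ≤ δ := by
  induction n with
  | zero => simpa using hδ
  | succ n ih =>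
    by_cases h : ∑ i ∈ Finset.range (n + 1), ξ i ω ^ 2 * v i ≤ δ ∧ Q n ω
    · refine le_trans (Finset.sum_le_sum fun j _ => ?_) h.1
      have hv : 0 ≤ v j := by rw [← hD.var j]; exact integral_nonneg fun ω => sq_nonneg _
      unfold stoppedCoeff
      split_ifs
      · exact le_rfl
      · simpa using mul_nonneg (sq_nonneg _) hv
    · rw [Finset.sum_range_succ, stoppedCoeff, if_neg h]
      simpa using ih

/-- Stopping preserves predictability: the variances are deterministic, so the energy including the
index `j` is already known at `G j`. -/
theorem measurable_stop {ξ : ℕ → Ω → ℝ} (hξ : ∀ j, Measurable[G j] (ξ j)) (δ : ℝ)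
    {Q : ℕ → Ω → Prop} (hQ : ∀ j, MeasurableSet[G j] {ω | Q j ω}) (j : ℕ) :
    Measurable[G j] (stoppedCoeff ξ v δ Q j) := by
  classical
  have h1 : Measurable[G j] fun ω => ∑ i ∈ Finset.range (j + 1), ξ i ω ^ 2 * v i := by
    refine Finset.measurable_fun_sum _ fun i hi => ?_
    exact (((hξ i).mono (G.mono (Nat.lt_succ_iff.1 (Finset.mem_range.1 hi))) le_rfl).pow_const
      2).mul_const _
  have h2 : MeasurableSet[G j] {ω | ∑ i ∈ Finset.range (j + 1), ξ i ω ^ 2 * v i ≤ δ ∧ Q j ω} :=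
    (h1 measurableSet_Iic).inter (hQ j)
  exact Measurable.ite h2 (hξ j) measurable_const

variable {μ : Measure Ω}

/-- Lenglart-type inequality for the squares of disjoint blocks. -/
theorem measure_blocks_le [IsProbabilityMeasure P] (hD : IsInnovation P G D v) (hμ : μ ≤ P) {ξ : ℕ → Ω → ℝ}
    (hξ : ∀ j, Measurable[G j] (ξ j)) {δ ε : ℝ} (hδ : 0 ≤ δ) (hε : 0 < ε) (n : ℕ) {ι : Type*}
    (I : Finset ι) (J : ι → Finset ℕ) (hJ : ∀ i ∈ I, J i ⊆ Finset.range n)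
    (hdisj : Set.PairwiseDisjoint (I : Set ι) J) :
    μ {ω | ε ≤ ∑ i ∈ I, (∑ j ∈ J i, ξ j ω * D j ω) ^ 2} ≤
      μ {ω | δ < ∑ j ∈ Finset.range n, ξ j ω ^ 2 * v j} + ENNReal.ofReal (δ / ε) := by
  set ζ := stoppedCoeff ξ v δ fun _ _ => True
  have h1 := hD.lintegral_blocks_le (measurable_stop (v := v) hξ δ
    (Q := fun _ _ => True) fun j => MeasurableSet.const _)
    (fun ω => hD.sum_stop_le ξ hδ _ n ω) I J hJ hdisj
  have hsub : {ω | ε ≤ ∑ i ∈ I, (∑ j ∈ J i, ξ j ω * D j ω) ^ 2} ⊆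
      {ω | δ < ∑ j ∈ Finset.range n, ξ j ω ^ 2 * v j} ∪
      {ω | ENNReal.ofReal ε ≤ ENNReal.ofReal (∑ i ∈ I, (∑ j ∈ J i, ζ j ω * D j ω) ^ 2)} := by
    intro ω hω
    by_cases h : δ < ∑ j ∈ Finset.range n, ξ j ω ^ 2 * v j
    · exact Or.inl h
    · refine Or.inr (ENNReal.ofReal_le_ofReal (le_trans (Set.mem_ofPred_eq ▸ hω) (le_of_eq ?_)))
      refine Finset.sum_congr rfl fun i hi => ?_
      congr 1
      refine Finset.sum_congr rfl fun j hj => ?_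
      have hjn := Finset.mem_range.1 (hJ i hi hj)
      have : ∑ i ∈ Finset.range (j + 1), ξ i ω ^ 2 * v i ≤ δ := by
        refine le_trans (Finset.sum_le_sum_of_subset_of_nonneg
          (Finset.range_mono hjn) fun j _ _ => ?_) (not_lt.1 h)
        exact mul_nonneg (sq_nonneg _) (hD.var_nonneg j)
      simp [ζ, stoppedCoeff, this]
  refine (measure_mono hsub).trans ((measure_union_le _ _).trans ?_)
  gcongr
  -- Only the stopped sum is estimated under `P`, where its second moment is controlled everywhere.
  -- The energy event stays under `μ`, which will be `P` restricted to `{t < τ}`, the only place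
  -- where the energy is known to be small.
  refine (hμ _).trans ?_
  have hm : AEMeasurable (fun ω => ENNReal.ofReal (∑ i ∈ I, (∑ j ∈ J i, ζ j ω * D j ω) ^ 2)) P := by
    refine (ENNReal.measurable_ofReal.comp (Finset.measurable_fun_sum _ fun i _ =>
      (Finset.measurable_fun_sum _ fun j _ => ?_).pow_const 2)).aemeasurable
    exact ((measurable_stop (v := v) hξ δ (Q := fun _ _ => True)
      (fun j => MeasurableSet.const _) j).mono (G.le _) le_rfl).mul (hD.measurable j)
  refine (meas_ge_le_lintegral_div hm (by simpa using hε) ENNReal.ofReal_ne_top).trans ?_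
  rw [ENNReal.ofReal_div_of_pos hε]
  gcongr

/-- Lenglart-type maximal inequality for discrete stochastic integrals. -/
theorem measure_max_le [IsProbabilityMeasure P] (hD : IsInnovation P G D v) (hμ : μ ≤ P) {ξ : ℕ → Ω → ℝ}
    (hξ : ∀ j, Measurable[G j] (ξ j)) {δ ε : ℝ} (hδ : 0 ≤ δ) (hε : 0 < ε) (n : ℕ) :
    μ {ω | ∃ k ≤ n, ε ≤ |∑ j ∈ Finset.range k, ξ j ω * D j ω|} ≤
      μ {ω | δ < ∑ j ∈ Finset.range n, ξ j ω ^ 2 * v j} + ENNReal.ofReal (δ / ε ^ 2) := by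
  classical
  -- `Q j` says that no partial sum of length at most `j` has reached `ε`. Stopping there freezes
  -- the sum at its first passage, so Chebyshev's inequality at the final time also controls the
  -- maximum.
  set Q : ℕ → Ω → Prop := fun j ω =>
    ∀ k ∈ Finset.range (j + 1), |∑ i ∈ Finset.range k, ξ i ω * D i ω| < ε with hQdef
  have hQ : ∀ j, MeasurableSet[G j] {ω | Q j ω} := by
    intro j
    have : {ω | Q j ω} = ⋂ k ∈ Finset.range (j + 1),
        {ω | |∑ i ∈ Finset.range k, ξ i ω * D i ω| < ε} := by
      ext ω; simp [hQdef]
    rw [this]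
    refine Finset.measurableSet_biInter _ fun k hk => ?_
    have hkj : k ≤ j := Nat.lt_succ_iff.1 (Finset.mem_range.1 hk)
    have hm : Measurable[G j] fun ω => ∑ i ∈ Finset.range k, ξ i ω * D i ω := by
      refine Finset.measurable_fun_sum _ fun i hi => ?_
      have hik : i < k := Finset.mem_range.1 hi
      exact ((hξ i).mono (G.mono (hik.le.trans hkj)) le_rfl).mul
        ((hD.meas i).mono (G.mono (Nat.succ_le_of_lt (hik.trans_le hkj))) le_rfl)
    have hset : MeasurableSet {x : ℝ | |x| < ε} :=
      (isOpen_lt continuous_abs continuous_const).measurableSet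
    exact hm hset
  set ζ := stoppedCoeff ξ v δ Q
  have hζm := measurable_stop (v := v) hξ δ hQ
  have h1 := hD.lintegral_blocks_le hζm (fun ω => hD.sum_stop_le ξ hδ Q n ω) {()}
    (fun _ => Finset.range n) (fun _ _ => le_rfl) (by simp)
  simp only [Finset.sum_singleton] at h1
  have hsub : {ω | ∃ k ≤ n, ε ≤ |∑ j ∈ Finset.range k, ξ j ω * D j ω|} ⊆
      {ω | δ < ∑ j ∈ Finset.range n, ξ j ω ^ 2 * v j} ∪
      {ω | ENNReal.ofReal (ε ^ 2) ≤
        ENNReal.ofReal ((∑ j ∈ Finset.range n, ζ j ω * D j ω) ^ 2)} := by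
    intro ω hω
    by_cases h : δ < ∑ j ∈ Finset.range n, ξ j ω ^ 2 * v j
    · exact Or.inl h
    · right
      have hex : ∃ k, k ≤ n ∧ ε ≤ |∑ j ∈ Finset.range k, ξ j ω * D j ω| := hω
      set k0 := Nat.find hex
      obtain ⟨hk0n, hk0⟩ := Nat.find_spec hex
      have hmin : ∀ k < k0, |∑ j ∈ Finset.range k, ξ j ω * D j ω| < ε := by
        intro k hk
        have := Nat.find_min hex hk
        by_contra hcon
        exact this ⟨hk.le.trans hk0n, not_lt.1 hcon⟩
      have hsum : ∑ j ∈ Finset.range n, ζ j ω * D j ω =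
          ∑ j ∈ Finset.range k0, ξ j ω * D j ω := by
        rw [← Finset.sum_subset (Finset.range_mono hk0n) (f := fun j => ζ j ω * D j ω)]
        · refine Finset.sum_congr rfl fun j hj => ?_
          have hjk := Finset.mem_range.1 hj
          have h2 : ∑ i ∈ Finset.range (j + 1), ξ i ω ^ 2 * v i ≤ δ := by
            refine le_trans (Finset.sum_le_sum_of_subset_of_nonneg
              (Finset.range_mono (hjk.trans_le hk0n)) fun j _ _ => ?_) (not_lt.1 h)
            exact mul_nonneg (sq_nonneg _) (hD.var_nonneg j)
          have h3 : Q j ω := fun k hk =>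
            hmin k (lt_of_lt_of_le (Finset.mem_range.1 hk) hjk)
          simp only [ζ, stoppedCoeff]
          rw [if_pos ⟨h2, h3⟩]
        · intro j _ hj
          have hjk : k0 ≤ j := not_lt.1 fun hh => hj (Finset.mem_range.2 hh)
          have h3 : ¬ Q j ω := fun hh =>
            absurd (hh k0 (Finset.mem_range.2 (Nat.lt_succ_of_le hjk))) (not_lt.2 hk0)
          simp only [ζ, stoppedCoeff]
          rw [if_neg fun hh => h3 hh.2, zero_mul]
      rw [Set.mem_ofPred_eq, hsum, ← sq_abs (∑ j ∈ Finset.range k0, _)]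
      exact ENNReal.ofReal_le_ofReal (by gcongr)
  refine (measure_mono hsub).trans ((measure_union_le _ _).trans ?_)
  gcongr
  refine (hμ _).trans ?_
  have hm : AEMeasurable (fun ω => ENNReal.ofReal ((∑ j ∈ Finset.range n, ζ j ω * D j ω) ^ 2)) P :=
    (ENNReal.measurable_ofReal.comp ((Finset.measurable_fun_sum _ fun j _ =>
      ((hζm j).mono (G.le _) le_rfl).mul (hD.measurable j)).pow_const 2)).aemeasurable
  have hε2 : 0 < ε ^ 2 := by positivity
  refine (meas_ge_le_lintegral_div hm (by simpa using hε2.not_ge) ENNReal.ofReal_ne_top).trans ?_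
  rw [ENNReal.ofReal_div_of_pos hε2]
  gcongr

end IsInnovation


/-! ### Simple integrands -/

/-- `Z` is a finite sum of adapted coefficients times indicators of intervals `(s, e]`, and `W` is
its integral process against `B`. -/
def IsSimple {Ω : Type*} {m : MeasurableSpace Ω} (𝓕 : Filtration ℝ≥0 m) (B Z W : ℝ≥0 → Ω → ℝ) :
    Prop :=
  ∃ (ι : Type) (I : Finset ι) (s e : ι → ℝ≥0) (c : ι → Ω → ℝ),
    (∀ i ∈ I, s i ≤ e i) ∧ (∀ i ∈ I, Measurable[𝓕 (s i)] (c i)) ∧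
    (∀ r ω, Z r ω = ∑ i ∈ I, (Set.Ioc (s i) (e i)).indicator (fun _ => c i ω) r) ∧
    ∀ t ω, W t ω = ∑ i ∈ I, c i ω * (B (min (e i) t) ω - B (min (s i) t) ω)

section Simple

variable {Ω : Type*} {m : MeasurableSpace Ω} {𝓕 : Filtration ℝ≥0 m} {B : ℝ≥0 → Ω → ℝ}

theorem ElementaryProcess.isSimple (Y : ElementaryProcess 𝓕) :
    IsSimple 𝓕 B Y.val (Y.integral B) :=
  ⟨ℕ, Finset.range Y.n, Y.time, fun i => Y.time (i + 1), Y.coeff,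
    fun i _ => Y.time_mono i.le_succ, fun i _ => Y.coeff_meas i, fun _ _ => rfl, fun _ _ => rfl⟩

theorem isSimple_zero : IsSimple 𝓕 B (fun _ _ => 0) (fun _ _ => 0) :=
  ⟨ℕ, ∅, fun _ => 0, fun _ => 0, fun _ _ => 0, by simp, by simp, by simp, by simp⟩

namespace IsSimple

variable {Z W Z' W' : ℝ≥0 → Ω → ℝ}

theorem add (h : IsSimple 𝓕 B Z W) (h' : IsSimple 𝓕 B Z' W') :
    IsSimple 𝓕 B (fun r ω => Z r ω + Z' r ω) (fun t ω => W t ω + W' t ω) := by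
  obtain ⟨ι, I, s, e, c, h1, h2, h3, h4⟩ := h
  obtain ⟨ι', I', s', e', c', h1', h2', h3', h4'⟩ := h'
  refine ⟨ι ⊕ ι', I.disjSum I', Sum.elim s s', Sum.elim e e', Sum.elim c c', ?_, ?_, ?_, ?_⟩
  · intro i hi
    rcases i with i | i
    · exact h1 i (by simpa using hi)
    · exact h1' i (by simpa using hi)
  · intro i hi
    rcases i with i | i
    · exact h2 i (by simpa using hi)
    · exact h2' i (by simpa using hi)
  · intro r ω
    beta_reduce
    rw [h3, h3', Finset.sum_disjSum]
    rfl
  · intro t ω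
    beta_reduce
    rw [h4, h4', Finset.sum_disjSum]
    rfl

theorem const_mul (h : IsSimple 𝓕 B Z W) (a : ℝ) :
    IsSimple 𝓕 B (fun r ω => a * Z r ω) (fun t ω => a * W t ω) := by
  obtain ⟨ι, I, s, e, c, h1, h2, h3, h4⟩ := h
  refine ⟨ι, I, s, e, fun i ω => a * c i ω, h1, fun i hi => (h2 i hi).const_mul a, ?_, ?_⟩
  · intro r ω
    beta_reduce
    rw [h3, Finset.mul_sum]
    refine Finset.sum_congr rfl fun i _ => ?_
    by_cases hr : r ∈ Set.Ioc (s i) (e i) <;> simp [hr]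
  · intro t ω
    beta_reduce
    rw [h4, Finset.mul_sum]
    exact Finset.sum_congr rfl fun i _ => by ring

theorem sub (h : IsSimple 𝓕 B Z W) (h' : IsSimple 𝓕 B Z' W') :
    IsSimple 𝓕 B (fun r ω => Z r ω - Z' r ω) (fun t ω => W t ω - W' t ω) := by
  simpa [sub_eq_add_neg] using h.add (h'.const_mul (-1))

/-- Allows adapted weights to be moved inside the integral cell by cell. -/
theorem mul_Ioc (h : IsSimple 𝓕 B Z W) {a b : ℝ≥0} (hab : a ≤ b) {ξ : Ω → ℝ}
    (hξ : Measurable[𝓕 a] ξ) :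
    IsSimple 𝓕 B (fun r ω => (Set.Ioc a b).indicator (fun r => ξ ω * Z r ω) r)
      (fun t ω => ξ ω * (W (min b t) ω - W (min a t) ω)) := by
  obtain ⟨ι, I, s, e, c, h1, h2, h3, h4⟩ := h
  -- The outer `max` in the right endpoint keeps it above the left one when `(s i, e i]` misses `(a,
  -- b]`.
  refine ⟨ι, I, fun i => max (s i) a, fun i => max (min (e i) b) (max (s i) a),
    fun i ω => ξ ω * c i ω, fun i hi => le_max_right _ _, fun i hi => ?_, ?_, ?_⟩
  · exact (hξ.mono (𝓕.mono (le_max_right _ _)) le_rfl).mul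
      ((h2 i hi).mono (𝓕.mono (le_max_left _ _)) le_rfl)
  · intro r ω
    beta_reduce
    by_cases hr : r ∈ Set.Ioc a b
    · rw [Set.indicator_of_mem hr, h3, Finset.mul_sum]
      refine Finset.sum_congr rfl fun i _ => ?_
      by_cases hr' : r ∈ Set.Ioc (s i) (e i)
      · rw [Set.indicator_of_mem hr', Set.indicator_of_mem]
        exact ⟨max_lt hr'.1 hr.1, le_max_of_le_left (le_min hr'.2 hr.2)⟩
      · rw [Set.indicator_of_notMem hr', Set.indicator_of_notMem, mul_zero]
        rintro ⟨h5, h6⟩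
        rcases le_max_iff.1 h6 with h7 | h7
        · exact hr' ⟨(le_max_left _ _).trans_lt h5, h7.trans (min_le_left _ _)⟩
        · exact absurd h5 (not_lt.2 h7)
    · rw [Set.indicator_of_notMem hr]
      refine (Finset.sum_eq_zero fun i _ => ?_).symm
      rw [Set.indicator_of_notMem]
      rintro ⟨h5, h6⟩
      rcases le_max_iff.1 h6 with h7 | h7
      · exact hr ⟨(le_max_right _ _).trans_lt h5, h7.trans (min_le_right _ _)⟩
      · exact absurd h5 (not_lt.2 h7)
  · intro t ω
    beta_reduce
    rw [h4, h4, ← Finset.sum_sub_distrib, Finset.mul_sum]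
    refine Finset.sum_congr rfl fun i hi => ?_
    have key : ∀ φ : ℝ≥0 → ℝ, ∀ s e : ℝ≥0, s ≤ e →
        φ (min e (min b t)) - φ (min s (min b t)) - (φ (min e (min a t)) - φ (min s (min a t))) =
        φ (min (max (min e b) (max s a)) t) - φ (min (max s a) t) := by
      intro φ s e hse
      rcases le_total b s with hbs | hbs
      · have e1 : min e b = b := min_eq_right (hbs.trans hse)
        have e2 : max s a = s := max_eq_left (hab.trans hbs)
        have e3 : min e (min b t) = min b t :=
          min_eq_right ((min_le_left _ _).trans (hbs.trans hse))
        have e4 : min s (min b t) = min b t := min_eq_right ((min_le_left _ _).trans hbs)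
        have e5 : min e (min a t) = min a t :=
          min_eq_right ((min_le_left _ _).trans (hab.trans (hbs.trans hse)))
        have e6 : min s (min a t) = min a t := min_eq_right ((min_le_left _ _).trans (hab.trans hbs))
        rw [e1, e2, e3, e4, e5, e6, max_eq_right hbs]
        ring
      · rcases le_total e a with hea | hea
        · have e1 : min e b = e := min_eq_left (hea.trans hab)
          have e2 : max s a = a := max_eq_right (hse.trans hea)
          rw [e1, e2, max_eq_right hea, ← min_assoc, ← min_assoc, ← min_assoc, ← min_assoc, e1,
            min_eq_left hbs, min_eq_left hea, min_eq_left (hse.trans hea)]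
          ring
        · have e1 : max s a ≤ min e b := max_le (le_min hse hbs) (le_min hea hab)
          rw [max_eq_left e1, ← min_assoc, ← min_assoc, ← min_assoc, ← min_assoc,
            min_eq_left hbs, min_eq_right hea]
          rcases le_total s a with hsa | hsa
          · rw [min_eq_left hsa, max_eq_right hsa]; ring
          · rw [min_eq_right hsa, max_eq_left hsa]; ring
    have := key (fun r => B r ω) (s i) (e i) (h1 i hi)
    rw [← this]
    ring

theorem sum {κ : Type*} (K : Finset κ) {Z W : κ → ℝ≥0 → Ω → ℝ}
    (h : ∀ i ∈ K, IsSimple 𝓕 B (Z i) (W i)) :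
    IsSimple 𝓕 B (fun r ω => ∑ i ∈ K, Z i r ω) (fun t ω => ∑ i ∈ K, W i t ω) := by
  classical
  induction K using Finset.induction_on with
  | empty => simpa using isSimple_zero
  | insert a K ha ih =>
    simp only [Finset.sum_insert ha]
    exact (h a (Finset.mem_insert_self a K)).add
      (ih fun i hi => h i (Finset.mem_insert_of_mem hi))

end IsSimple

end Simple

/-! ### Refinement to a grid -/

theorem exists_grid (S : Finset ℝ≥0) : ∃ (n : ℕ) (x : ℕ → ℝ≥0), Monotone x ∧ x 0 = 0 ∧
    x n = S.sup id ∧ ∀ p ∈ S, ∃ j ≤ n, x j = p := by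
  induction S using Finset.induction_on_max with
  | empty => exact ⟨0, fun _ => 0, monotone_const, rfl, by simp, by simp⟩
  | insert a S ha ih =>
    obtain ⟨n, x, hx, hx0, hxn, hS⟩ := ih
    have hle : S.sup id ≤ a := Finset.sup_le fun p hp => (ha p hp).le
    refine ⟨n + 1, fun j => if j ≤ n then x j else a, ?_, by simpa using hx0, ?_, ?_⟩
    · intro i j hij
      simp only
      split_ifs with h1 h2
      · exact hx hij
      · exact (hx h1).trans (hxn ▸ hle)
      · omega
      · exact le_rfl
    · simp [hle]
    · intro p hp
      rcases Finset.mem_insert.1 hp with rfl | hp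
      · exact ⟨n + 1, le_rfl, by simp⟩
      · obtain ⟨j, hj, hjp⟩ := hS p hp
        exact ⟨j, by omega, by simp [hj, hjp]⟩

/-- A grid on `[0, T]` through finitely many given points. -/
theorem exists_grid_gap (S : Finset ℝ≥0) (T : ℝ≥0) : ∃ (n : ℕ) (x : ℕ → ℝ≥0), Monotone x ∧
    x 0 = 0 ∧ x n = T ∧ (∀ p ∈ S, p ≤ T → ∃ j ≤ n, x j = p) ∧
    ∀ p ∈ S, ∀ k < n, p ≤ x k ∨ x (k + 1) ≤ p := by
  classical
  obtain ⟨n, x, hx, hx0, hxn, hS⟩ := exists_grid (insert T (S.filter (· ≤ T)))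
  have hxT : x n = T := by
    rw [hxn]
    refine le_antisymm (Finset.sup_le fun p hp => ?_)
      (Finset.le_sup (f := id) (Finset.mem_insert_self _ _))
    rcases Finset.mem_insert.1 hp with rfl | hp
    · exact le_rfl
    · exact (Finset.mem_filter.1 hp).2
  have hmem : ∀ p ∈ S, p ≤ T → ∃ j ≤ n, x j = p := fun p hp hpT =>
    hS p (Finset.mem_insert_of_mem (Finset.mem_filter.2 ⟨hp, hpT⟩))
  refine ⟨n, x, hx, hx0, hxT, hmem, fun p hp k hk => ?_⟩
  rcases le_total p T with h | h
  · obtain ⟨j, hj, rfl⟩ := hmem p hp h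
    rcases Nat.lt_or_ge k j with h1 | h1
    · exact Or.inr (hx h1)
    · exact Or.inl (hx h1)
  · exact Or.inr ((hx hk).trans (hxT.le.trans h))

theorem lintegral_step_eq {Z : ℝ≥0 → ℝ} {x : ℕ → ℝ≥0} {ξ : ℕ → ℝ} (hx : Monotone x)
    (hx0 : x 0 = 0) (n : ℕ) (hZ : ∀ j < n, ∀ r ∈ Set.Ioc (x j) (x (j + 1)), Z r = ξ j) :
    ∫⁻ r in Set.Icc (0 : ℝ) (x n), ENNReal.ofReal (Z r.toNNReal ^ 2) =
      ENNReal.ofReal (∑ j ∈ Finset.range n, ξ j ^ 2 * ((x (j + 1) : ℝ) - x j)) := by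
  rw [← restrict_Ioc_eq_restrict_Icc]
  induction n with
  | zero => simp [hx0]
  | succ n ih =>
    have hle : (x n : ℝ) ≤ x (n + 1) := by exact_mod_cast hx n.le_succ
    rw [← Set.Ioc_union_Ioc_eq_Ioc (NNReal.coe_nonneg (x n)) hle, lintegral_union measurableSet_Ioc
      (Set.Ioc_disjoint_Ioc_of_le le_rfl), ih fun j hj => hZ j (by omega), Finset.sum_range_succ,
      ENNReal.ofReal_add]
    · congr 1
      have : ∫⁻ r in Set.Ioc (x n : ℝ) (x (n + 1)), ENNReal.ofReal (Z r.toNNReal ^ 2) =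
          ∫⁻ r in Set.Ioc (x n : ℝ) (x (n + 1)), ENNReal.ofReal (ξ n ^ 2) := by
        refine setLIntegral_congr_fun measurableSet_Ioc fun r hr => ?_
        have hr0 : 0 ≤ r := (NNReal.coe_nonneg (x n)).trans hr.1.le
        rw [hZ n n.lt_succ_self]
        exact ⟨Real.lt_toNNReal_iff_coe_lt.2 hr.1, Real.toNNReal_le_iff_le_coe.2 hr.2⟩
      rw [this, lintegral_const, Measure.restrict_apply_univ, Real.volume_Ioc,
        ← ENNReal.ofReal_mul (sq_nonneg _)]
    · refine Finset.sum_nonneg fun j _ => mul_nonneg (sq_nonneg _) (sub_nonneg.2 ?_)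
      exact_mod_cast hx j.le_succ
    · exact mul_nonneg (sq_nonneg _) (sub_nonneg.2 hle)

/-- A simple integrand, rewritten on a common grid. -/
theorem IsSimple.exists_grid_rep {Ω : Type*} {m : MeasurableSpace Ω} {𝓕 : Filtration ℝ≥0 m}
    {B Z W : ℝ≥0 → Ω → ℝ} (h : IsSimple 𝓕 B Z W) (F : Finset ℝ≥0) (T : ℝ≥0) :
    ∃ (n : ℕ) (x : ℕ → ℝ≥0) (ξ : ℕ → Ω → ℝ), Monotone x ∧ x n = T ∧
      (∀ p ∈ F, p ≤ T → ∃ j ≤ n, x j = p) ∧ (∀ j, Measurable[𝓕 (x j)] (ξ j)) ∧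
      (∀ ω, ∫⁻ r in Set.Icc (0 : ℝ) T, ENNReal.ofReal (Z r.toNNReal ω ^ 2) =
        ENNReal.ofReal (∑ j ∈ Finset.range n, ξ j ω ^ 2 * ((x (j + 1) : ℝ) - x j))) ∧
      ∀ k ≤ n, ∀ ω, W (x k) ω =
        ∑ j ∈ Finset.range k, ξ j ω * (B (x (j + 1)) ω - B (x j) ω) := by
  classical
  obtain ⟨ι, I, s, e, c, h1, h2, h3, h4⟩ := h
  obtain ⟨n, x, hx, hx0, hxn, hF, hgap⟩ := exists_grid_gap (F ∪ (I.image s ∪ I.image e)) T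
  have hgs : ∀ i ∈ I, ∀ k < n, s i ≤ x k ∨ x (k + 1) ≤ s i := fun i hi => hgap _ <|
    Finset.mem_union_right _ (Finset.mem_union_left _ (Finset.mem_image_of_mem s hi))
  have hge : ∀ i ∈ I, ∀ k < n, e i ≤ x k ∨ x (k + 1) ≤ e i := fun i hi => hgap _ <|
    Finset.mem_union_right _ (Finset.mem_union_right _ (Finset.mem_image_of_mem e hi))
  -- Since all endpoints are grid points, a nondegenerate cell is either contained in `(s i, e i]`
  -- or disjoint from it. Containment includes `s i ≤ x j`, so the coefficient is known at the left
  -- end of the cell.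
  set ξ : ℕ → Ω → ℝ := fun j ω =>
    ∑ i ∈ I, if s i ≤ x j ∧ x (j + 1) ≤ e i then c i ω else 0 with hξ
  refine ⟨n, x, ξ, hx, hxn, fun p hp => hF p (Finset.mem_union_left _ hp), ?_, ?_, ?_⟩
  · intro j
    refine Finset.measurable_fun_sum _ fun i hi => ?_
    by_cases hij : s i ≤ x j ∧ x (j + 1) ≤ e i
    · simp only [hij, and_self, if_true]
      exact (h2 i hi).mono (𝓕.mono hij.1) le_rfl
    · simp only [hij, if_false]
      exact measurable_const
  · intro ω
    rw [← hxn]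
    refine lintegral_step_eq (Z := fun r => Z r ω) (ξ := fun j => ξ j ω) hx hx0 n
      fun j hj r hr => ?_
    simp only [hξ]
    rw [h3]
    refine Finset.sum_congr rfl fun i hi => ?_
    by_cases hri : r ∈ Set.Ioc (s i) (e i)
    · rw [Set.indicator_of_mem hri, if_pos]
      constructor
      · rcases hgs i hi j hj with h | h
        · exact h
        · exact absurd (hri.1.trans_le hr.2) (not_lt.2 h)
      · rcases hge i hi j hj with h | h
        · exact absurd (hr.1.trans_le hri.2) (not_lt.2 h)
        · exact h
    · rw [Set.indicator_of_notMem hri, if_neg]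
      rintro ⟨h5, h6⟩
      exact hri ⟨h5.trans_lt hr.1, hr.2.trans h6⟩
  · intro k hk ω
    rw [h4]
    simp only [hξ, Finset.sum_mul]
    rw [Finset.sum_comm]
    refine Finset.sum_congr rfl fun i hi => ?_
    induction k with
    | zero =>
      have : ∀ q : ℝ≥0, min q (x 0) = 0 := fun q => by rw [hx0]; exact min_eq_right zero_le
      simp [this]
    | succ k ih =>
      rw [Finset.sum_range_succ, ← ih (by omega)]
      have hk' : x k ≤ x (k + 1) := hx k.le_succ
      have hkn : k < n := hk
      rcases hge i hi k hkn with he | he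
      · have hs := (h1 i hi).trans he
        rw [min_eq_left he, min_eq_left hs, min_eq_left (he.trans hk'),
          min_eq_left (hs.trans hk')]
        -- The condition can hold here only for a degenerate cell, whose increment is zero.
        split_ifs with hif
        · rw [le_antisymm (hif.2.trans he) hk']; ring
        · ring
      · rcases hgs i hi k hkn with hs | hs
        · rw [if_pos ⟨hs, he⟩, min_eq_right he, min_eq_right (hk'.trans he), min_eq_left hs,
            min_eq_left (hs.trans hk')]
          ring
        · rw [min_eq_right he, min_eq_right (hk'.trans he), min_eq_right hs,
            min_eq_right (hk'.trans hs)]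
          split_ifs with hif
          · rw [le_antisymm (hs.trans hif.1) hk']; ring
          · ring


/-! ### Brownian increments as innovations -/

section Brownian

variable {Ω : Type*} {m : MeasurableSpace Ω} {P : Measure Ω} {𝓕 : Filtration ℝ≥0 m}
  {B : ℝ≥0 → Ω → ℝ}

/-- The filtration sampled at the points of a grid. -/
def sampled (𝓕 : Filtration ℝ≥0 m) {x : ℕ → ℝ≥0} (hx : Monotone x) : Filtration ℕ m where
  seq j := 𝓕 (x j)
  mono' _ _ hij := 𝓕.mono (hx hij)
  le' j := 𝓕.le (x j)

theorem IsFilteredBrownian.measurable_sub (hB : IsFilteredBrownian P 𝓕 B) {s t : ℝ≥0}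
    (hst : s ≤ t) : Measurable[𝓕 t] fun ω => B t ω - B s ω :=
  (hB.adapted t).measurable.sub ((hB.adapted s).measurable.mono (𝓕.mono hst) le_rfl)

theorem IsFilteredBrownian.hasLaw_sub (hB : IsFilteredBrownian P 𝓕 B) {s t : ℝ≥0} (hst : s ≤ t) :
    HasLaw (fun ω => B t ω - B s ω) (gaussianReal 0 (t - s)) P := by
  have h := hB.brownian.hasLaw_sub t s
  have h2 : nndist t.1 s.1 = t - s := by
    ext
    rw [coe_nndist, Real.dist_eq, NNReal.coe_sub hst]
    exact abs_of_nonneg (sub_nonneg.2 (by exact_mod_cast hst))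
  rw [h2] at h
  exact h

theorem IsFilteredBrownian.isInnovation (hB : IsFilteredBrownian P 𝓕 B) {x : ℕ → ℝ≥0}
    (hx : Monotone x) :
    IsInnovation P (sampled 𝓕 hx) (fun j ω => B (x (j + 1)) ω - B (x j) ω)
      (fun j => (x (j + 1) : ℝ) - x j) where
  meas j := hB.measurable_sub (hx j.le_succ)
  indep j := hB.indep _ _ (hx j.le_succ)
  memLp j := by
    have h := hB.hasLaw_sub (hx j.le_succ)
    have h2 := memLp_id_gaussianReal (μ := 0) (v := x (j + 1) - x j) 2
    rw [← h.map_eq] at h2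
    exact h2.comp_of_map h.aemeasurable
  mean j := by
    have h := hB.hasLaw_sub (hx j.le_succ)
    rw [h.integral_eq, integral_id_gaussianReal]
  var j := by
    have h := hB.hasLaw_sub (hx j.le_succ)
    have h1 := h.variance_eq
    rw [variance_id_gaussianReal, variance_of_integral_eq_zero h.aemeasurable
      (by rw [h.integral_eq, integral_id_gaussianReal])] at h1
    rw [h1, NNReal.coe_sub (hx j.le_succ)]

/-- The fourth moment of a standard normal variable. -/
def gaussFourth : ℝ := ∫ z, z ^ 4 ∂(gaussianReal 0 1)

theorem memLp_sq_gaussianReal (v : ℝ≥0) : MemLp (fun z : ℝ => z ^ 2) 2 (gaussianReal 0 v) := by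
  have h := memLp_id_gaussianReal (μ := 0) (v := v) 4
  have h2 := h.norm_rpow_div (2 : ℝ≥0∞)
  have h3 : ((4 : ℝ≥0) : ℝ≥0∞) / 2 = 2 := by
    rw [show ((4 : ℝ≥0) : ℝ≥0∞) = 2 * 2 by norm_num,
      ENNReal.mul_div_cancel_right two_ne_zero ENNReal.ofNat_ne_top]
  rw [h3] at h2
  refine h2.congr_norm (by fun_prop) (ae_of_all _ fun z => ?_)
  simp

theorem integral_fourth_gaussianReal (v : ℝ≥0) :
    ∫ z, z ^ 4 ∂(gaussianReal 0 v) = gaussFourth * (v : ℝ) ^ 2 := by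
  have h := gaussianReal_map_const_mul (μ := 0) (v := 1) (NNReal.sqrt v : ℝ)
  have h2 : NNReal.mk (((NNReal.sqrt v : ℝ≥0) : ℝ) ^ 2) (sq_nonneg _) * 1 = v := by
    ext
    simp
  rw [mul_zero, h2] at h
  rw [← h, integral_map (by fun_prop) (by fun_prop), gaussFourth]
  simp_rw [mul_pow]
  rw [integral_const_mul, mul_comm]
  congr 1
  rw [show (4 : ℕ) = 2 * 2 from rfl, pow_mul]
  simp

/-- By Gaussian scaling the fourth moment of an increment is proportional to the square of the cell
length. The value of the constant is irrelevant; the quadratic order makes the total variance vanish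
with the mesh. -/
theorem IsFilteredBrownian.isInnovation_sq [IsProbabilityMeasure P]
    (hB : IsFilteredBrownian P 𝓕 B) {x : ℕ → ℝ≥0} (hx : Monotone x) :
    ∃ v : ℕ → ℝ, IsInnovation P (sampled 𝓕 hx)
      (fun j ω => (B (x (j + 1)) ω - B (x j) ω) ^ 2 - ((x (j + 1) : ℝ) - x j)) v ∧
      ∀ j, v j ≤ gaussFourth * ((x (j + 1) : ℝ) - x j) ^ 2 := by
  have hL : ∀ j, MemLp (fun ω => (B (x (j + 1)) ω - B (x j) ω) ^ 2) 2 P := by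
    intro j
    have h := hB.hasLaw_sub (hx j.le_succ)
    have h2 := memLp_sq_gaussianReal (x (j + 1) - x j)
    rw [← h.map_eq] at h2
    exact h2.comp_of_map h.aemeasurable
  have hI := hB.isInnovation hx
  refine ⟨fun j => ∫ ω, ((B (x (j + 1)) ω - B (x j) ω) ^ 2 - ((x (j + 1) : ℝ) - x j)) ^ 2 ∂P,
    ⟨fun j => ((hI.meas j).pow_const 2).sub_const _, fun j => ?_, fun j => ?_, fun j => ?_,
      fun j => rfl⟩, fun j => ?_⟩
  · refine indep_of_indep_of_le_left (hI.indep j) ?_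
    have : (fun ω => (B (x (j + 1)) ω - B (x j) ω) ^ 2 - ((x (j + 1) : ℝ) - x j)) =
        (fun z : ℝ => z ^ 2 - ((x (j + 1) : ℝ) - x j)) ∘
          fun ω => B (x (j + 1)) ω - B (x j) ω := rfl
    rw [this, ← MeasurableSpace.comap_comp]
    exact MeasurableSpace.comap_mono (Measurable.comap_le (by fun_prop))
  · exact (hL j).sub (memLp_const _)
  · rw [integral_sub ((hL j).integrable one_le_two) (integrable_const _), hI.var j]
    simp
  · have h1 : ∀ ω, ((B (x (j + 1)) ω - B (x j) ω) ^ 2 - ((x (j + 1) : ℝ) - x j)) ^ 2 =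
        ((B (x (j + 1)) ω - B (x j) ω) ^ 2) ^ 2 -
          2 * ((x (j + 1) : ℝ) - x j) * (B (x (j + 1)) ω - B (x j) ω) ^ 2 +
          ((x (j + 1) : ℝ) - x j) ^ 2 := fun ω => by ring
    have h2 : ∫ ω, ((B (x (j + 1)) ω - B (x j) ω) ^ 2) ^ 2 ∂P =
        gaussFourth * ((x (j + 1) : ℝ) - x j) ^ 2 := by
      have h := hB.hasLaw_sub (hx j.le_succ)
      have h3 := h.integral_comp (f := fun z : ℝ => z ^ 4) (by fun_prop)
      rw [integral_fourth_gaussianReal, NNReal.coe_sub (hx j.le_succ)] at h3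
      rw [← h3]
      refine integral_congr_ae (ae_of_all _ fun ω => ?_)
      simp only [Function.comp]
      ring
    have hvar := hI.var j
    simp_rw [h1]
    have hi1 : Integrable (fun ω => ((B (x (j + 1)) ω - B (x j) ω) ^ 2) ^ 2) P :=
      (hL j).integrable_sq
    have hi2 : Integrable (fun ω => 2 * ((x (j + 1) : ℝ) - x j) *
        (B (x (j + 1)) ω - B (x j) ω) ^ 2) P :=
      ((hL j).integrable one_le_two).const_mul _
    have hi3 : Integrable (fun ω => ((B (x (j + 1)) ω - B (x j) ω) ^ 2) ^ 2 -
        2 * ((x (j + 1) : ℝ) - x j) * (B (x (j + 1)) ω - B (x j) ω) ^ 2) P := hi1.sub hi2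
    rw [integral_add hi3 (integrable_const _), integral_sub hi1 hi2,
      integral_const_mul, hvar, h2]
    simp only [integral_const, probReal_univ, one_smul]
    nlinarith [sq_nonneg ((x (j + 1) : ℝ) - x j)]

variable [IsProbabilityMeasure P] {μ : Measure Ω} {Z W : ℝ≥0 → Ω → ℝ}

theorem IsSimple.measure_finset_le (hB : IsFilteredBrownian P 𝓕 B) (hμ : μ ≤ P)
    (h : IsSimple 𝓕 B Z W) {T : ℝ≥0} (F : Finset ℝ≥0) (hF : ∀ t ∈ F, t ≤ T) {δ ε : ℝ}
    (hδ : 0 ≤ δ) (hε : 0 < ε) :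
    μ {ω | ∃ t ∈ F, ε ≤ |W t ω|} ≤
      μ {ω | ENNReal.ofReal δ <
        ∫⁻ r in Set.Icc (0 : ℝ) T, ENNReal.ofReal (Z r.toNNReal ω ^ 2)} +
      ENNReal.ofReal (δ / ε ^ 2) := by
  obtain ⟨n, x, ξ, hx, hxn, hFx, hξ, hE, hW⟩ := h.exists_grid_rep F T
  have hI := hB.isInnovation hx
  refine (measure_mono ?_).trans ((hI.measure_max_le hμ hξ hδ hε n).trans ?_)
  · rintro ω ⟨t, ht, hω⟩
    obtain ⟨k, hk, rfl⟩ := hFx t ht (hF t ht)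
    exact ⟨k, hk, by rwa [← hW k hk]⟩
  · gcongr
    intro hω
    rw [hE]
    exact (ENNReal.ofReal_lt_ofReal_iff_of_nonneg hδ).2 hω

/-- The maximal bound does not depend on the number of times, so continuity from below carries it to
countably many. -/
theorem IsSimple.measure_sequence_le (hB : IsFilteredBrownian P 𝓕 B) (hμ : μ ≤ P)
    (h : IsSimple 𝓕 B Z W) {T : ℝ≥0} (q : ℕ → ℝ≥0) (hq : ∀ i, q i ≤ T) {δ ε : ℝ}
    (hδ : 0 ≤ δ) (hε : 0 < ε) :
    μ {ω | ∃ i, ε ≤ |W (q i) ω|} ≤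
      μ {ω | ENNReal.ofReal δ <
        ∫⁻ r in Set.Icc (0 : ℝ) T, ENNReal.ofReal (Z r.toNNReal ω ^ 2)} +
      ENNReal.ofReal (δ / ε ^ 2) := by
  classical
  have hU : {ω | ∃ i, ε ≤ |W (q i) ω|} =
      ⋃ n : ℕ, {ω | ∃ t ∈ (Finset.range n).image q, ε ≤ |W t ω|} := by
    ext ω
    simp only [Set.mem_ofPred_eq, Set.mem_iUnion, Finset.mem_image, Finset.mem_range]
    constructor
    · rintro ⟨i, hi⟩
      exact ⟨i + 1, q i, ⟨i, i.lt_succ_self, rfl⟩, hi⟩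
    · rintro ⟨n, t, ⟨i, -, rfl⟩, hi⟩
      exact ⟨i, hi⟩
  rw [hU, Monotone.measure_iUnion]
  · refine iSup_le fun n => h.measure_finset_le hB hμ _ (fun t ht => ?_) hδ hε
    obtain ⟨i, -, rfl⟩ := Finset.mem_image.1 ht
    exact hq i
  · intro n n' hnn ω
    rintro ⟨t, ht, hω⟩
    exact ⟨t, Finset.image_subset_image (Finset.range_mono hnn) ht, hω⟩

/-- On a common refinement containing all the `t i`, the increments of `W` are disjoint blocks of
one discrete stochastic integral. -/
theorem IsSimple.measure_sum_sq_le (hB : IsFilteredBrownian P 𝓕 B) (hμ : μ ≤ P)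
    (h : IsSimple 𝓕 B Z W) {t : ℕ → ℝ≥0} (ht : Monotone t) (N : ℕ) {δ ε : ℝ}
    (hδ : 0 ≤ δ) (hε : 0 < ε) :
    μ {ω | ε ≤ ∑ i ∈ Finset.range N, (W (t (i + 1)) ω - W (t i) ω) ^ 2} ≤
      μ {ω | ENNReal.ofReal δ <
        ∫⁻ r in Set.Icc (0 : ℝ) (t N), ENNReal.ofReal (Z r.toNNReal ω ^ 2)} +
      ENNReal.ofReal (δ / ε) := by
  classical
  obtain ⟨n, x, ξ, hx, hxn, hFx, hξ, hE, hW⟩ :=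
    h.exists_grid_rep ((Finset.range (N + 1)).image t) (t N)
  have hI := hB.isInnovation hx
  set J : ℕ → Finset ℕ := fun i => (Finset.range n).filter fun j => t i ≤ x j ∧ x j < t (i + 1)
  have hWt : ∀ i ≤ N, ∀ ω, W (t i) ω =
      ∑ j ∈ (Finset.range n).filter (fun j => x j < t i), ξ j ω * (B (x (j + 1)) ω - B (x j) ω) := by
    intro i hi ω
    obtain ⟨k, hk, hkt⟩ := hFx (t i)
      (Finset.mem_image_of_mem t (Finset.mem_range.2 (Nat.lt_succ_of_le hi))) (ht hi)
    rw [← hkt, hW k hk]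
    symm
    refine Finset.sum_subset_zero_on_sdiff (fun j hj => ?_) (fun j hj => ?_) fun _ _ => rfl
    · have h2 := (Finset.mem_filter.1 hj).2
      rw [Finset.mem_range]
      by_contra hcon
      exact absurd h2 (not_lt.2 (hx (not_lt.1 hcon)))
    · rw [Finset.mem_sdiff, Finset.mem_filter, Finset.mem_range, Finset.mem_range] at hj
      have h1 : x k ≤ x j := not_lt.1 fun hh => hj.2 ⟨hj.1.trans_le hk, hh⟩
      -- Grid points may repeat, so the indices below `k` and the points below `x k` can differ; the
      -- discrepancy consists of degenerate cells.
      have h2 : x (j + 1) = x j :=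
        le_antisymm ((hx (Nat.succ_le_of_lt hj.1)).trans h1) (hx j.le_succ)
      rw [h2, sub_self, mul_zero]
  have hinc : ∀ i < N, ∀ ω, W (t (i + 1)) ω - W (t i) ω =
      ∑ j ∈ J i, ξ j ω * (B (x (j + 1)) ω - B (x j) ω) := by
    intro i hi ω
    rw [hWt _ hi, hWt _ hi.le, sub_eq_iff_eq_add, ← Finset.sum_union]
    · refine Finset.sum_congr ?_ fun _ _ => rfl
      ext j
      simp only [J, Finset.mem_union, Finset.mem_filter, Finset.mem_range]
      have := ht i.le_succ
      constructor
      · rintro ⟨h1, h2⟩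
        rcases lt_or_ge (x j) (t i) with h3 | h3
        · exact Or.inr ⟨h1, h3⟩
        · exact Or.inl ⟨h1, h3, h2⟩
      · rintro (⟨h1, h2, h3⟩ | ⟨h1, h2⟩)
        · exact ⟨h1, h3⟩
        · exact ⟨h1, h2.trans_le this⟩
    · refine Finset.disjoint_left.2 fun j h1 h2 => ?_
      exact absurd (Finset.mem_filter.1 h2).2 (not_lt.2 (Finset.mem_filter.1 h1).2.1)
  have hdisj : Set.PairwiseDisjoint ((Finset.range N : Finset ℕ) : Set ℕ) J := by
    have aux : ∀ i i', i < i' → Disjoint (J i) (J i') := by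
      intro i i' hii
      refine Finset.disjoint_left.2 fun j h1 h2 => ?_
      exact absurd (Finset.mem_filter.1 h1).2.2
        (not_lt.2 ((ht hii).trans (Finset.mem_filter.1 h2).2.1))
    intro i _ i' _ hne
    rcases lt_or_gt_of_ne hne with h | h
    · exact aux i i' h
    · exact (aux i' i h).symm
  have hmain := hI.measure_blocks_le hμ hξ hδ hε n (Finset.range N) J
    (fun i _ => Finset.filter_subset _ _) hdisj
  refine (measure_mono ?_).trans (hmain.trans ?_)
  · intro ω hω
    refine le_trans (Set.mem_ofPred_eq ▸ hω) (le_of_eq (Finset.sum_congr rfl fun i hi => ?_))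
    rw [hinc i (Finset.mem_range.1 hi)]
  · gcongr
    intro hω
    rw [hE]
    exact (ENNReal.ofReal_lt_ofReal_iff_of_nonneg hδ).2 hω

end Brownian


/-! ### Convergence to zero in measure -/

/-- `f n → 0` in `μ`-measure. -/
def Negl {Ω : Type*} {m : MeasurableSpace Ω} (μ : Measure Ω) (f : ℕ → Ω → ℝ≥0∞) : Prop :=
  ∀ ε : ℝ, 0 < ε → Tendsto (fun n => μ {ω | ENNReal.ofReal ε ≤ f n ω}) atTop (𝓝 0)

namespace Negl

variable {Ω : Type*} {m : MeasurableSpace Ω} {μ : Measure Ω} {f g : ℕ → Ω → ℝ≥0∞}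

theorem of_le (h : ∀ ε : ℝ, 0 < ε → ∀ η : ℝ≥0∞, 0 < η →
    ∀ᶠ n in atTop, μ {ω | ENNReal.ofReal ε ≤ f n ω} ≤ η) : Negl μ f := fun ε hε =>
  ENNReal.tendsto_nhds_zero.2 fun η hη => h ε hε η hη

theorem eventually_le (h : Negl μ f) {ε : ℝ} (hε : 0 < ε) {η : ℝ≥0∞} (hη : 0 < η) :
    ∀ᶠ n in atTop, μ {ω | ENNReal.ofReal ε ≤ f n ω} ≤ η :=
  ENNReal.tendsto_nhds_zero.1 (h ε hε) η hη

theorem mono (hg : Negl μ g) (h : ∀ n, ∀ᵐ ω ∂μ, f n ω ≤ g n ω) : Negl μ f := fun ε hε =>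
  tendsto_of_tendsto_of_tendsto_of_le_of_le tendsto_const_nhds (hg ε hε) (fun _ => zero_le)
    fun n => measure_mono_ae <| by
      filter_upwards [h n] with ω hω (h1 : _ ≤ _)
      exact h1.trans hω

theorem add (hf : Negl μ f) (hg : Negl μ g) : Negl μ fun n ω => f n ω + g n ω := by
  intro ε hε
  have h := (hf (ε / 2) (by positivity)).add (hg (ε / 2) (by positivity))
  rw [add_zero] at h
  refine tendsto_of_tendsto_of_tendsto_of_le_of_le tendsto_const_nhds h (fun _ => zero_le)
    fun n => (measure_mono ?_).trans (measure_union_le _ _)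
  intro ω hω
  by_contra hcon
  simp only [Set.mem_union, Set.mem_ofPred_eq, not_or, not_le] at hcon hω
  have h1 := ENNReal.add_lt_add hcon.1 hcon.2
  rw [← ENNReal.ofReal_add (by positivity) (by positivity), add_halves] at h1
  exact absurd h1 (not_lt.2 hω)

theorem sq (hf : Negl μ f) : Negl μ fun n ω => f n ω ^ 2 := by
  intro ε hε
  refine (hf (Real.sqrt ε) (Real.sqrt_pos.2 hε)).congr fun n => ?_
  congr 1
  ext ω
  simp only [Set.mem_ofPred_eq]
  rw [← Real.sq_sqrt hε.le, ENNReal.ofReal_pow (Real.sqrt_nonneg _),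
    Real.sqrt_sq (Real.sqrt_nonneg ε)]
  exact (ENNReal.pow_right_strictMono two_ne_zero).le_iff_le.symm

theorem comp_strictMono (hf : Negl μ f) {φ : ℕ → ℕ} (hφ : StrictMono φ) :
    Negl μ fun n ω => f (φ n) ω := fun ε hε => (hf ε hε).comp hφ.tendsto_atTop

/-- An almost everywhere finite factor is bounded by a constant off a set of small measure. -/
theorem random_mul [IsFiniteMeasure μ] (hf : Negl μ f) {R : Ω → ℝ≥0∞} (hR : Measurable R)
    (hR' : ∀ᵐ ω ∂μ, R ω ≠ ⊤) : Negl μ fun n ω => R ω * f n ω := by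
  refine of_le fun ε hε η hη => ?_
  have h1 : Tendsto (fun K : ℕ => μ {ω | (K : ℝ≥0∞) + 1 ≤ R ω}) atTop (𝓝 0) := by
    have h2 : μ (⋂ K : ℕ, {ω | (K : ℝ≥0∞) + 1 ≤ R ω}) = 0 := by
      refine measure_mono_null ?_ (ae_iff.1 hR')
      intro ω hω
      simp only [Set.mem_iInter, Set.mem_ofPred_eq, not_not] at hω ⊢
      by_contra hne
      obtain ⟨K, hK⟩ := ENNReal.exists_nat_gt hne
      exact absurd ((le_self_add).trans (hω K)) (not_le.2 hK)
    rw [← h2]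
    refine tendsto_measure_iInter_atTop
      (fun K => (measurableSet_le measurable_const hR).nullMeasurableSet) ?_
      ⟨0, measure_ne_top _ _⟩
    intro K K' hKK ω hω
    simp only [Set.mem_ofPred_eq] at hω
    simp only [Set.mem_ofPred_eq]
    exact le_trans (by gcongr) hω
  obtain ⟨K, hK⟩ := (ENNReal.tendsto_nhds_zero.1 h1 (η / 2) (ENNReal.half_pos hη.ne')).exists
  have hK0 : (0 : ℝ) < K + 1 := by positivity
  filter_upwards [hf.eventually_le (ε := ε / (K + 1)) (by positivity) (ENNReal.half_pos hη.ne')]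
    with n hn
  refine (measure_mono ?_).trans ((measure_union_le _ _).trans
    ((add_le_add hK hn).trans_eq (ENNReal.add_halves η)))
  intro ω hω
  by_contra hcon
  simp only [Set.mem_union, Set.mem_ofPred_eq, not_or, not_le] at hcon hω
  have h3 : R ω * f n ω ≤ ((K : ℝ≥0∞) + 1) * f n ω := by gcongr; exact hcon.1.le
  have h4 : ((K : ℝ≥0∞) + 1) * f n ω < ENNReal.ofReal ε := by
    have h5 : ((K : ℝ≥0∞) + 1) = ENNReal.ofReal (K + 1) := by
      rw [ENNReal.ofReal_add (by positivity) zero_le_one]; simp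
    rw [h5]
    calc ENNReal.ofReal (K + 1) * f n ω < ENNReal.ofReal (K + 1) * ENNReal.ofReal (ε / (K + 1)) :=
          ENNReal.mul_lt_mul_right (by simpa using hK0) ENNReal.ofReal_ne_top hcon.2
      _ = ENNReal.ofReal ε := by
          rw [← ENNReal.ofReal_mul hK0.le, mul_div_cancel₀ _ hK0.ne']
  exact absurd (h3.trans_lt h4) (not_lt.2 hω)

theorem const_mul [IsFiniteMeasure μ] (hf : Negl μ f) {c : ℝ≥0∞} (hc : c ≠ ⊤) :
    Negl μ fun n ω => c * f n ω :=
  hf.random_mul measurable_const (ae_of_all _ fun _ => hc)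

theorem of_tendsto_ae [IsFiniteMeasure μ] (hf : ∀ n, Measurable (f n))
    (h : ∀ᵐ ω ∂μ, Tendsto (fun n => f n ω) atTop (𝓝 0)) : Negl μ f := by
  intro ε hε
  have hanti : Antitone fun n => ⋃ k : ℕ, {ω | ENNReal.ofReal ε ≤ f (n + k) ω} := by
    intro n n' hnn ω hω
    obtain ⟨k, hk⟩ := Set.mem_iUnion.1 hω
    refine Set.mem_iUnion.2 ⟨n' - n + k, ?_⟩
    rwa [← add_assoc, Nat.add_sub_cancel' hnn]
  have h1 := tendsto_measure_iInter_atTop (μ := μ)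
    (fun n => (MeasurableSet.iUnion fun k =>
      measurableSet_le measurable_const (hf (n + k))).nullMeasurableSet) hanti
    ⟨0, measure_ne_top _ _⟩
  have h2 : μ (⋂ n, ⋃ k : ℕ, {ω | ENNReal.ofReal ε ≤ f (n + k) ω}) = 0 := by
    refine measure_mono_null ?_ (ae_iff.1 h)
    intro ω hω hten
    obtain ⟨n, hn⟩ := eventually_atTop.1
      ((tendsto_order.1 hten).2 (ENNReal.ofReal ε) (by simpa using hε))
    obtain ⟨k, hk⟩ := Set.mem_iUnion.1 (Set.mem_iInter.1 hω n)
    exact absurd (hn (n + k) (Nat.le_add_right _ _)) (not_lt.2 hk)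
  rw [h2] at h1
  refine tendsto_of_tendsto_of_tendsto_of_le_of_le tendsto_const_nhds h1 (fun _ => zero_le)
    fun n => measure_mono fun ω hω => Set.mem_iUnion.2 ⟨0, hω⟩

/-- Taking `φ n` late enough beats any prescribed growth `K n`. Later `K n = 2 ^ n`, the number of
cells over which an error is summed. -/
theorem exists_diag (hf : Negl μ f) (K : ℕ → ℝ) (hK : ∀ n, 0 < K n) :
    ∃ φ : ℕ → ℕ, StrictMono φ ∧ Negl μ fun n ω => ENNReal.ofReal (K n) * f (φ n) ω := by
  have h1 : ∀ n : ℕ, ∀ᶠ k in atTop,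
      μ {ω | ENNReal.ofReal ((1 / (n + 1)) / K n) ≤ f k ω} ≤ ENNReal.ofReal (1 / (n + 1)) :=
    fun n => hf.eventually_le (div_pos Nat.one_div_pos_of_nat (hK n))
      (ENNReal.ofReal_pos.2 Nat.one_div_pos_of_nat)
  obtain ⟨φ, hφ, hφ'⟩ := extraction_forall_of_eventually h1
  refine ⟨φ, hφ, of_le fun ε hε η hη => ?_⟩
  have h2 : Tendsto (fun n : ℕ => ENNReal.ofReal (1 / ((n : ℝ) + 1))) atTop (𝓝 0) := by
    have := ENNReal.tendsto_ofReal tendsto_one_div_add_atTop_nhds_zero_nat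
    rwa [ENNReal.ofReal_zero] at this
  filter_upwards [ENNReal.tendsto_nhds_zero.1 h2 η hη,
    (tendsto_one_div_add_atTop_nhds_zero_nat (𝕜 := ℝ)).eventually (gt_mem_nhds hε)] with n h3 h4
  refine (measure_mono ?_).trans ((hφ' n).trans h3)
  intro ω hω
  simp only [Set.mem_ofPred_eq] at hω
  simp only [Set.mem_ofPred_eq]
  rw [ENNReal.ofReal_div_of_pos (hK n), ENNReal.div_le_iff_le_mul (Or.inl (by simpa using hK n))
    (Or.inl ENNReal.ofReal_ne_top), mul_comm]
  exact (ENNReal.ofReal_le_ofReal h4.le).trans hω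

/-- Borel–Cantelli with thresholds and measures `2^{-n}`. -/
theorem exists_subseq (hf : Negl μ f) :
    ∃ φ : ℕ → ℕ, StrictMono φ ∧ ∀ᵐ ω ∂μ, Tendsto (fun n => f (φ n) ω) atTop (𝓝 0) := by
  have h1 : ∀ n : ℕ, ∀ᶠ k in atTop,
      μ {ω | ENNReal.ofReal ((1 / 2) ^ n) ≤ f k ω} ≤ ENNReal.ofReal ((1 / 2) ^ n) :=
    fun n => hf.eventually_le (by positivity) (ENNReal.ofReal_pos.2 (by positivity))
  obtain ⟨φ, hφ, hφ'⟩ := extraction_forall_of_eventually h1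
  refine ⟨φ, hφ, ?_⟩
  have hg : Tendsto (fun n : ℕ => ENNReal.ofReal ((1 / 2) ^ n)) atTop (𝓝 0) := by
    have := ENNReal.tendsto_ofReal
      (tendsto_pow_atTop_nhds_zero_of_lt_one (r := (1 / 2 : ℝ)) (by norm_num) (by norm_num))
    rwa [ENNReal.ofReal_zero] at this
  have hsum : ∑' n, μ {ω | ENNReal.ofReal ((1 / 2) ^ n) ≤ f (φ n) ω} ≠ ⊤ := by
    refine ne_top_of_le_ne_top ?_ (ENNReal.tsum_le_tsum hφ')
    rw [← ENNReal.ofReal_tsum_of_nonneg (fun n => by positivity) summable_geometric_two]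
    exact ENNReal.ofReal_ne_top
  filter_upwards [ae_eventually_notMem hsum] with ω hω
  refine tendsto_of_tendsto_of_tendsto_of_le_of_le' tendsto_const_nhds hg
    (Eventually.of_forall fun _ => zero_le) ?_
  filter_upwards [hω] with n hn
  exact (not_le.1 hn).le

end Negl

/-! ### Itô integrals -/

/-- `∫_0^T |Z - X|² ds`. -/
def sqDist {Ω : Type*} (T : ℝ≥0) (Z X : ℝ≥0 → Ω → ℝ) (ω : Ω) : ℝ≥0∞ :=
  ∫⁻ s in Set.Icc (0 : ℝ) T, ENNReal.ofReal ((Z s.toNNReal ω - X s.toNNReal ω) ^ 2)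

section Ito

variable {Ω : Type*} {m : MeasurableSpace Ω} {P : Measure Ω} {𝓕 : Filtration ℝ≥0 m}
  {B : ℝ≥0 → Ω → ℝ}

theorem IsSimple.measurable_path {Z W : ℝ≥0 → Ω → ℝ} (h : IsSimple 𝓕 B Z W) (ω : Ω) :
    Measurable fun r => Z r ω := by
  obtain ⟨ι, I, s, e, c, -, -, h3, -⟩ := h
  simp_rw [h3]
  exact Finset.measurable_fun_sum _ fun i _ => measurable_const.indicator measurableSet_Ioc

theorem IsSimple.continuous_path {Z W : ℝ≥0 → Ω → ℝ} (h : IsSimple 𝓕 B Z W) {ω : Ω}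
    (hB : Continuous fun t => B t ω) : Continuous fun t => W t ω := by
  obtain ⟨ι, I, s, e, c, -, -, -, h4⟩ := h
  simp_rw [h4]
  refine continuous_finsetSum _ fun i _ => continuous_const.mul (Continuous.sub ?_ ?_)
  · exact hB.comp (continuous_const.min continuous_id)
  · exact hB.comp (continuous_const.min continuous_id)

theorem sqDist_comm (T : ℝ≥0) (Z X : ℝ≥0 → Ω → ℝ) (ω : Ω) : sqDist T Z X ω = sqDist T X Z ω := by
  unfold sqDist
  refine lintegral_congr fun s => ?_
  rw [← neg_sub, neg_sq]

theorem sqDist_mono {S T : ℝ≥0} (hST : S ≤ T) (Z X : ℝ≥0 → Ω → ℝ) (ω : Ω) :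
    sqDist S Z X ω ≤ sqDist T Z X ω :=
  lintegral_mono_set (Set.Icc_subset_Icc_right (by exact_mod_cast hST))

theorem sqDist_triangle {T : ℝ≥0} {Z X Z' : ℝ≥0 → Ω → ℝ} {ω : Ω}
    (hZ : Measurable fun r => Z r ω) (hX : Measurable fun r => X r ω) :
    sqDist T Z Z' ω ≤ 2 * (sqDist T Z X ω + sqDist T X Z' ω) := by
  unfold sqDist
  rw [← lintegral_add_left, ← lintegral_const_mul' _ _ (by norm_num)]
  · refine lintegral_mono fun s => ?_
    rw [← ENNReal.ofReal_add (sq_nonneg _) (sq_nonneg _), ← ENNReal.ofReal_ofNat 2,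
      ← ENNReal.ofReal_mul (by norm_num)]
    refine ENNReal.ofReal_le_ofReal ?_
    nlinarith [sq_nonneg (Z s.toNNReal ω - X s.toNNReal ω - (X s.toNNReal ω - Z' s.toNNReal ω))]
  · exact ENNReal.measurable_ofReal.comp (((hZ.comp measurable_real_toNNReal).sub
      (hX.comp measurable_real_toNNReal)).pow_const 2)

variable [IsProbabilityMeasure P] {μ : Measure Ω}

/-- In the Lenglart bound `δ` is fixed first, to make the deterministic term small, and then `n` is
taken large for the energy. The level `ε / 2` appears because a supremum of at least `ε` need not be
attained. -/
theorem Negl.iSup_simple (hB : IsFilteredBrownian P 𝓕 B) (hμ : μ ≤ P)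
    {Z W : ℕ → ℝ≥0 → Ω → ℝ} (h : ∀ n, IsSimple 𝓕 B (Z n) (W n)) {T : ℝ≥0}
    (hE : Negl μ fun n ω => sqDist T (Z n) (fun _ _ => 0) ω) (q : ℕ → ℕ → ℝ≥0)
    (hq : ∀ n i, q n i ≤ T) : Negl μ fun n ω => ⨆ i, ENNReal.ofReal |W n (q n i) ω| := by
  refine Negl.of_le fun ε hε η hη => ?_
  obtain ⟨δ, hδ, hδη⟩ : ∃ δ : ℝ, 0 < δ ∧ ENNReal.ofReal (δ / (ε / 2) ^ 2) ≤ η / 2 := by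
    rcases eq_or_ne η ⊤ with rfl | hηt
    · exact ⟨1, one_pos, by simp [ENNReal.top_div]⟩
    · have h2 : 0 < (η / 2).toReal := ENNReal.toReal_pos (ENNReal.half_pos hη.ne').ne'
        (ENNReal.div_ne_top hηt two_ne_zero)
      refine ⟨(η / 2).toReal * (ε / 2) ^ 2, by positivity, ?_⟩
      rw [mul_div_cancel_right₀ _ (by positivity), ENNReal.ofReal_toReal
        (ENNReal.div_ne_top hηt two_ne_zero)]
  filter_upwards [hE.eventually_le hδ (ENNReal.half_pos hη.ne')] with n hn
  refine (measure_mono ?_).trans (((h n).measure_sequence_le hB hμ (q n) (hq n) hδ.le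
    (half_pos hε)).trans ((add_le_add ((measure_mono ?_).trans hn) hδη).trans_eq
      (ENNReal.add_halves η)))
  · intro ω hω
    simp only [Set.mem_ofPred_eq] at hω
    have h1 : ENNReal.ofReal (ε / 2) < ⨆ i, ENNReal.ofReal |W n (q n i) ω| :=
      lt_of_lt_of_le ((ENNReal.ofReal_lt_ofReal_iff hε).2 (half_lt_self hε)) hω
    obtain ⟨i, hi⟩ := lt_iSup_iff.1 h1
    exact ⟨i, (ENNReal.ofReal_lt_ofReal_iff_of_nonneg (half_pos hε).le).1 hi |>.le⟩
  · intro ω hω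
    simp only [Set.mem_ofPred_eq] at hω
    simpa [sqDist] using hω.le

theorem Negl.sum_sq_simple (hB : IsFilteredBrownian P 𝓕 B) (hμ : μ ≤ P)
    {Z W : ℕ → ℝ≥0 → Ω → ℝ} (h : ∀ n, IsSimple 𝓕 B (Z n) (W n)) {T : ℝ≥0}
    (hE : Negl μ fun n ω => sqDist T (Z n) (fun _ _ => 0) ω) {t : ℕ → ℕ → ℝ≥0}
    (ht : ∀ n, Monotone (t n)) (N : ℕ → ℕ) (htN : ∀ n, t n (N n) ≤ T) :
    Negl μ fun n ω => ENNReal.ofReal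
      (∑ i ∈ Finset.range (N n), (W n (t n (i + 1)) ω - W n (t n i) ω) ^ 2) := by
  refine Negl.of_le fun ε hε η hη => ?_
  obtain ⟨δ, hδ, hδη⟩ : ∃ δ : ℝ, 0 < δ ∧ ENNReal.ofReal (δ / ε) ≤ η / 2 := by
    rcases eq_or_ne η ⊤ with rfl | hηt
    · exact ⟨1, one_pos, by simp [ENNReal.top_div]⟩
    · have h2 : 0 < (η / 2).toReal := ENNReal.toReal_pos (ENNReal.half_pos hη.ne').ne'
        (ENNReal.div_ne_top hηt two_ne_zero)
      refine ⟨(η / 2).toReal * ε, by positivity, ?_⟩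
      rw [mul_div_cancel_right₀ _ hε.ne', ENNReal.ofReal_toReal
        (ENNReal.div_ne_top hηt two_ne_zero)]
  filter_upwards [hE.eventually_le hδ (ENNReal.half_pos hη.ne')] with n hn
  refine (measure_mono ?_).trans (((h n).measure_sum_sq_le hB hμ (ht n) (N n) hδ.le
    hε).trans ((add_le_add ((measure_mono ?_).trans hn) hδη).trans_eq
      (ENNReal.add_halves η)))
  · intro ω hω
    simp only [Set.mem_ofPred_eq] at hω
    exact (ENNReal.ofReal_le_ofReal_iff
      (Finset.sum_nonneg fun i _ => sq_nonneg _)).1 hω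
  · intro ω hω
    simp only [Set.mem_ofPred_eq] at hω
    refine hω.le.trans ?_
    simpa [sqDist] using sqDist_mono (htN n) (Z n) (fun _ _ => 0) ω

end Ito


/-! ### Approximation and continuity of Itô integrals, and their Euler remainders -/

section Ito

variable {Ω : Type*} {m : MeasurableSpace Ω} {P : Measure Ω} {𝓕 : Filtration ℝ≥0 m}
  {B : ℝ≥0 → Ω → ℝ}

theorem HasItoIntegralOn.mono {X : ℝ≥0 → Ω → ℝ} {t : ℝ≥0} {A A' : Set Ω} {J : Ω → ℝ}
    (h : HasItoIntegralOn P 𝓕 B X t A J) (hA : A' ⊆ A) : HasItoIntegralOn P 𝓕 B X t A' J := by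
  obtain ⟨Y, h1, h2⟩ := h
  refine ⟨Y, fun ε hε => ?_, fun ε hε => ?_⟩
  · exact tendsto_of_tendsto_of_tendsto_of_le_of_le tendsto_const_nhds (h1 ε hε)
      (fun _ => zero_le) fun n => measure_mono fun ω hω => ⟨hA hω.1, hω.2⟩
  · exact tendsto_of_tendsto_of_tendsto_of_le_of_le tendsto_const_nhds (h2 ε hε)
      (fun _ => zero_le) fun n => measure_mono fun ω hω => ⟨hA hω.1, hω.2⟩

theorem HasItoIntegralOn.exists_negl {X : ℝ≥0 → Ω → ℝ} {t : ℝ≥0} {A : Set Ω} {J : Ω → ℝ}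
    (h : HasItoIntegralOn P 𝓕 B X t A J) (hA : MeasurableSet A) :
    ∃ Y : ℕ → ElementaryProcess 𝓕,
      Negl (P.restrict A) (fun n ω => sqDist t (Y n).val X ω) ∧
      Negl (P.restrict A) (fun n ω => ENNReal.ofReal |(Y n).integral B t ω - J ω|) := by
  obtain ⟨Y, h1, h2⟩ := h
  refine ⟨Y, fun ε hε => (h1 ε hε).congr fun n => ?_, fun ε hε => (h2 ε hε).congr fun n => ?_⟩
  · rw [Measure.restrict_apply' hA]
    congr 1
    ext ω
    exact and_comm
  · rw [Measure.restrict_apply' hA]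
    congr 1
    ext ω
    simp only [Set.mem_ofPred_eq, Set.mem_inter_iff]
    rw [ENNReal.ofReal_le_ofReal_iff (abs_nonneg _)]
    exact and_comm

variable [IsProbabilityMeasure P] {A : Set Ω} {X I : ℝ≥0 → Ω → ℝ} {T : ℝ≥0}

theorem ElementaryProcess.measurable_val (Y : ElementaryProcess 𝓕) (ω : Ω) :
    Measurable fun r => Y.val r ω :=
  (Y.isSimple (B := fun _ _ => 0)).measurable_path ω

theorem sqDist_sub_zero (T : ℝ≥0) (Z Z' : ℝ≥0 → Ω → ℝ) (ω : Ω) :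
    sqDist T (fun r ω => Z r ω - Z' r ω) (fun _ _ => 0) ω = sqDist T Z Z' ω := by
  simp [sqDist]

/-- Elementary approximations of an Itô integral at time `T` approximate it at all earlier times
of a given sequence, uniformly. -/
theorem exists_ito_approx (hB : IsFilteredBrownian P 𝓕 B) (hA : MeasurableSet A)
    (hX : ∀ ω, Measurable fun r => X r ω)
    (hI : ∀ t ≤ T, HasItoIntegralOn P 𝓕 B X t A (I t)) :
    ∃ Y : ℕ → ElementaryProcess 𝓕,
      Negl (P.restrict A) (fun n ω => sqDist T (Y n).val X ω) ∧
      ∀ q : ℕ → ℝ≥0, (∀ i, q i ≤ T) → Negl (P.restrict A) (fun n ω =>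
        ⨆ i, ENNReal.ofReal |I (q i) ω - (Y n).integral B (q i) ω|) := by
  obtain ⟨Y, hY1, -⟩ := (hI T le_rfl).exists_negl hA
  have hμ : P.restrict A ≤ P := Measure.restrict_le_self
  refine ⟨Y, hY1, fun q hq => ?_⟩
  -- The integral at time `t` comes with its own approximating sequence `Y'`. Since `Y - Y'` has
  -- vanishing energy on `[0, t]`, the integrals of `Y` converge to `I t` as well.
  have hpt : ∀ t ≤ T, Negl (P.restrict A)
      (fun n ω => ENNReal.ofReal |I t ω - (Y n).integral B t ω|) := by
    intro t ht
    obtain ⟨Y', hY'1, hY'2⟩ := (hI t ht).exists_negl hA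
    have hS : ∀ n, IsSimple 𝓕 B (fun r ω => (Y n).val r ω - (Y' n).val r ω)
        (fun r ω => (Y n).integral B r ω - (Y' n).integral B r ω) := fun n =>
      (Y n).isSimple.sub (Y' n).isSimple
    have hE : Negl (P.restrict A) fun n ω =>
        sqDist t (fun r ω => (Y n).val r ω - (Y' n).val r ω) (fun _ _ => 0) ω := by
      refine ((hY1.add hY'1).const_mul (c := 2) (by norm_num)).mono fun n =>
        ae_of_all _ fun ω => ?_
      rw [sqDist_sub_zero]
      refine (sqDist_triangle ((Y n).measurable_val ω) (hX ω)).trans ?_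
      rw [sqDist_comm t X]
      gcongr
      exact sqDist_mono ht _ _ ω
    have hsup := Negl.iSup_simple hB hμ hS hE (fun _ _ => t) (fun _ _ => le_rfl)
    refine (hsup.add hY'2).mono fun n => ae_of_all _ fun ω => ?_
    simp only [ciSup_const]
    rw [← ENNReal.ofReal_add (abs_nonneg _) (abs_nonneg _)]
    refine ENNReal.ofReal_le_ofReal ?_
    rw [abs_sub_comm]
    refine le_trans (le_of_eq ?_) (abs_add_le _ _)
    congr 1
    ring
  -- The maximal inequality is applied to `Y l - Y k`, then `l → ∞` at finitely many times, and
  -- finally the number of times grows. The thresholds `δ / 4` absorb the factor `2` in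
  -- `sqDist_triangle`.
  have hbound : ∀ k, ∀ ε δ : ℝ, 0 < ε → 0 < δ →
      P.restrict A {ω | ∃ i, ε ≤ |I (q i) ω - (Y k).integral B (q i) ω|} ≤
      P.restrict A {ω | ENNReal.ofReal (δ / 4) ≤ sqDist T (Y k).val X ω} +
        ENNReal.ofReal (δ / (ε / 2) ^ 2) := by
    intro k ε δ hε hδ
    have hfin : ∀ n : ℕ,
        P.restrict A {ω | ∃ i < n, ε ≤ |I (q i) ω - (Y k).integral B (q i) ω|} ≤
        P.restrict A {ω | ENNReal.ofReal (δ / 4) ≤ sqDist T (Y k).val X ω} +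
        ENNReal.ofReal (δ / (ε / 2) ^ 2) := by
      intro n
      have hlim : Tendsto (fun l : ℕ => (∑ i ∈ Finset.range n, P.restrict A
          {ω | ENNReal.ofReal (ε / 2) ≤ ENNReal.ofReal |I (q i) ω - (Y l).integral B (q i) ω|}) +
          (P.restrict A {ω | ENNReal.ofReal (δ / 4) ≤ sqDist T (Y l).val X ω} +
          (P.restrict A {ω | ENNReal.ofReal (δ / 4) ≤ sqDist T (Y k).val X ω} +
            ENNReal.ofReal (δ / (ε / 2) ^ 2)))) atTop
          (𝓝 ((∑ i ∈ Finset.range n, 0) + (0 +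
            (P.restrict A {ω | ENNReal.ofReal (δ / 4) ≤ sqDist T (Y k).val X ω} +
            ENNReal.ofReal (δ / (ε / 2) ^ 2))))) := by
        refine Tendsto.add (tendsto_finsetSum _ fun i _ => hpt _ (hq i) _ (half_pos hε))
          (Tendsto.add (hY1 _ (by positivity)) tendsto_const_nhds)
      simp only [Finset.sum_const_zero, zero_add] at hlim
      refine ge_of_tendsto' hlim fun l => ?_
      have hS : IsSimple 𝓕 B (fun r ω => (Y l).val r ω - (Y k).val r ω)
        (fun r ω => (Y l).integral B r ω - (Y k).integral B r ω) :=
        (Y l).isSimple.sub (Y k).isSimple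
      have h1 := hS.measure_sequence_le hB hμ q hq hδ.le (half_pos hε)
      have h2 : P.restrict A {ω | ENNReal.ofReal δ < ∫⁻ r in Set.Icc (0 : ℝ) T,
          ENNReal.ofReal (((Y l).val r.toNNReal ω - (Y k).val r.toNNReal ω) ^ 2)} ≤
          P.restrict A {ω | ENNReal.ofReal (δ / 4) ≤ sqDist T (Y l).val X ω} +
          P.restrict A {ω | ENNReal.ofReal (δ / 4) ≤ sqDist T (Y k).val X ω} := by
        refine (measure_mono ?_).trans (measure_union_le _ _)
        intro ω hω
        by_contra hcon
        simp only [Set.mem_union, Set.mem_ofPred_eq, not_or, not_le] at hcon hω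
        have h3 := sqDist_triangle (T := T) (Z' := (Y k).val) ((Y l).measurable_val ω) (hX ω)
        rw [sqDist_comm T X] at h3
        have h4 : (2 : ℝ≥0∞) * (sqDist T (Y l).val X ω + sqDist T (Y k).val X ω) ≤
            ENNReal.ofReal δ := by
          calc (2 : ℝ≥0∞) * (sqDist T (Y l).val X ω + sqDist T (Y k).val X ω)
              ≤ 2 * (ENNReal.ofReal (δ / 4) + ENNReal.ofReal (δ / 4)) := by
                gcongr
                · exact hcon.1.le
                · exact hcon.2.le
            _ = ENNReal.ofReal δ := by
                rw [← ENNReal.ofReal_add (by positivity) (by positivity),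
                  ← ENNReal.ofReal_ofNat 2, ← ENNReal.ofReal_mul (by norm_num)]
                congr 1
                ring
        exact absurd (hω.trans_le h3) (not_lt.2 h4)
      have h3 : {ω | ∃ i < n, ε ≤ |I (q i) ω - (Y k).integral B (q i) ω|} ⊆
          (⋃ i ∈ Finset.range n, {ω | ENNReal.ofReal (ε / 2) ≤
            ENNReal.ofReal |I (q i) ω - (Y l).integral B (q i) ω|}) ∪
          {ω | ∃ i, ε / 2 ≤ |(Y l).integral B (q i) ω - (Y k).integral B (q i) ω|} := by
        rintro ω ⟨i, hi, hω⟩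
        by_cases hc : ε / 2 ≤ |I (q i) ω - (Y l).integral B (q i) ω|
        · left
          simp only [Set.mem_iUnion, Finset.mem_range]
          exact ⟨i, hi, ENNReal.ofReal_le_ofReal hc⟩
        · right
          refine ⟨i, ?_⟩
          have := abs_sub_le (I (q i) ω) ((Y l).integral B (q i) ω) ((Y k).integral B (q i) ω)
          linarith [not_le.1 hc]
      refine (measure_mono h3).trans ((measure_union_le _ _).trans ?_)
      refine add_le_add (measure_biUnion_finset_le _ _) (h1.trans ?_)
      rw [← add_assoc]
      gcongr
    have hU : {ω | ∃ i, ε ≤ |I (q i) ω - (Y k).integral B (q i) ω|} =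
        ⋃ n : ℕ, {ω | ∃ i < n, ε ≤ |I (q i) ω - (Y k).integral B (q i) ω|} := by
      ext ω
      simp only [Set.mem_ofPred_eq, Set.mem_iUnion]
      exact ⟨fun ⟨i, hi⟩ => ⟨i + 1, i, i.lt_succ_self, hi⟩, fun ⟨_, i, _, hi⟩ => ⟨i, hi⟩⟩
    rw [hU, Monotone.measure_iUnion]
    · exact iSup_le hfin
    · rintro n n' hnn ω ⟨i, hi, hω⟩
      exact ⟨i, hi.trans_le hnn, hω⟩
  refine Negl.of_le fun ε hε η hη => ?_
  obtain ⟨δ, hδ, hδη⟩ : ∃ δ : ℝ, 0 < δ ∧ ENNReal.ofReal (δ / (ε / 2 / 2) ^ 2) ≤ η / 2 := by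
    rcases eq_or_ne η ⊤ with rfl | hηt
    · exact ⟨1, one_pos, by simp [ENNReal.top_div]⟩
    · have h2 : 0 < (η / 2).toReal := ENNReal.toReal_pos (ENNReal.half_pos hη.ne').ne'
        (ENNReal.div_ne_top hηt two_ne_zero)
      refine ⟨(η / 2).toReal * (ε / 2 / 2) ^ 2, by positivity, ?_⟩
      rw [mul_div_cancel_right₀ _ (by positivity), ENNReal.ofReal_toReal
        (ENNReal.div_ne_top hηt two_ne_zero)]
  filter_upwards [hY1.eventually_le (ε := δ / 4) (by positivity) (ENNReal.half_pos hη.ne')]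
    with n hn
  refine (measure_mono ?_).trans ((hbound n (ε / 2) δ (half_pos hε) hδ).trans
    ((add_le_add hn hδη).trans_eq (ENNReal.add_halves η)))
  intro ω hω
  simp only [Set.mem_ofPred_eq] at hω
  have h1 : ENNReal.ofReal (ε / 2) < ⨆ i, ENNReal.ofReal |I (q i) ω - (Y n).integral B (q i) ω| :=
    lt_of_lt_of_le ((ENNReal.ofReal_lt_ofReal_iff hε).2 (half_lt_self hε)) hω
  obtain ⟨i, hi⟩ := lt_iSup_iff.1 h1
  exact ⟨i, (ENNReal.ofReal_lt_ofReal_iff_of_nonneg (half_pos hε).le).1 hi |>.le⟩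

/-- An Itô integral process is uniformly continuous along countable bounded sets of times. -/
theorem ae_uniformContinuousOn_ito (hB : IsFilteredBrownian P 𝓕 B) (hA : MeasurableSet A)
    (hX : ∀ ω, Measurable fun r => X r ω)
    (hI : ∀ t ≤ T, HasItoIntegralOn P 𝓕 B X t A (I t)) {q : ℕ → ℝ≥0} (hq : ∀ i, q i ≤ T) :
    ∀ᵐ ω ∂(P.restrict A), UniformContinuousOn (fun t => I t ω) (Set.range q) := by
  obtain ⟨Y, -, hY⟩ := exists_ito_approx hB hA hX hI
  -- Along this subsequence the approximations converge almost surely uniformly on the range of `q`,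
  -- so the limit inherits the uniform continuity of their continuous paths.
  obtain ⟨φ, -, hφ⟩ := (hY q hq).exists_subseq
  filter_upwards [hφ, ae_restrict_of_ae hB.brownian.cont] with ω h1 h2
  rw [Metric.uniformContinuousOn_iff]
  intro ε hε
  obtain ⟨k, hk⟩ := ((tendsto_order.1 h1).2 (ENNReal.ofReal (ε / 3)) (by simpa using hε)).exists
  have hc : ∀ i, |I (q i) ω - (Y (φ k)).integral B (q i) ω| < ε / 3 := fun i =>
    (ENNReal.ofReal_lt_ofReal_iff (by positivity)).1
      ((le_iSup (fun i => ENNReal.ofReal |I (q i) ω - (Y (φ k)).integral B (q i) ω|) i).trans_lt hk)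
  have hu : UniformContinuousOn (fun t => (Y (φ k)).integral B t ω) (Set.Icc 0 T) :=
    isCompact_Icc.uniformContinuousOn_of_continuous
      ((Y (φ k)).isSimple.continuous_path h2).continuousOn
  obtain ⟨δ, hδ, hd⟩ := Metric.uniformContinuousOn_iff.1 hu (ε / 3) (by positivity)
  refine ⟨δ, hδ, ?_⟩
  rintro _ ⟨i, rfl⟩ _ ⟨j, rfl⟩ hij
  have h3 := hd (q i) ⟨zero_le, hq i⟩ (q j) ⟨zero_le, hq j⟩ hij
  rw [Real.dist_eq] at h3 ⊢
  have h4 := hc i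
  have h5 := hc j
  rw [abs_lt] at *
  constructor <;> linarith [h3.1, h3.2, h4.1, h4.2, h5.1, h5.2]

/-- The piecewise constant process with the dyadic values of `X`. -/
def stepProc (T : ℝ≥0) (n : ℕ) (X : ℝ≥0 → Ω → ℝ) (r : ℝ≥0) (ω : Ω) : ℝ :=
  ∑ i ∈ Finset.range (2 ^ n),
    (Set.Ioc (grid T n i) (grid T n (i + 1))).indicator (fun _ => X (grid T n i) ω) r

/-- The integral process of `stepProc`. -/
def stepInt (B : ℝ≥0 → Ω → ℝ) (T : ℝ≥0) (n : ℕ) (X : ℝ≥0 → Ω → ℝ) (t : ℝ≥0) (ω : Ω) : ℝ :=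
  ∑ i ∈ Finset.range (2 ^ n),
    X (grid T n i) ω * (B (min (grid T n (i + 1)) t) ω - B (min (grid T n i) t) ω)

theorem isSimple_stepProc (hX : ∀ t, Measurable[𝓕 t] (X t)) (T : ℝ≥0) (n : ℕ) :
    IsSimple 𝓕 B (stepProc T n X) (stepInt B T n X) :=
  ⟨ℕ, Finset.range (2 ^ n), grid T n, fun i => grid T n (i + 1), fun i => X (grid T n i),
    fun i _ => grid_mono T n i.le_succ, fun i _ => hX _, fun _ _ => rfl, fun _ _ => rfl⟩

theorem stepInt_sub (T : ℝ≥0) (n : ℕ) {i : ℕ} (hi : i < 2 ^ n) (ω : Ω) :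
    stepInt B T n X (grid T n (i + 1)) ω - stepInt B T n X (grid T n i) ω =
      X (grid T n i) ω * (B (grid T n (i + 1)) ω - B (grid T n i) ω) := by
  unfold stepInt
  rw [← Finset.sum_sub_distrib, Finset.sum_eq_single_of_mem i (Finset.mem_range.2 hi)]
  · have := grid_mono T n i.le_succ
    rw [min_self, min_eq_left this, min_eq_right this, min_self]
    ring
  · intro j _ hji
    rcases lt_or_gt_of_ne hji with h | h
    · have h1 : grid T n (j + 1) ≤ grid T n i := grid_mono T n h
      have h2 : grid T n j ≤ grid T n i := grid_mono T n h.le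
      have h3 : grid T n i ≤ grid T n (i + 1) := grid_mono T n i.le_succ
      rw [min_eq_left h1, min_eq_left h2, min_eq_left (h1.trans h3), min_eq_left (h2.trans h3)]
      ring
    · have h1 : grid T n (i + 1) ≤ grid T n j := grid_mono T n h
      have h2 : grid T n j ≤ grid T n (j + 1) := grid_mono T n j.le_succ
      have h3 : grid T n i ≤ grid T n (i + 1) := grid_mono T n i.le_succ
      rw [min_eq_right h1, min_eq_right (h1.trans h2), min_eq_right (h3.trans h1),
        min_eq_right (h3.trans (h1.trans h2))]
      ring

/-- An enumeration of all dyadic points of `[0, T]`. -/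
def dyadicSeq (T : ℝ≥0) (j : ℕ) : ℝ≥0 :=
  if (Nat.unpair j).2 ≤ 2 ^ (Nat.unpair j).1 then grid T (Nat.unpair j).1 (Nat.unpair j).2 else 0

theorem dyadicSeq_le (T : ℝ≥0) (j : ℕ) : dyadicSeq T j ≤ T := by
  unfold dyadicSeq
  split_ifs with h
  · exact grid_le h
  · exact zero_le

theorem exists_dyadicSeq_eq (T : ℝ≥0) {n i : ℕ} (hi : i ≤ 2 ^ n) :
    ∃ j, dyadicSeq T j = grid T n i :=
  ⟨Nat.pair n i, by simp [dyadicSeq, hi]⟩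

theorem exists_eq_grid_dyadicSeq (T : ℝ≥0) (j : ℕ) :
    ∃ n i, i ≤ 2 ^ n ∧ dyadicSeq T j = grid T n i := by
  unfold dyadicSeq
  split_ifs with h
  · exact ⟨_, _, h, rfl⟩
  · exact ⟨0, 0, by simp, (grid_zero T 0).symm⟩

/-- The error of the Euler approximation of an Itô integral over a dyadic interval. -/
def itoRem (B X I : ℝ≥0 → Ω → ℝ) (T : ℝ≥0) (n i : ℕ) (ω : Ω) : ℝ :=
  I (grid T n (i + 1)) ω - I (grid T n i) ω -
    X (grid T n i) ω * (B (grid T n (i + 1)) ω - B (grid T n i) ω)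

/-- The Itô integral is close, at the dyadic points, to integrals of simple processes. -/
theorem exists_simple_close (hB : IsFilteredBrownian P 𝓕 B) (hA : MeasurableSet A)
    (hXa : ∀ t, Measurable[𝓕 t] (X t)) (hX : ∀ ω, Measurable fun r => X r ω)
    (hI : ∀ t ≤ T, HasItoIntegralOn P 𝓕 B X t A (I t))
    (hstep : Negl (P.restrict A) fun n ω => sqDist T (stepProc T n X) X ω) :
    ∃ (Z W : ℕ → ℝ≥0 → Ω → ℝ) (f : ℕ → Ω → ℝ≥0∞), (∀ n, IsSimple 𝓕 B (Z n) (W n)) ∧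
      Negl (P.restrict A) (fun n ω => sqDist T (Z n) (fun _ _ => 0) ω) ∧
      Negl (P.restrict A) (fun n ω => ENNReal.ofReal (2 ^ n) * f n ω) ∧
      ∀ n, ∀ i < 2 ^ n, ∀ ω, ENNReal.ofReal |itoRem B X I T n i ω -
        (W n (grid T n (i + 1)) ω - W n (grid T n i) ω)| ≤ 2 * f n ω := by
  obtain ⟨Y, hY1, hY2⟩ := exists_ito_approx hB hA hX hI
  -- The approximation is taken so fine at level `n` that even `2 ^ n` times its uniform error is
  -- negligible.
  obtain ⟨φ, hφ, hφ2⟩ := (hY2 (dyadicSeq T) (dyadicSeq_le T)).exists_diag (fun n => 2 ^ n)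
    fun n => by positivity
  refine ⟨fun n r ω => (Y (φ n)).val r ω - stepProc T n X r ω,
    fun n t ω => (Y (φ n)).integral B t ω - stepInt B T n X t ω, _,
    fun n => (Y (φ n)).isSimple.sub (isSimple_stepProc hXa T n), ?_, hφ2, ?_⟩
  · refine (((hY1.comp_strictMono hφ).add hstep).const_mul (c := 2) (by norm_num)).mono fun n =>
      ae_of_all _ fun ω => ?_
    rw [sqDist_sub_zero]
    refine (sqDist_triangle ((Y (φ n)).measurable_val ω) (hX ω)).trans ?_
    rw [sqDist_comm T X]
  · intro n i hi ω
    have h1 : ∀ i ≤ 2 ^ n, ENNReal.ofReal |I (grid T n i) ω - (Y (φ n)).integral B (grid T n i) ω| ≤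
        ⨆ j, ENNReal.ofReal |I (dyadicSeq T j) ω - (Y (φ n)).integral B (dyadicSeq T j) ω| := by
      intro i hi
      obtain ⟨j, hj⟩ := exists_dyadicSeq_eq T hi
      rw [← hj]
      exact le_iSup (fun j => ENNReal.ofReal
        |I (dyadicSeq T j) ω - (Y (φ n)).integral B (dyadicSeq T j) ω|) j
    have h2 := stepInt_sub (B := B) (X := X) T n hi ω
    have h3 : itoRem B X I T n i ω - ((Y (φ n)).integral B (grid T n (i + 1)) ω -
        stepInt B T n X (grid T n (i + 1)) ω - ((Y (φ n)).integral B (grid T n i) ω -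
        stepInt B T n X (grid T n i) ω)) =
        (I (grid T n (i + 1)) ω - (Y (φ n)).integral B (grid T n (i + 1)) ω) -
        (I (grid T n i) ω - (Y (φ n)).integral B (grid T n i) ω) := by
      rw [itoRem, ← h2]; ring
    rw [h3, two_mul]
    refine (ENNReal.ofReal_le_ofReal (abs_sub _ _)).trans ?_
    rw [ENNReal.ofReal_add (abs_nonneg _) (abs_nonneg _)]
    exact add_le_add (h1 _ hi) (h1 _ hi.le)

/-- Up to a negligible uniform error, the remainders are increments of stochastic integrals whose
energy tends to zero. The vanishing sum of squares makes cross terms disappear by Cauchy–Schwarz. -/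
theorem negl_sum_sq_itoRem (hB : IsFilteredBrownian P 𝓕 B) (hA : MeasurableSet A)
    (hXa : ∀ t, Measurable[𝓕 t] (X t)) (hX : ∀ ω, Measurable fun r => X r ω)
    (hI : ∀ t ≤ T, HasItoIntegralOn P 𝓕 B X t A (I t))
    (hstep : Negl (P.restrict A) fun n ω => sqDist T (stepProc T n X) X ω) :
    Negl (P.restrict A) fun n ω =>
      ENNReal.ofReal (∑ i ∈ Finset.range (2 ^ n), itoRem B X I T n i ω ^ 2) := by
  obtain ⟨Z, W, f, hS, hE, hf, hclose⟩ := exists_simple_close hB hA hXa hX hI hstep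
  have h1 := Negl.sum_sq_simple hB Measure.restrict_le_self hS hE (fun n => grid_mono T n)
    (fun n => 2 ^ n) (fun n => (grid_last T n).le)
  refine ((h1.const_mul (c := 2) (by norm_num)).add
    (hf.sq.const_mul (c := 8) (by norm_num))).mono fun n => ae_of_all _ fun ω => ?_
  rcases eq_or_ne (f n ω) ⊤ with hft | hft
  · rw [hft, ENNReal.mul_top (by simp)]
    simp
  · set F := (f n ω).toReal
    have hF : f n ω = ENNReal.ofReal F := (ENNReal.ofReal_toReal hft).symm
    have hF0 : 0 ≤ F := ENNReal.toReal_nonneg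
    -- From `x² ≤ 2y² + 2(x - y)²` with `|x - y| ≤ 2F`.
    have hsum : ∀ i ∈ Finset.range (2 ^ n), itoRem B X I T n i ω ^ 2 ≤
        2 * (W n (grid T n (i + 1)) ω - W n (grid T n i) ω) ^ 2 + 8 * F ^ 2 := by
      intro i hi
      have h2 := hclose n i (Finset.mem_range.1 hi) ω
      rw [hF, ← ENNReal.ofReal_ofNat 2, ← ENNReal.ofReal_mul (by norm_num),
        ENNReal.ofReal_le_ofReal_iff (by positivity), abs_le] at h2
      set x := itoRem B X I T n i ω
      set y := W n (grid T n (i + 1)) ω - W n (grid T n i) ω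
      nlinarith [sq_nonneg (x - 2 * y)]
    have h2 := Finset.sum_le_sum hsum
    rw [Finset.sum_add_distrib, ← Finset.mul_sum, Finset.sum_const, Finset.card_range,
      nsmul_eq_mul] at h2
    push_cast at h2
    have h3 : (2 : ℝ) ^ n * (8 * F ^ 2) ≤ 8 * (2 ^ n * F) ^ 2 := by
      have : (1 : ℝ) ≤ 2 ^ n := one_le_pow₀ (by norm_num)
      have h4 : 0 ≤ (2 : ℝ) ^ n * F ^ 2 * (2 ^ n - 1) := by
        have := sub_nonneg.2 this
        positivity
      nlinarith
    rw [hF, ← ENNReal.ofReal_mul (by positivity), ← ENNReal.ofReal_pow (by positivity),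
      ← ENNReal.ofReal_ofNat 2, ← ENNReal.ofReal_ofNat 8, ← ENNReal.ofReal_mul (by norm_num),
      ← ENNReal.ofReal_mul (by norm_num), ← ENNReal.ofReal_add]
    · exact ENNReal.ofReal_le_ofReal (h2.trans (by gcongr))
    · exact mul_nonneg (by norm_num) (Finset.sum_nonneg fun i _ => sq_nonneg _)
    · positivity

/-- The supremum of the dyadic values of a process. -/
def dyadicSup (T : ℝ≥0) (c : ℝ≥0 → Ω → ℝ) (ω : Ω) : ℝ≥0∞ :=
  ⨆ j, ENNReal.ofReal |c (dyadicSeq T j) ω|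

theorem measurable_dyadicSup {c : ℝ≥0 → Ω → ℝ} (hc : ∀ t, Measurable[𝓕 t] (c t)) (T : ℝ≥0) :
    Measurable (dyadicSup T c) :=
  Measurable.iSup fun j => ENNReal.measurable_ofReal.comp
    (((hc (dyadicSeq T j)).mono (𝓕.le _) le_rfl).abs)

theorem le_dyadicSup {c : ℝ≥0 → Ω → ℝ} {T : ℝ≥0} {n i : ℕ} (hi : i ≤ 2 ^ n) (ω : Ω) :
    ENNReal.ofReal |c (grid T n i) ω| ≤ dyadicSup T c ω := by
  obtain ⟨j, hj⟩ := exists_dyadicSeq_eq T hi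
  rw [← hj]
  exact le_iSup (fun j => ENNReal.ofReal |c (dyadicSeq T j) ω|) j

theorem dyadicSup_ne_top {c : ℝ≥0 → Ω → ℝ} {T : ℝ≥0} {ω : Ω} {R : ℝ}
    (h : ∀ n i, i ≤ 2 ^ n → |c (grid T n i) ω| ≤ R) : dyadicSup T c ω ≠ ⊤ := by
  refine ne_top_of_le_ne_top ENNReal.ofReal_ne_top (iSup_le (a := ENNReal.ofReal R) fun j => ?_)
  obtain ⟨n, i, hi, hj⟩ := exists_eq_grid_dyadicSeq T j
  rw [hj]
  exact ENNReal.ofReal_le_ofReal (h n i hi)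

/-- Taking absolute values would lose the stochastic cancellation. Instead the adapted weights go
into the integrand, whose energy grows at most by the square of the almost surely finite `dyadicSup
T c`, and the maximal inequality applies once more. -/
theorem negl_sum_mul_itoRem (hB : IsFilteredBrownian P 𝓕 B) (hA : MeasurableSet A)
    (hXa : ∀ t, Measurable[𝓕 t] (X t)) (hX : ∀ ω, Measurable fun r => X r ω)
    (hI : ∀ t ≤ T, HasItoIntegralOn P 𝓕 B X t A (I t))
    (hstep : Negl (P.restrict A) fun n ω => sqDist T (stepProc T n X) X ω)
    {c : ℝ≥0 → Ω → ℝ} (hc : ∀ t, Measurable[𝓕 t] (c t))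
    (hcb : ∀ᵐ ω ∂(P.restrict A), dyadicSup T c ω ≠ ⊤) :
    Negl (P.restrict A) fun n ω => ENNReal.ofReal
      |∑ i ∈ Finset.range (2 ^ n), c (grid T n i) ω * itoRem B X I T n i ω| := by
  obtain ⟨Z, W, f, hS, hE, hf, hclose⟩ := exists_simple_close hB hA hXa hX hI hstep
  set Z' : ℕ → ℝ≥0 → Ω → ℝ := fun n r ω => ∑ i ∈ Finset.range (2 ^ n),
    (Set.Ioc (grid T n i) (grid T n (i + 1))).indicator
      (fun r => c (grid T n i) ω * Z n r ω) r with hZ'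
  set W' : ℕ → ℝ≥0 → Ω → ℝ := fun n t ω => ∑ i ∈ Finset.range (2 ^ n),
    c (grid T n i) ω * (W n (min (grid T n (i + 1)) t) ω - W n (min (grid T n i) t) ω) with hW'
  have hS' : ∀ n, IsSimple 𝓕 B (Z' n) (W' n) := fun n =>
    IsSimple.sum _ fun i _ => (hS n).mul_Ioc (grid_mono T n i.le_succ) (hc _)
  have hR := measurable_dyadicSup hc T
  have hE' : Negl (P.restrict A) fun n ω => sqDist T (Z' n) (fun _ _ => 0) ω := by
    refine (hE.random_mul (hR.pow_const 2)
      (hcb.mono fun ω hω => ENNReal.pow_ne_top hω)).mono fun n => ae_of_all _ fun ω => ?_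
    unfold sqDist
    rw [← lintegral_const_mul]
    · refine lintegral_mono fun s => ?_
      simp only [sub_zero]
      set r := s.toNNReal
      by_cases hr : ∃ i ∈ Finset.range (2 ^ n), r ∈ Set.Ioc (grid T n i) (grid T n (i + 1))
      · obtain ⟨i, hi, hri⟩ := hr
        have h1 : Z' n r ω = c (grid T n i) ω * Z n r ω := by
          simp only [hZ']
          rw [Finset.sum_eq_single_of_mem i hi]
          · rw [Set.indicator_of_mem hri]
          · intro j _ hji
            rw [Set.indicator_of_notMem]
            intro hrj
            rcases lt_or_gt_of_ne hji with h | h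
            · exact absurd (hri.1.trans_le hrj.2) (not_lt.2 (grid_mono T n h))
            · exact absurd (hrj.1.trans_le hri.2) (not_lt.2 (grid_mono T n h))
        rw [h1, mul_pow, ENNReal.ofReal_mul (sq_nonneg _), ← sq_abs (c _ ω),
          ENNReal.ofReal_pow (abs_nonneg _)]
        gcongr
        exact le_dyadicSup (Finset.mem_range.1 hi).le ω
      · have h1 : Z' n r ω = 0 := by
          refine Finset.sum_eq_zero fun i hi => ?_
          rw [Set.indicator_of_notMem fun h => hr ⟨i, hi, h⟩]
        rw [h1]
        simp
    · exact ENNReal.measurable_ofReal.comp (((((hS n).measurable_path ω).comp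
        measurable_real_toNNReal).sub measurable_const).pow_const 2)
  have h1 := Negl.iSup_simple hB Measure.restrict_le_self hS' hE' (fun _ _ => T)
    (fun _ _ => le_rfl)
  refine (h1.add ((hf.random_mul hR hcb).const_mul (c := 2) (by norm_num))).mono fun n =>
    ae_of_all _ fun ω => ?_
  simp only [ciSup_const]
  have h2 : W' n T ω = ∑ i ∈ Finset.range (2 ^ n),
      c (grid T n i) ω * (W n (grid T n (i + 1)) ω - W n (grid T n i) ω) := by
    refine Finset.sum_congr rfl fun i hi => ?_
    have hi := Finset.mem_range.1 hi
    rw [min_eq_left (grid_le hi), min_eq_left (grid_le hi.le)]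
  have h3 : |∑ i ∈ Finset.range (2 ^ n), c (grid T n i) ω * itoRem B X I T n i ω| ≤
      |W' n T ω| + ∑ i ∈ Finset.range (2 ^ n), |c (grid T n i) ω| * |itoRem B X I T n i ω -
        (W n (grid T n (i + 1)) ω - W n (grid T n i) ω)| := by
    have h4 : ∑ i ∈ Finset.range (2 ^ n), c (grid T n i) ω * itoRem B X I T n i ω =
        W' n T ω + ∑ i ∈ Finset.range (2 ^ n), c (grid T n i) ω * (itoRem B X I T n i ω -
        (W n (grid T n (i + 1)) ω - W n (grid T n i) ω)) := by
      rw [h2, ← Finset.sum_add_distrib]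
      exact Finset.sum_congr rfl fun i _ => by ring
    rw [h4]
    refine (abs_add_le _ _).trans ?_
    gcongr
    refine (Finset.abs_sum_le_sum_abs _ _).trans (le_of_eq ?_)
    exact Finset.sum_congr rfl fun i _ => abs_mul _ _
  refine (ENNReal.ofReal_le_ofReal h3).trans ?_
  rw [ENNReal.ofReal_add (abs_nonneg _)
    (Finset.sum_nonneg fun i _ => mul_nonneg (abs_nonneg _) (abs_nonneg _)),
    ENNReal.ofReal_sum_of_nonneg fun i _ => mul_nonneg (abs_nonneg _) (abs_nonneg _)]
  gcongr
  calc ∑ i ∈ Finset.range (2 ^ n), ENNReal.ofReal (|c (grid T n i) ω| * |itoRem B X I T n i ω -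
        (W n (grid T n (i + 1)) ω - W n (grid T n i) ω)|)
      ≤ ∑ i ∈ Finset.range (2 ^ n), dyadicSup T c ω * (2 * f n ω) := by
        refine Finset.sum_le_sum fun i hi => ?_
        rw [ENNReal.ofReal_mul (abs_nonneg _)]
        exact mul_le_mul' (le_dyadicSup (Finset.mem_range.1 hi).le ω)
          (hclose n i (Finset.mem_range.1 hi) ω)
    _ = 2 * (dyadicSup T c ω * (ENNReal.ofReal (2 ^ n) * f n ω)) := by
        rw [Finset.sum_const, Finset.card_range, nsmul_eq_mul, ENNReal.ofReal_pow (by norm_num)]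
        push_cast
        rw [ENNReal.ofReal_ofNat]
        ring

end Ito


/-! ### Quadratic variation of Brownian motion and dyadic discretization of integrands -/

section QuadraticVariation

variable {Ω : Type*} {m : MeasurableSpace Ω} {P : Measure Ω} {𝓕 : Filtration ℝ≥0 m}
  {B : ℝ≥0 → Ω → ℝ} [IsProbabilityMeasure P] {A : Set Ω} {T : ℝ≥0}

theorem Negl.of_tendsto {μ : Measure Ω} [IsFiniteMeasure μ] {c : ℕ → ℝ≥0∞}
    (h : Tendsto c atTop (𝓝 0)) : Negl μ fun n _ => c n :=
  Negl.of_tendsto_ae (fun _ => measurable_const) (ae_of_all _ fun _ => h)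

theorem tendsto_ofReal_div_two_pow (c : ℝ) :
    Tendsto (fun n : ℕ => ENNReal.ofReal (c / 2 ^ n)) atTop (𝓝 0) := by
  have h : Tendsto (fun n : ℕ => c * (1 / 2 : ℝ) ^ n) atTop (𝓝 (c * 0)) :=
    (tendsto_pow_atTop_nhds_zero_of_lt_one (by norm_num) (by norm_num)).const_mul c
  rw [mul_zero] at h
  have h2 := ENNReal.tendsto_ofReal h
  rw [ENNReal.ofReal_zero] at h2
  refine h2.congr fun n => ?_
  rw [one_div, inv_pow, div_eq_mul_inv]

/-- Weighted quadratic variation of Brownian motion. -/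
theorem negl_sum_mul_sq_sub (hB : IsFilteredBrownian P 𝓕 B)
    {ζ : ℝ≥0 → Ω → ℝ} (hζ : ∀ t, Measurable[𝓕 t] (ζ t))
    (hζb : ∀ᵐ ω ∂(P.restrict A), dyadicSup T ζ ω ≠ ⊤) :
    Negl (P.restrict A) fun n ω => ENNReal.ofReal |∑ i ∈ Finset.range (2 ^ n),
      ζ (grid T n i) ω * ((B (grid T n (i + 1)) ω - B (grid T n i) ω) ^ 2 -
        ((grid T n (i + 1) : ℝ) - grid T n i))| := by
  choose v hI hv using fun n => hB.isInnovation_sq (grid_mono T n)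
  have hG : 0 ≤ gaussFourth := integral_nonneg fun z => by positivity
  -- There are `2 ^ n` variances, each at most `gaussFourth * (T / 2 ^ n)²`, so the energy is of
  -- order `2^{-n}`.
  have hE : Negl (P.restrict A) fun n ω => ENNReal.ofReal
      (∑ i ∈ Finset.range (2 ^ n), ζ (grid T n i) ω ^ 2 * v n i) := by
    have h1 := (Negl.of_tendsto (μ := P.restrict A) (tendsto_ofReal_div_two_pow
      (gaussFourth * (T : ℝ) ^ 2))).random_mul ((measurable_dyadicSup hζ T).pow_const 2)
      (hζb.mono fun ω hω => ENNReal.pow_ne_top hω)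
    refine h1.mono fun n => ?_
    filter_upwards [hζb] with ω hω
    set R := (dyadicSup T ζ ω).toReal
    have hR : dyadicSup T ζ ω = ENNReal.ofReal R := (ENNReal.ofReal_toReal hω).symm
    have hR0 : 0 ≤ R := ENNReal.toReal_nonneg
    rw [hR, ← ENNReal.ofReal_pow hR0, ← ENNReal.ofReal_mul (by positivity)]
    refine ENNReal.ofReal_le_ofReal ?_
    have h2 : ∀ i ∈ Finset.range (2 ^ n), ζ (grid T n i) ω ^ 2 * v n i ≤
        R ^ 2 * (gaussFourth * ((T : ℝ) / 2 ^ n) ^ 2) := by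
      intro i hi
      have h3 := le_dyadicSup (c := ζ) (T := T) (Finset.mem_range.1 hi).le ω
      rw [hR, ENNReal.ofReal_le_ofReal_iff hR0] at h3
      have h4 := hv n i
      have h5 : ((grid T n (i + 1) : ℝ) - grid T n i) = (T : ℝ) / 2 ^ n := by
        rw [grid_succ]; push_cast; ring
      rw [h5] at h4
      have h6 : ζ (grid T n i) ω ^ 2 ≤ R ^ 2 := by
        rw [← sq_abs]; gcongr
      exact mul_le_mul h6 h4 ((hI n).var_nonneg i) (by positivity)
    refine (Finset.sum_le_sum h2).trans (le_of_eq ?_)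
    rw [Finset.sum_const, Finset.card_range, nsmul_eq_mul]
    push_cast
    field_simp
  refine Negl.of_le fun ε hε η hη => ?_
  obtain ⟨δ, hδ, hδη⟩ : ∃ δ : ℝ, 0 < δ ∧ ENNReal.ofReal (δ / ε ^ 2) ≤ η / 2 := by
    rcases eq_or_ne η ⊤ with rfl | hηt
    · exact ⟨1, one_pos, by simp [ENNReal.top_div]⟩
    · have h2 : 0 < (η / 2).toReal := ENNReal.toReal_pos (ENNReal.half_pos hη.ne').ne'
        (ENNReal.div_ne_top hηt two_ne_zero)
      refine ⟨(η / 2).toReal * ε ^ 2, by positivity, ?_⟩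
      rw [mul_div_cancel_right₀ _ (by positivity), ENNReal.ofReal_toReal
        (ENNReal.div_ne_top hηt two_ne_zero)]
  filter_upwards [hE.eventually_le hδ (ENNReal.half_pos hη.ne')] with n hn
  have h1 := (hI n).measure_max_le (μ := P.restrict A) Measure.restrict_le_self
    (ξ := fun i => ζ (grid T n i)) (fun j => hζ _) hδ.le hε (2 ^ n)
  refine (measure_mono ?_).trans (h1.trans ((add_le_add ((measure_mono ?_).trans hn)
    hδη).trans_eq (ENNReal.add_halves η)))
  · intro ω hω
    simp only [Set.mem_ofPred_eq] at hω
    exact ⟨2 ^ n, le_rfl, (ENNReal.ofReal_le_ofReal_iff (abs_nonneg _)).1 hω⟩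
  · intro ω hω
    simp only [Set.mem_ofPred_eq] at hω
    exact ENNReal.ofReal_le_ofReal hω.le

/-- The cells of `stepProc` are open on the left and those of `dfloor` closed on the left; they
disagree only at grid points, a null set of times. -/
theorem stepProc_eq_dfloor (hT : 0 < T) {n : ℕ} {X : ℝ≥0 → Ω → ℝ} {r : ℝ≥0} (hr : r < T)
    (hg : ∀ i, r ≠ grid T n i) (ω : Ω) : stepProc T n X r ω = X (dfloor T n r) ω := by
  set i := ⌊r * 2 ^ n / T⌋₊
  have h1 : dfloor T n r = grid T n i := rfl
  have h2 : grid T n i < r := lt_of_le_of_ne (dfloor_le hT n r) (hg i).symm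
  have h3 : r < grid T n (i + 1) := by
    rw [grid_succ]; exact lt_dfloor_add hT n r
  have hi : i < 2 ^ n := by
    by_contra hcon
    have := grid_mono T n (not_lt.1 hcon)
    rw [grid_last] at this
    exact absurd (this.trans_lt h2) (not_lt.2 hr.le)
  rw [h1, stepProc, Finset.sum_eq_single_of_mem i (Finset.mem_range.2 hi)]
  · rw [Set.indicator_of_mem (show r ∈ Set.Ioc _ _ from ⟨h2, h3.le⟩)]
  · intro j _ hji
    rw [Set.indicator_of_notMem]
    intro hrj
    rcases lt_or_gt_of_ne hji with h | h
    · exact absurd (h2.trans_le hrj.2) (not_lt.2 (grid_mono T n h))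
    · exact absurd (hrj.1.trans h3) (not_lt.2 (grid_mono T n h))

/-- Almost every point of `[0, T]` is in `(0, T)` and is not dyadic. -/
theorem ae_nondyadic (T : ℝ≥0) : ∀ᵐ s ∂(volume.restrict (Set.Icc (0 : ℝ) T)),
    s.toNNReal < T ∧ ∀ n i, s.toNNReal ≠ grid T n i := by
  have hc : (insert (T : ℝ) (Set.range fun q : ℕ × ℕ => (grid T q.1 q.2 : ℝ))).Countable :=
    (Set.countable_range _).insert _
  filter_upwards [ae_restrict_mem measurableSet_Icc,
    ae_restrict_of_ae (measure_eq_zero_iff_ae_notMem.1 (hc.measure_zero volume))] with s hs h1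
  simp only [Set.mem_insert_iff, Set.mem_range, Prod.exists, not_or, not_exists] at h1
  refine ⟨(Real.toNNReal_lt_iff_lt_coe hs.1).2 (lt_of_le_of_ne hs.2 h1.1), fun n i h => ?_⟩
  refine h1.2 n i ?_
  rw [← h, Real.coe_toNNReal _ hs.1]

theorem abs_le_dyadicSup_toReal {c : ℝ≥0 → Ω → ℝ} {ω : Ω} (h : dyadicSup T c ω ≠ ⊤) {n i : ℕ}
    (hi : i ≤ 2 ^ n) : |c (grid T n i) ω| ≤ (dyadicSup T c ω).toReal := by
  have h3 := le_dyadicSup (c := c) (T := T) hi ω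
  rwa [← ENNReal.ofReal_toReal h, ENNReal.ofReal_le_ofReal_iff ENNReal.toReal_nonneg] at h3

theorem exists_dfloor_eq_of_le (hT : 0 < T) (n : ℕ) {s : ℝ≥0} (hs : s ≤ T) :
    ∃ i ≤ 2 ^ n, dfloor T n s = grid T n i := by
  refine ⟨_, ?_, rfl⟩
  refine Nat.floor_le_of_le ?_
  rw [div_le_iff₀ hT]
  push_cast
  rw [mul_comm]
  gcongr

/-- Convergence of the dyadic discretizations in `L²([0, T])`. -/
theorem tendsto_sqDist_stepProc (hT : 0 < T) {X : ℝ≥0 → Ω → ℝ} {ω : Ω}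
    (hX : Measurable fun r => X r ω) (hb : dyadicSup T X ω ≠ ⊤)
    (h : ∀ᵐ s ∂(volume.restrict (Set.Icc (0 : ℝ) T)),
      Tendsto (fun n => X (dfloor T n s.toNNReal) ω) atTop (𝓝 (X s.toNNReal ω))) :
    Tendsto (fun n => sqDist T (stepProc T n X) X ω) atTop (𝓝 0) := by
  set R := (dyadicSup T X ω).toReal
  have hR0 : 0 ≤ R := ENNReal.toReal_nonneg
  have hstep : ∀ n, Measurable fun r => stepProc T n X r ω := fun n =>
    Finset.measurable_fun_sum _ fun i _ => measurable_const.indicator measurableSet_Ioc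
  have hlim : ∫⁻ s in Set.Icc (0 : ℝ) T, (0 : ℝ≥0∞) = 0 := by simp
  rw [← hlim]
  unfold sqDist
  refine tendsto_lintegral_of_dominated_convergence (fun _ => ENNReal.ofReal ((2 * R) ^ 2))
    (fun n => ?_) (fun n => ?_) ?_ ?_
  · exact ENNReal.measurable_ofReal.comp ((((hstep n).comp measurable_real_toNNReal).sub
      (hX.comp measurable_real_toNNReal)).pow_const 2)
  · filter_upwards [h, ae_nondyadic T] with s h1 h2
    have hbd : ∀ n, |X (dfloor T n s.toNNReal) ω| ≤ R := by
      intro n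
      obtain ⟨i, hi, hd⟩ := exists_dfloor_eq_of_le hT n h2.1.le
      rw [hd]
      exact abs_le_dyadicSup_toReal hb hi
    have hbl : |X s.toNNReal ω| ≤ R := le_of_tendsto' h1.abs hbd
    rw [stepProc_eq_dfloor hT h2.1 (h2.2 n)]
    refine ENNReal.ofReal_le_ofReal ?_
    rw [← sq_abs]
    refine pow_le_pow_left₀ (abs_nonneg _) ((abs_sub _ _).trans ?_) 2
    linarith [hbd n]
  · rw [lintegral_const]
    exact ENNReal.mul_ne_top ENNReal.ofReal_ne_top (by simp)
  · filter_upwards [h, ae_nondyadic T] with s h1 h2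
    have h3 : Tendsto (fun n => ENNReal.ofReal ((X (dfloor T n s.toNNReal) ω -
        X s.toNNReal ω) ^ 2)) atTop (𝓝 (ENNReal.ofReal 0)) := by
      refine ENNReal.tendsto_ofReal ?_
      have h4 := (h1.sub_const (X s.toNNReal ω)).pow 2
      simpa using h4
    rw [ENNReal.ofReal_zero] at h3
    refine h3.congr fun n => ?_
    rw [stepProc_eq_dfloor hT h2.1 (h2.2 n)]

theorem negl_sqDist_stepProc (hT : 0 < T) {X : ℝ≥0 → Ω → ℝ}
    (hX : Measurable (Function.uncurry X))
    (hb : ∀ᵐ ω ∂(P.restrict A), dyadicSup T X ω ≠ ⊤)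
    (h : ∀ᵐ ω ∂(P.restrict A), ∀ᵐ s ∂(volume.restrict (Set.Icc (0 : ℝ) T)),
      Tendsto (fun n => X (dfloor T n s.toNNReal) ω) atTop (𝓝 (X s.toNNReal ω))) :
    Negl (P.restrict A) fun n ω => sqDist T (stepProc T n X) X ω := by
  refine Negl.of_tendsto_ae (fun n => ?_) ?_
  · have hs : Measurable fun q : Ω × ℝ => stepProc T n X q.2.toNNReal q.1 := by
      unfold stepProc
      refine Finset.measurable_fun_sum _ fun i _ => ?_
      have h1 : Measurable fun q : Ω × ℝ => X (grid T n i) q.1 :=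
        (hX.comp measurable_prodMk_left).comp measurable_fst
      have h2 : (fun q : Ω × ℝ => (Set.Ioc (grid T n i) (grid T n (i + 1))).indicator
          (fun _ => X (grid T n i) q.1) q.2.toNNReal) =
          ((fun q : Ω × ℝ => q.2.toNNReal) ⁻¹' Set.Ioc (grid T n i) (grid T n (i + 1))).indicator
            fun q : Ω × ℝ => X (grid T n i) q.1 := by
        rfl
      rw [h2]
      exact h1.indicator ((measurable_real_toNNReal.comp measurable_snd) measurableSet_Ioc)
    have h2 : Measurable fun q : Ω × ℝ => X q.2.toNNReal q.1 :=
      hX.comp ((measurable_real_toNNReal.comp measurable_snd).prodMk measurable_fst)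
    exact Measurable.lintegral_prod_right' (f := fun q : Ω × ℝ =>
      ENNReal.ofReal ((stepProc T n X q.2.toNNReal q.1 - X q.2.toNNReal q.1) ^ 2))
      (ENNReal.measurable_ofReal.comp ((hs.sub h2).pow_const 2))
  · filter_upwards [hb, h] with ω h1 h2
    exact tendsto_sqDist_stepProc hT (hX.comp measurable_prodMk_right) h1 h2

end QuadraticVariation


/-! ### Riemann–Stieltjes integrals along dyadic grids -/

section Young

variable {f h : ℝ≥0 → ℝ} {T : ℝ≥0}

theorem sum_range_blocks (x : ℕ → ℝ) (M N : ℕ) :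
    ∑ i ∈ Finset.range N, ∑ j ∈ Finset.range M, x (M * i + j) = ∑ k ∈ Finset.range (M * N), x k := by
  induction N with
  | zero => simp
  | succ N ih => rw [Finset.sum_range_succ, ih, mul_add, mul_one, Finset.sum_range_add]

theorem grid_two_pow_mul (T : ℝ≥0) (n m i : ℕ) : grid T (n + m) (2 ^ m * i) = grid T n i := by
  simp only [grid]
  push_cast
  rw [pow_add, show T * (2 ^ m * (i : ℝ≥0)) = (T * i) * 2 ^ m by ring,
    mul_div_mul_right _ _ (by positivity)]

/-- The increment of `h` over a dyadic interval. -/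
def gridInc (h : ℝ≥0 → ℝ) (T : ℝ≥0) (n i : ℕ) : ℝ := h (grid T n (i + 1)) - h (grid T n i)

/-- The left Riemann–Stieltjes sum along a dyadic grid. -/
def gridSum (f h : ℝ≥0 → ℝ) (T : ℝ≥0) (n j : ℕ) : ℝ :=
  ∑ k ∈ Finset.range j, f (grid T n k) * gridInc h T n k

theorem tendsto_gridSum {n i : ℕ} {J : ℝ} (hJ : HasStieltjesIntegral f h (grid T n i) J) :
    Tendsto (fun m => gridSum f h T (n + m) (2 ^ m * i)) atTop (𝓝 J) := by
  rw [Metric.tendsto_atTop]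
  intro ε hε
  obtain ⟨δ, hδ, hJ⟩ := hJ ε hε
  have h1 : ∀ᶠ m in atTop, T / 2 ^ (n + m) < δ :=
    ((tendsto_mesh T).comp (tendsto_add_atTop_nat n)).eventually (gt_mem_nhds hδ) |>.mono
      fun m hm => by simpa [add_comm] using hm
  obtain ⟨m0, hm0⟩ := eventually_atTop.1 h1
  refine ⟨m0, fun m hm => ?_⟩
  rw [Real.dist_eq]
  refine hJ (2 ^ m * i) (grid T (n + m)) (grid T (n + m)) (grid_mono _ _) (grid_zero _ _)
    (grid_two_pow_mul _ _ _ _) fun k _ => ⟨?_, le_rfl, grid_mono _ _ k.le_succ⟩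
  rw [grid_succ]
  gcongr
  exact hm0 m hm

/-- Halving a cell changes its Riemann term by the increment of `f` over the left half times the
increment of `h` over the right half. -/
theorem gridSum_refine (n m i : ℕ) :
    (gridSum f h T (n + (m + 1)) (2 ^ (m + 1) * (i + 1)) -
        gridSum f h T (n + (m + 1)) (2 ^ (m + 1) * i)) -
      (gridSum f h T (n + m) (2 ^ m * (i + 1)) - gridSum f h T (n + m) (2 ^ m * i)) =
    ∑ j ∈ Finset.range (2 ^ m), (f (grid T (n + m + 1) (2 * (2 ^ m * i + j) + 1)) -
      f (grid T (n + m + 1) (2 * (2 ^ m * i + j)))) *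
        gridInc h T (n + m + 1) (2 * (2 ^ m * i + j) + 1) := by
  have key : ∀ l M, gridSum f h T l (M * (i + 1)) - gridSum f h T l (M * i) =
      ∑ j ∈ Finset.range M, f (grid T l (M * i + j)) * gridInc h T l (M * i + j) := by
    intro l M
    unfold gridSum
    rw [mul_add, mul_one, Finset.sum_range_add, add_sub_cancel_left]
  rw [key, key, pow_succ, mul_comm (2 ^ m) 2, ← sum_range_blocks _ 2 (2 ^ m),
    ← Finset.sum_sub_distrib]
  refine Finset.sum_congr rfl fun j _ => ?_
  rw [Finset.sum_range_succ, Finset.sum_range_one]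
  have e1 : 2 * 2 ^ m * i + (2 * j + 0) = 2 * (2 ^ m * i + j) := by ring
  have e2 : 2 * 2 ^ m * i + (2 * j + 1) = 2 * (2 ^ m * i + j) + 1 := by ring
  rw [e1, e2]
  set k := 2 ^ m * i + j
  have e3 : gridInc h T (n + m) k =
      gridInc h T (n + m + 1) (2 * k) + gridInc h T (n + m + 1) (2 * k + 1) := by
    unfold gridInc
    rw [show 2 * k + 1 + 1 = 2 * (k + 1) by ring, grid_double, grid_double]
    ring
  rw [← add_assoc, e3, ← grid_double T (n + m) k]
  ring

/-- Only the Hölder bound on `f` is pointwise. The integrator enters through its total dyadic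
variation at one level, which can be controlled in mean. -/
theorem sum_abs_gridSum_refine {γ M : ℝ≥0} (hf : HolderOnWith M γ f (Set.Icc 0 T)) (n m : ℕ) :
    ∑ i ∈ Finset.range (2 ^ n),
      |(gridSum f h T (n + (m + 1)) (2 ^ (m + 1) * (i + 1)) -
        gridSum f h T (n + (m + 1)) (2 ^ (m + 1) * i)) -
      (gridSum f h T (n + m) (2 ^ m * (i + 1)) - gridSum f h T (n + m) (2 ^ m * i))| ≤
    M * ((T : ℝ) / 2 ^ (n + m + 1)) ^ (γ : ℝ) *
      ∑ k ∈ Finset.range (2 ^ (n + m + 1)), |gridInc h T (n + m + 1) k| := by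
  set l := n + m + 1
  set c := M * ((T : ℝ) / 2 ^ l) ^ (γ : ℝ) with hc
  have hc0 : 0 ≤ c := by positivity
  have hl : 2 * (2 ^ m * 2 ^ n) = 2 ^ l := by simp only [l]; ring
  calc _ ≤ ∑ i ∈ Finset.range (2 ^ n), ∑ j ∈ Finset.range (2 ^ m),
        c * |gridInc h T l (2 * (2 ^ m * i + j) + 1)| := by
        refine Finset.sum_le_sum fun i hi => ?_
        rw [gridSum_refine]
        refine (Finset.abs_sum_le_sum_abs _ _).trans (Finset.sum_le_sum fun j hj => ?_)
        rw [abs_mul]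
        refine mul_le_mul_of_nonneg_right ?_ (abs_nonneg _)
        set k := 2 ^ m * i + j
        have hk : 2 * k + 1 ≤ 2 ^ l := by
          have hi' := Finset.mem_range.1 hi
          have hj' := Finset.mem_range.1 hj
          have h1 : k < 2 ^ m * 2 ^ n := by
            calc k < 2 ^ m * i + 2 ^ m := by simp only [k]; omega
              _ = 2 ^ m * (i + 1) := by ring
              _ ≤ 2 ^ m * 2 ^ n := Nat.mul_le_mul_left _ hi'
          omega
        have h2 := hf.dist_le ⟨zero_le, grid_le hk⟩ ⟨zero_le, grid_le (by omega : 2 * k ≤ 2 ^ l)⟩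
        rw [Real.dist_eq] at h2
        refine h2.trans (le_of_eq ?_)
        rw [hc, NNReal.dist_eq, grid_succ]
        push_cast
        rw [add_sub_cancel_left, abs_of_nonneg (by positivity)]
    _ = c * ∑ k ∈ Finset.range (2 ^ m * 2 ^ n), |gridInc h T l (2 * k + 1)| := by
        rw [← sum_range_blocks (fun k => |gridInc h T l (2 * k + 1)|), Finset.mul_sum]
        exact Finset.sum_congr rfl fun i _ => (Finset.mul_sum _ _ _).symm
    _ ≤ c * ∑ k ∈ Finset.range (2 ^ l), |gridInc h T l k| := by
        refine mul_le_mul_of_nonneg_left ?_ hc0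
        rw [← hl, ← sum_range_blocks _ 2]
        refine Finset.sum_le_sum fun k _ => ?_
        rw [Finset.sum_range_succ, Finset.sum_range_one]
        exact le_add_of_nonneg_left (abs_nonneg _)

/-- The error of the Euler approximation of a Stieltjes integral over a dyadic interval. -/
def youngRem (f h J : ℝ≥0 → ℝ) (T : ℝ≥0) (n i : ℕ) : ℝ :=
  J (grid T n (i + 1)) - J (grid T n i) - f (grid T n i) * gridInc h T n i

/-- The errors of the Euler approximation of a Young integral sum up to zero in the limit. -/
theorem tendsto_sum_abs_youngRem {γ M : ℝ≥0} (hf : HolderOnWith M γ f (Set.Icc 0 T)) {q : ℝ}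
    (hq : q ≤ γ) (hV : Summable fun l : ℕ => ((2 : ℝ) ^ (-q)) ^ l *
      ∑ k ∈ Finset.range (2 ^ l), |gridInc h T l k|) {J : ℝ≥0 → ℝ}
    (hJ : ∀ n i, i ≤ 2 ^ n → HasStieltjesIntegral f h (grid T n i) (J (grid T n i))) :
    Tendsto (fun n => ∑ i ∈ Finset.range (2 ^ n), |youngRem f h J T n i|) atTop (𝓝 0) := by
  -- `A l` bounds the total change of the Riemann sums when passing from level `l - 1` to level `l`.
  set A : ℕ → ℝ := fun l => M * (T : ℝ) ^ (γ : ℝ) * (((2 : ℝ) ^ (-q)) ^ l *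
      ∑ k ∈ Finset.range (2 ^ l), |gridInc h T l k|) with hA
  have hA0 : ∀ l, 0 ≤ A l := fun l =>
    mul_nonneg (by positivity) (mul_nonneg (by positivity)
      (Finset.sum_nonneg fun _ _ => abs_nonneg _))
  have hAs : Summable A := hV.mul_left _
  have hcA : ∀ l, M * ((T : ℝ) / 2 ^ l) ^ (γ : ℝ) *
      ∑ k ∈ Finset.range (2 ^ l), |gridInc h T l k| ≤ A l := by
    intro l
    rw [hA]
    beta_reduce
    rw [← mul_assoc]
    refine mul_le_mul_of_nonneg_right ?_ (Finset.sum_nonneg fun _ _ => abs_nonneg _)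
    rw [mul_assoc]
    refine mul_le_mul_of_nonneg_left ?_ (by positivity)
    rw [Real.div_rpow (by positivity) (by positivity), div_eq_mul_inv]
    refine mul_le_mul_of_nonneg_left ?_ (by positivity)
    rw [← Real.rpow_neg (by positivity), ← Real.rpow_natCast, ← Real.rpow_natCast,
      ← Real.rpow_mul (by norm_num), ← Real.rpow_mul (by norm_num)]
    refine Real.rpow_le_rpow_of_exponent_le (by norm_num) ?_
    have : (0 : ℝ) ≤ l := by positivity
    nlinarith
  set R : ℕ → ℕ → ℕ → ℝ := fun n m i =>
    gridSum f h T (n + m) (2 ^ m * (i + 1)) - gridSum f h T (n + m) (2 ^ m * i) with hR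
  have hR0 : ∀ n i, R n 0 i = f (grid T n i) * gridInc h T n i := by
    intro n i
    simp only [hR, gridSum, pow_zero, one_mul, add_zero, Finset.sum_range_succ]
    ring
  have hfin : ∀ n m, ∑ i ∈ Finset.range (2 ^ n), |R n m i - R n 0 i| ≤
      ∑ j ∈ Finset.range m, A (j + (n + 1)) := by
    intro n m
    induction m with
    | zero => simp
    | succ m ih =>
      rw [Finset.sum_range_succ, add_comm (∑ j ∈ Finset.range m, _)]
      refine le_trans ?_ (add_le_add ((sum_abs_gridSum_refine (h := h) hf n m).trans
        ((hcA (n + m + 1)).trans_eq (congrArg A (by omega)))) ih)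
      rw [← Finset.sum_add_distrib]
      refine Finset.sum_le_sum fun i _ => ?_
      exact abs_sub_le _ (R n m i) _
  -- As the refinement `m` grows, `R n m i` tends to the increment of `J`, so the remainders at
  -- level `n` are bounded by the tail of `∑ A` beyond level `n`.
  have hlim : ∀ n, ∑ i ∈ Finset.range (2 ^ n), |youngRem f h J T n i| ≤
      ∑' j, A (j + (n + 1)) := by
    intro n
    have h1 : Tendsto (fun m => ∑ i ∈ Finset.range (2 ^ n), |R n m i - R n 0 i|) atTop
        (𝓝 (∑ i ∈ Finset.range (2 ^ n), |youngRem f h J T n i|)) := by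
      refine tendsto_finsetSum _ fun i hi => Tendsto.abs ?_
      have hi := Finset.mem_range.1 hi
      rw [youngRem, ← hR0]
      exact ((tendsto_gridSum (hJ n (i + 1) hi)).sub (tendsto_gridSum (hJ n i hi.le))).sub_const _
    refine le_of_tendsto' h1 fun m => (hfin n m).trans ?_
    exact ((summable_nat_add_iff (n + 1)).2 hAs).sum_le_tsum _ fun j _ => hA0 _
  refine tendsto_of_tendsto_of_tendsto_of_le_of_le tendsto_const_nhds
    ((tendsto_sum_nat_add A).comp (tendsto_add_atTop_nat 1))
    (fun n => Finset.sum_nonneg fun _ _ => abs_nonneg _) hlim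

/-- The values of a Young integral at dyadic points approach its value at any other point. -/
theorem tendsto_stieltjes_dfloor (hT : 0 < T) {F : ℝ} (hF : ∀ t ≤ T, |f t| ≤ F)
    (hh : Continuous h) {J : ℝ≥0 → ℝ} {s : ℝ≥0} (hs : s ≤ T)
    (hJ0 : J 0 = 0)
    (hY : Tendsto (fun n => ∑ i ∈ Finset.range (2 ^ n), |youngRem f h J T n i|) atTop (𝓝 0))
    (hJs : HasStieltjesIntegral f h s (J s)) :
    Tendsto (fun n => J (dfloor T n s)) atTop (𝓝 (J s)) := by
  set idx : ℕ → ℕ := fun n => ⌊s * 2 ^ n / T⌋₊ with hidx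
  have hd : ∀ n, dfloor T n s = grid T n (idx n) := fun n => rfl
  have hle : ∀ n, grid T n (idx n) ≤ s := fun n => dfloor_le hT n s
  have hlt : ∀ n, s < grid T n (idx n + 1) := fun n => by
    rw [grid_succ]; exact lt_dfloor_add hT n s
  have hidx2 : ∀ n, idx n ≤ 2 ^ n := by
    intro n
    refine Nat.floor_le_of_le ?_
    rw [div_le_iff₀ hT]
    push_cast
    rw [mul_comm]
    gcongr
  -- The dyadic grid cut off at `s` is an admissible partition of `[0, s]`; its last cell, from
  -- `dfloor T n s` to `s`, is the extra term.
  have h1 : Tendsto (fun n => gridSum f h T n (idx n) +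
      f (dfloor T n s) * (h s - h (dfloor T n s))) atTop (𝓝 (J s)) := by
    rw [Metric.tendsto_atTop]
    intro ε hε
    obtain ⟨δ, hδ, hJ⟩ := hJs ε hε
    obtain ⟨n0, hn0⟩ := eventually_atTop.1 ((tendsto_mesh T).eventually (gt_mem_nhds hδ))
    refine ⟨n0, fun n hn => ?_⟩
    rw [Real.dist_eq]
    have h2 := hJ (idx n + 1) (fun k => min (grid T n k) s) (fun k => min (grid T n k) s)
      (fun i j hij => min_le_min_right _ (grid_mono T n hij)) (by simp [grid_zero])
      (min_eq_right (hlt n).le) fun i hi => ⟨?_, le_rfl, min_le_min_right _ (grid_mono T n i.le_succ)⟩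
    · convert h2 using 3
      rw [Finset.sum_range_succ]
      congr 1
      · refine Finset.sum_congr rfl fun k hk => ?_
        have hk := Finset.mem_range.1 hk
        have e1 := (grid_mono T n hk).trans (hle n)
        have e2 := (grid_mono T n hk.le).trans (hle n)
        rw [min_eq_left e1, min_eq_left e2, gridInc]
      · rw [min_eq_left (hle n), min_eq_right (hlt n).le, hd]
    · have e1 := (grid_mono T n (Nat.le_of_lt_succ hi)).trans (hle n)
      rw [min_eq_left e1]
      refine (min_le_left _ _).trans_lt ?_
      rw [grid_succ]
      gcongr
      exact hn0 n hn
  have h2 : Tendsto (fun n => f (dfloor T n s) * (h s - h (dfloor T n s))) atTop (𝓝 0) := by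
    have h3 : Tendsto (fun n => F * |h s - h (dfloor T n s)|) atTop (𝓝 (F * |h s - h s|)) :=
      ((((hh.tendsto s).comp (tendsto_dfloor hT s)).const_sub (h s)).abs).const_mul F
    rw [sub_self, abs_zero, mul_zero] at h3
    refine squeeze_zero_norm (fun n => ?_) h3
    rw [norm_mul, Real.norm_eq_abs, Real.norm_eq_abs]
    exact mul_le_mul_of_nonneg_right (hF _ ((dfloor_le hT n s).trans hs)) (abs_nonneg _)
  have h3 : Tendsto (fun n => gridSum f h T n (idx n)) atTop (𝓝 (J s)) := by
    have := h1.sub h2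
    simpa using this
  have h4 : Tendsto (fun n => J (dfloor T n s) - gridSum f h T n (idx n)) atTop (𝓝 0) := by
    refine squeeze_zero_norm (fun n => ?_) hY
    rw [Real.norm_eq_abs, hd]
    have h5 : ∀ j, J (grid T n j) - gridSum f h T n j =
        ∑ i ∈ Finset.range j, youngRem f h J T n i := by
      intro j
      have := Finset.sum_range_sub (fun i => J (grid T n i)) j
      simp only [youngRem, gridSum]
      rw [Finset.sum_sub_distrib, this, grid_zero, hJ0, sub_zero]
    rw [h5]
    refine (Finset.abs_sum_le_sum_abs _ _).trans ?_
    exact Finset.sum_le_sum_of_subset_of_nonneg (Finset.range_mono (hidx2 n))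
      fun _ _ _ => abs_nonneg _
  have := h3.add h4
  simpa using this

/-- A Stieltjes integral is bounded on dyadic points. -/
theorem exists_bound_stieltjes {F : ℝ} (hF : ∀ t ≤ T, |f t| ≤ F) (hh : Continuous h)
    {J : ℝ≥0 → ℝ} (hJT : HasStieltjesIntegral f h T (J T))
    (hJ : ∀ n i, i ≤ 2 ^ n → HasStieltjesIntegral f h (grid T n i) (J (grid T n i))) :
    ∃ R, ∀ n i, i ≤ 2 ^ n → |J (grid T n i)| ≤ R := by
  obtain ⟨Hb, hHb⟩ := (isCompact_Icc (a := (0 : ℝ≥0)) (b := T)).exists_bound_of_continuousOn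
    hh.continuousOn
  obtain ⟨δ, hδ, hP⟩ := hJT 1 one_pos
  obtain ⟨n0, hn0⟩ := eventually_atTop.1 ((tendsto_mesh T).eventually (gt_mem_nhds hδ))
  have hmesh : ∀ n ≥ n0, ∀ i, grid T n (i + 1) < grid T n i + δ := fun n hn i => by
    rw [grid_succ]; gcongr; exact hn0 n hn
  have hF0 : 0 ≤ F := (abs_nonneg _).trans (hF 0 zero_le)
  have hHb0 : 0 ≤ Hb := (norm_nonneg _).trans (hHb 0 ⟨le_rfl, zero_le⟩)
  set R := |J T| + 1 + 2 ^ n0 * (F * (Hb + Hb)) with hR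
  have hS : ∀ N ≥ n0, ∀ K ≤ 2 ^ N, |gridSum f h T N K| ≤ R := by
    intro N hN K hK
    set t := grid T N K with ht
    have htT : t ≤ T := grid_le hK
    -- A partition of `[0, T]` that is arbitrarily fine up to `t` but coarse afterwards. Its sum is
    -- within `1` of `J T`, and the coarse part has `2 ^ n0` terms whatever `N` is, which bounds the
    -- fine part uniformly.
    set x : ℕ → ℝ≥0 := fun k => if k ≤ K then grid T N k else max t (grid T n0 (k - K)) with hx
    have hx1 : ∀ k ≤ K, x k = grid T N k := fun k hk => if_pos hk
    have hx2 : ∀ j, x (K + j) = max t (grid T n0 j) := by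
      intro j
      rcases Nat.eq_zero_or_pos j with rfl | hj
      · rw [add_zero, hx1 K le_rfl, grid_zero, max_eq_left zero_le]
      · simp only [hx]
        rw [if_neg (by omega), Nat.add_sub_cancel_left]
    have hstep : ∀ k, x k ≤ x (k + 1) ∧ x (k + 1) < x k + δ := by
      intro k
      rcases lt_or_ge k K with hk | hk
      · rw [hx1 k hk.le, hx1 (k + 1) hk]
        exact ⟨grid_mono T N k.le_succ, hmesh N hN k⟩
      · obtain ⟨j, rfl⟩ := Nat.exists_eq_add_of_le hk
        rw [add_assoc, hx2, hx2]
        refine ⟨max_le_max_left _ (grid_mono T n0 j.le_succ), ?_⟩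
        refine max_lt ?_ ?_
        · exact (le_max_left _ _).trans_lt (lt_add_of_pos_right _ hδ)
        · exact (hmesh n0 le_rfl j).trans_le (by gcongr; exact le_max_right _ _)
    have h1 := hP (K + 2 ^ n0) x x (monotone_nat_of_le_succ fun k => (hstep k).1)
      (by rw [hx1 0 (Nat.zero_le _), grid_zero])
      (by rw [hx2, grid_last, max_eq_right htT])
      fun k _ => ⟨(hstep k).2, le_rfl, (hstep k).1⟩
    rw [Finset.sum_range_add] at h1
    have h2 : ∑ k ∈ Finset.range K, f (x k) * (h (x (k + 1)) - h (x k)) = gridSum f h T N K := by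
      refine Finset.sum_congr rfl fun k hk => ?_
      have hk := Finset.mem_range.1 hk
      rw [hx1 k hk.le, hx1 (k + 1) hk, gridInc]
    rw [h2] at h1
    have h3 : |∑ j ∈ Finset.range (2 ^ n0), f (x (K + j)) * (h (x (K + j + 1)) - h (x (K + j)))| ≤
        2 ^ n0 * (F * (Hb + Hb)) := by
      refine (Finset.abs_sum_le_sum_abs _ _).trans ?_
      refine (Finset.sum_le_sum (g := fun _ => F * (Hb + Hb)) fun j hj => ?_).trans (by simp)
      have hj := Finset.mem_range.1 hj
      have hxT : ∀ j ≤ 2 ^ n0, x (K + j) ≤ T := fun j hj => by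
        rw [hx2]; exact max_le htT (grid_le hj)
      rw [abs_mul]
      refine mul_le_mul (hF _ (hxT j hj.le)) ((abs_sub _ _).trans (add_le_add ?_ ?_))
        (abs_nonneg _) hF0
      · exact hHb _ ⟨zero_le, hxT (j + 1) hj⟩
      · exact hHb _ ⟨zero_le, hxT j hj.le⟩
    rw [hR]
    rw [abs_le] at h3 ⊢
    rw [abs_lt] at h1
    have := abs_le.1 (le_refl |J T|)
    constructor <;> linarith [h1.1, h1.2, h3.1, h3.2, this.1, this.2]
  refine ⟨R, fun n i hi => ?_⟩
  refine le_of_tendsto (tendsto_gridSum (hJ n i hi)).abs ?_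
  filter_upwards [eventually_ge_atTop n0] with m hm
  refine hS _ (by omega) _ ?_
  rw [add_comm, pow_add]
  exact Nat.mul_le_mul_left _ hi

theorem HasStieltjesIntegral.eq_zero {J : ℝ} (hJ : HasStieltjesIntegral f h 0 J) : J = 0 := by
  by_contra hne
  obtain ⟨δ, hδ, h1⟩ := hJ |J| (abs_pos.2 hne)
  have := h1 0 (fun _ => 0) (fun _ => 0) (fun _ _ _ => le_rfl) rfl rfl (by simp)
  simp at this

end Young


/-! ### Dyadic variation of fractional Brownian motion -/

section Fractional

variable {Ω : Type*} {m : MeasurableSpace Ω} {P : Measure Ω} {𝓕 : Filtration ℝ≥0 m}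
  {H : ℝ} {X : ℝ≥0 → Ω → ℝ}

/-- By Tonelli the sum has finite expectation. -/
theorem ae_summable_of_integral_le {Z : ℕ → Ω → ℝ} (hZ0 : ∀ l ω, 0 ≤ Z l ω)
    (hZi : ∀ l, Integrable (Z l) P) {c : ℕ → ℝ} (hZc : ∀ l, ∫ ω, Z l ω ∂P ≤ c l)
    (hc : Summable c) : ∀ᵐ ω ∂P, Summable fun l => Z l ω := by
  have hc0 : ∀ l, 0 ≤ c l := fun l => (integral_nonneg (hZ0 l)).trans (hZc l)
  have h1 : ∫⁻ ω, ∑' l, ENNReal.ofReal (Z l ω) ∂P ≠ ⊤ := by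
    rw [lintegral_tsum fun l => (hZi l).aemeasurable.ennreal_ofReal]
    have h2 : ∀ l, ∫⁻ ω, ENNReal.ofReal (Z l ω) ∂P ≤ ENNReal.ofReal (c l) := fun l => by
      rw [← ofReal_integral_eq_lintegral_ofReal (hZi l) (ae_of_all _ (hZ0 l))]
      exact ENNReal.ofReal_le_ofReal (hZc l)
    refine ne_top_of_le_ne_top ?_ (ENNReal.tsum_le_tsum h2)
    rw [← ENNReal.ofReal_tsum_of_nonneg hc0 hc]
    exact ENNReal.ofReal_ne_top
  filter_upwards [ae_lt_top' (AEMeasurable.tsum fun l => (hZi l).aemeasurable.ennreal_ofReal) h1]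
    with ω hω
  have h3 := ENNReal.summable_toReal hω.ne
  exact h3.congr fun l => (ENNReal.toReal_ofReal (hZ0 l ω))

namespace IsFractionalBrownian

variable [IsProbabilityMeasure P]

theorem memLp_sub (hX : IsFractionalBrownian P 𝓕 H X) (s t : ℝ≥0) :
    MemLp (fun ω => X t ω - X s ω) 2 P :=
  (hX.gaussian.hasGaussianLaw_eval t).memLp_two.sub (hX.gaussian.hasGaussianLaw_eval s).memLp_two

theorem integral_sq_sub (hX : IsFractionalBrownian P 𝓕 H X) (hH : 0 < H) (s t : ℝ≥0) :
    ∫ ω, (X t ω - X s ω) ^ 2 ∂P = |(t : ℝ) - s| ^ (2 * H) := by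
  have hs := (hX.gaussian.hasGaussianLaw_eval s).memLp_two
  have ht := (hX.gaussian.hasGaussianLaw_eval t).memLp_two
  have h0 : ∫ ω, (X t ω - X s ω) ∂P = 0 := by
    rw [integral_sub (ht.integrable one_le_two) (hs.integrable one_le_two), hX.mean, hX.mean,
      sub_zero]
  rw [← variance_of_integral_eq_zero (hX.memLp_sub s t).aestronglyMeasurable.aemeasurable h0,
    ← covariance_self (hX.memLp_sub s t).aestronglyMeasurable.aemeasurable]
  have h1 := covariance_sub_sub ht hs ht hs
  have h2 : (fun ω => X t ω - X s ω) = X t - X s := rfl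
  rw [h2, h1, hX.covariance, hX.covariance, hX.covariance, hX.covariance, sub_self, sub_self,
    abs_zero, Real.zero_rpow (by positivity), abs_sub_comm (s : ℝ) t]
  ring

/-- Nonnegativity of the variance of `|X t - X s|` bounds the first absolute moment by the root of
the second moment. -/
theorem integral_abs_sub_le (hX : IsFractionalBrownian P 𝓕 H X) (hH : 0 < H) (s t : ℝ≥0) :
    ∫ ω, |X t ω - X s ω| ∂P ≤ |(t : ℝ) - s| ^ H := by
  have hm := hX.memLp_sub s t
  have h1 := hX.integral_sq_sub hH s t
  have habs : MemLp (fun ω => |X t ω - X s ω|) 2 P := hm.abs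
  have hv := variance_nonneg (fun ω => |X t ω - X s ω|) P
  rw [variance_eq_sub habs] at hv
  have h2 : ∫ ω, ((fun ω => |X t ω - X s ω|) ^ 2) ω ∂P = |(t : ℝ) - s| ^ (2 * H) := by
    rw [← h1]
    exact integral_congr_ae (ae_of_all _ fun ω => sq_abs _)
  rw [h2, mul_comm 2 H, Real.rpow_mul (abs_nonneg _)] at hv
  rw [show (2 : ℝ) = ((2 : ℕ) : ℝ) by norm_num, Real.rpow_natCast] at hv
  exact (pow_le_pow_iff_left₀ (integral_nonneg fun _ => abs_nonneg _) (by positivity)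
    two_ne_zero).1 (sub_nonneg.1 hv)

/-- The expected variation at level `l` is at most `2^l (T / 2^l)^H`, so the weight `2^{-ql}` leaves
a geometric series of ratio `2^{1-q-H} < 1`. This averaged bound takes the place of Hölder
continuity of the paths. -/
theorem ae_summable_variation (hX : IsFractionalBrownian P 𝓕 H X) (hH : 0 < H) (T : ℝ≥0) {q : ℝ}
    (hq : 1 - H < q) : ∀ᵐ ω ∂P, Summable fun l : ℕ => ((2 : ℝ) ^ (-q)) ^ l *
      ∑ k ∈ Finset.range (2 ^ l), |gridInc (fun t => X t ω) T l k| := by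
  have hi : ∀ l k, Integrable (fun ω => |gridInc (fun t => X t ω) T l k|) P := fun l k =>
    ((hX.memLp_sub _ _).integrable one_le_two).abs
  refine ae_summable_of_integral_le (c := fun l => (T : ℝ) ^ H * ((2 : ℝ) ^ (1 - q - H)) ^ l)
    (fun l ω => mul_nonneg (by positivity) (Finset.sum_nonneg fun _ _ => abs_nonneg _))
    (fun l => (integrable_finsetSum _ fun k _ => hi l k).const_mul _) (fun l => ?_) ?_
  · rw [integral_const_mul, integral_finsetSum _ fun k _ => hi l k]
    have h1 : ∀ k ∈ Finset.range (2 ^ l), ∫ ω, |gridInc (fun t => X t ω) T l k| ∂P ≤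
        ((T : ℝ) / 2 ^ l) ^ H := by
      intro k _
      refine (hX.integral_abs_sub_le hH _ _).trans (le_of_eq ?_)
      rw [grid_succ]
      push_cast
      rw [add_sub_cancel_left, abs_of_nonneg (by positivity)]
    refine (mul_le_mul_of_nonneg_left (Finset.sum_le_sum h1) (by positivity)).trans (le_of_eq ?_)
    rw [Finset.sum_const, Finset.card_range, nsmul_eq_mul,
      Real.div_rpow (by positivity) (by positivity)]
    push_cast
    have h2 : ((2 : ℝ) ^ (1 - q - H)) ^ l = ((2 : ℝ) ^ (-q)) ^ l * 2 ^ l / ((2 : ℝ) ^ l) ^ H := by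
      rw [← Real.rpow_natCast, ← Real.rpow_natCast, ← Real.rpow_natCast,
        ← Real.rpow_mul (by norm_num), ← Real.rpow_mul (by norm_num),
        ← Real.rpow_mul (by norm_num), ← Real.rpow_add (by norm_num),
        ← Real.rpow_sub (by norm_num)]
      congr 1
      ring
    rw [h2]
    ring
  · refine (summable_geometric_of_lt_one (by positivity) ?_).mul_left _
    exact Real.rpow_lt_one_of_one_lt_of_neg (by norm_num) (by linarith)

/-- The expected sums are of order `2^{l(1-2H)}`, summable exactly because `H > 1/2`. -/
theorem ae_tendsto_sum_sq (hX : IsFractionalBrownian P 𝓕 H X) (hH : 1 / 2 < H) (T : ℝ≥0) :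
    ∀ᵐ ω ∂P, Tendsto (fun l : ℕ => ∑ k ∈ Finset.range (2 ^ l),
      gridInc (fun t => X t ω) T l k ^ 2) atTop (𝓝 0) := by
  have hi : ∀ l k, Integrable (fun ω => gridInc (fun t => X t ω) T l k ^ 2) P := fun l k =>
    (hX.memLp_sub _ _).integrable_sq
  have h0 : ∀ᵐ ω ∂P, Summable fun l : ℕ => ∑ k ∈ Finset.range (2 ^ l),
      gridInc (fun t => X t ω) T l k ^ 2 := by
    refine ae_summable_of_integral_le
      (c := fun l => (T : ℝ) ^ (2 * H) * ((2 : ℝ) ^ (1 - 2 * H)) ^ l)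
      (fun l ω => Finset.sum_nonneg fun _ _ => sq_nonneg _)
      (fun l => integrable_finsetSum _ fun k _ => hi l k) (fun l => ?_) ?_
    · rw [integral_finsetSum _ fun k _ => hi l k]
      have h1 : ∀ k ∈ Finset.range (2 ^ l), ∫ ω, gridInc (fun t => X t ω) T l k ^ 2 ∂P =
          ((T : ℝ) / 2 ^ l) ^ (2 * H) := by
        intro k _
        refine (hX.integral_sq_sub (by linarith) _ _).trans ?_
        rw [grid_succ]
        push_cast
        rw [add_sub_cancel_left, abs_of_nonneg (by positivity)]
      rw [Finset.sum_congr rfl h1]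
      rw [Finset.sum_const, Finset.card_range, nsmul_eq_mul,
        Real.div_rpow (by positivity) (by positivity)]
      push_cast
      have h2 : ((2 : ℝ) ^ (1 - 2 * H)) ^ l = 2 ^ l / ((2 : ℝ) ^ l) ^ (2 * H) := by
        rw [← Real.rpow_natCast, ← Real.rpow_natCast,
          ← Real.rpow_mul (by norm_num), ← Real.rpow_mul (by norm_num),
          ← Real.rpow_sub (by norm_num)]
        congr 1
        ring
      rw [h2]
      exact le_of_eq (by ring)
    · refine (summable_geometric_of_lt_one (by positivity) ?_).mul_left _
      exact Real.rpow_lt_one_of_one_lt_of_neg (by norm_num) (by linarith)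
  filter_upwards [h0] with ω hω using hω.tendsto_atTop_zero

/-- Almost every path admits Young integration against all Hölder functions of order larger than
`1 - H`. -/
theorem ae_forall_tendsto_youngRem (hX : IsFractionalBrownian P 𝓕 H X) (hH : 0 < H) (T : ℝ≥0) :
    ∀ᵐ ω ∂P, ∀ (f J : ℝ≥0 → ℝ) (γ M : ℝ≥0), 1 - H < γ → HolderOnWith M γ f (Set.Icc 0 T) →
      (∀ n i, i ≤ 2 ^ n →
        HasStieltjesIntegral f (fun t => X t ω) (grid T n i) (J (grid T n i))) →
      Tendsto (fun n => ∑ i ∈ Finset.range (2 ^ n), |youngRem f (fun t => X t ω) J T n i|)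
        atTop (𝓝 0) := by
  -- Countably many exponents decreasing to `1 - H` give one null set valid for all `f` and `γ`;
  -- this matters since the integrands and their Hölder orders depend on the path.
  have h1 : ∀ᵐ ω ∂P, ∀ r : ℕ, Summable fun l : ℕ =>
      ((2 : ℝ) ^ (-(1 - H + 1 / ((r : ℝ) + 1)))) ^ l *
        ∑ k ∈ Finset.range (2 ^ l), |gridInc (fun t => X t ω) T l k| :=
    ae_all_iff.2 fun r => hX.ae_summable_variation hH T
      (lt_add_of_pos_right _ Nat.one_div_pos_of_nat)
  filter_upwards [h1] with ω hω f J γ M hγ hf hJ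
  obtain ⟨r, hr⟩ := exists_nat_one_div_lt (sub_pos.2 hγ)
  exact tendsto_sum_abs_youngRem hf (by linarith) (hω r) hJ

end IsFractionalBrownian

end Fractional


/-! ### Limits of sums along dyadic grids -/

section PathwiseLimits

variable {l : Filter ℕ} {T : ℝ≥0}

/-- Cauchy–Schwarz: bounded quadratic sums times vanishing quadratic sums. -/
theorem tendsto_sum_of_abs_le_mul {z u v : ℕ → ℕ → ℝ} {R K : ℝ} (hR : 0 ≤ R)
    (hz : ∀ᶠ n in l, ∀ i < 2 ^ n, |z n i| ≤ R * (|u n i| * |v n i|))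
    (hu : ∀ᶠ n in l, ∑ i ∈ Finset.range (2 ^ n), u n i ^ 2 ≤ K)
    (hv : Tendsto (fun n => ∑ i ∈ Finset.range (2 ^ n), v n i ^ 2) l (𝓝 0)) :
    Tendsto (fun n => ∑ i ∈ Finset.range (2 ^ n), z n i) l (𝓝 0) := by
  have h1 : Tendsto (fun n => R * (Real.sqrt K *
      Real.sqrt (∑ i ∈ Finset.range (2 ^ n), v n i ^ 2))) l
      (𝓝 (R * (Real.sqrt K * Real.sqrt 0))) :=
    ((Real.continuous_sqrt.tendsto 0).comp hv |>.const_mul _).const_mul _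
  rw [Real.sqrt_zero, mul_zero, mul_zero] at h1
  refine squeeze_zero_norm' ?_ h1
  filter_upwards [hz, hu] with n hzn hun
  rw [Real.norm_eq_abs]
  refine (Finset.abs_sum_le_sum_abs _ _).trans ((Finset.sum_le_sum fun i hi =>
    hzn i (Finset.mem_range.1 hi)).trans ?_)
  rw [← Finset.mul_sum]
  refine mul_le_mul_of_nonneg_left ?_ hR
  refine (Real.sum_mul_le_sqrt_mul_sqrt _ _ _).trans ?_
  simp only [sq_abs]
  gcongr

theorem tendsto_sum_of_forall_abs_le {z v : ℕ → ℕ → ℝ} {K : ℝ}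
    (hz : ∀ ε > 0, ∀ᶠ n in l, ∀ i < 2 ^ n, |z n i| ≤ ε * v n i)
    (hv : ∀ᶠ n in l, ∑ i ∈ Finset.range (2 ^ n), v n i ≤ K) :
    Tendsto (fun n => ∑ i ∈ Finset.range (2 ^ n), z n i) l (𝓝 0) := by
  rw [Metric.tendsto_nhds]
  intro ε hε
  have hK : 0 < |K| + 1 := by positivity
  filter_upwards [hz (ε / (|K| + 1)) (by positivity), hv] with n h1 h2
  rw [Real.dist_eq, sub_zero]
  calc |∑ i ∈ Finset.range (2 ^ n), z n i| ≤ ∑ i ∈ Finset.range (2 ^ n), ε / (|K| + 1) * v n i :=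
        (Finset.abs_sum_le_sum_abs _ _).trans
          (Finset.sum_le_sum fun i hi => h1 i (Finset.mem_range.1 hi))
    _ = ε / (|K| + 1) * ∑ i ∈ Finset.range (2 ^ n), v n i := (Finset.mul_sum _ _ _).symm
    _ ≤ ε / (|K| + 1) * K := by gcongr
    _ < ε / (|K| + 1) * (|K| + 1) := by
        gcongr
        linarith [le_abs_self K]
    _ = ε := div_mul_cancel₀ _ hK.ne'

theorem tendsto_sum_of_abs_le {z v : ℕ → ℕ → ℝ} {R : ℝ}
    (hz : ∀ n, ∀ i < 2 ^ n, |z n i| ≤ R * |v n i|)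
    (hv : Tendsto (fun n => ∑ i ∈ Finset.range (2 ^ n), |v n i|) l (𝓝 0)) :
    Tendsto (fun n => ∑ i ∈ Finset.range (2 ^ n), z n i) l (𝓝 0) := by
  have h1 := hv.const_mul R
  rw [mul_zero] at h1
  refine squeeze_zero_norm (fun n => ?_) h1
  rw [Real.norm_eq_abs, Finset.mul_sum]
  exact (Finset.abs_sum_le_sum_abs _ _).trans
    (Finset.sum_le_sum fun i hi => hz n i (Finset.mem_range.1 hi))

theorem sum_gridInc (f : ℝ≥0 → ℝ) (T : ℝ≥0) (n j : ℕ) :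
    ∑ i ∈ Finset.range j, gridInc f T n i = f (grid T n j) - f 0 := by
  unfold gridInc
  rw [Finset.sum_range_sub fun i => f (grid T n i), grid_zero]

/-- Oscillation of a continuous function over dyadic intervals. -/
theorem eventually_abs_sub_lt {f : ℝ≥0 → ℝ} (hf : Continuous f) (T : ℝ≥0) {ε : ℝ} (hε : 0 < ε) :
    ∀ᶠ n in atTop, ∀ i < 2 ^ n, ∀ s ∈ Set.Icc (grid T n i) (grid T n (i + 1)),
      |f (grid T n (i + 1)) - f s| < ε := by
  have hu : UniformContinuousOn f (Set.Icc 0 T) :=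
    isCompact_Icc.uniformContinuousOn_of_continuous hf.continuousOn
  obtain ⟨δ, hδ, hd⟩ := Metric.uniformContinuousOn_iff.1 hu ε hε
  have h1 : Tendsto (fun n : ℕ => ((T / 2 ^ n : ℝ≥0) : ℝ)) atTop (𝓝 ((0 : ℝ≥0) : ℝ)) :=
    (NNReal.continuous_coe.tendsto 0).comp (tendsto_mesh T)
  filter_upwards [h1.eventually (gt_mem_nhds (by simpa using hδ))] with n hn i hi s hs
  refine hd _ ⟨zero_le, grid_le hi⟩ _ ⟨zero_le, hs.2.trans (grid_le hi)⟩ ?_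
  have h2 : (s : ℝ) ≤ grid T n (i + 1) := by exact_mod_cast hs.2
  have h3 : (grid T n i : ℝ) ≤ s := by exact_mod_cast hs.1
  have h4 : (grid T n (i + 1) : ℝ) = grid T n i + (T / 2 ^ n : ℝ≥0) := by
    rw [grid_succ]; push_cast; rfl
  rw [NNReal.dist_eq, abs_of_nonneg (by linarith)]
  linarith

theorem intervalIntegrable_grid {F : ℝ → ℝ} (hF : IntervalIntegrable F volume 0 T) {n i : ℕ}
    (hi : i < 2 ^ n) : IntervalIntegrable F volume (grid T n i) (grid T n (i + 1)) := by
  refine hF.mono_set ?_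
  have h1 : (grid T n i : ℝ) ≤ grid T n (i + 1) := by exact_mod_cast grid_mono T n i.le_succ
  rw [Set.uIcc_of_le h1, Set.uIcc_of_le T.coe_nonneg]
  exact Set.Icc_subset_Icc (NNReal.coe_nonneg _) (by exact_mod_cast grid_le hi)

theorem sum_integral_grid {F : ℝ → ℝ} (hF : IntervalIntegrable F volume 0 T) (n : ℕ) :
    ∑ i ∈ Finset.range (2 ^ n), ∫ s in (grid T n i : ℝ)..grid T n (i + 1), F s =
      ∫ s in (0 : ℝ)..T, F s := by
  have h := intervalIntegral.sum_integral_adjacent_intervals (f := F) (μ := volume)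
    (a := fun i => (grid T n i : ℝ)) (n := 2 ^ n) fun i hi => intervalIntegrable_grid hF hi
  rw [h, grid_zero, grid_last, NNReal.coe_zero]

/-- The weight sits at the right endpoint because the increment of a product is split as `c_{i+1} Δy
+ y_i Δc`; uniform continuity of `c` makes this harmless. -/
theorem tendsto_sum_mul_integral {c : ℝ≥0 → ℝ} (hc : Continuous c) {F : ℝ → ℝ}
    (hF : IntervalIntegrable F volume 0 T) :
    Tendsto (fun n => ∑ i ∈ Finset.range (2 ^ n),
      c (grid T n (i + 1)) * ∫ s in (grid T n i : ℝ)..grid T n (i + 1), F s) atTop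
      (𝓝 (∫ s in (0 : ℝ)..T, c s.toNNReal * F s)) := by
  have hc' : Continuous fun s : ℝ => c s.toNNReal := hc.comp continuous_real_toNNReal
  have hcF : IntervalIntegrable (fun s => c s.toNNReal * F s) volume 0 T :=
    hF.continuousOn_mul hc'.continuousOn
  have h1 : Tendsto (fun n => ∑ i ∈ Finset.range (2 ^ n),
      (c (grid T n (i + 1)) * (∫ s in (grid T n i : ℝ)..grid T n (i + 1), F s) -
        ∫ s in (grid T n i : ℝ)..grid T n (i + 1), c s.toNNReal * F s)) atTop (𝓝 0) := by
    refine tendsto_sum_of_forall_abs_le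
      (v := fun n i => ∫ s in (grid T n i : ℝ)..grid T n (i + 1), |F s|) (fun ε hε => ?_)
      (Eventually.of_forall fun n => (sum_integral_grid hF.abs n).le)
    filter_upwards [eventually_abs_sub_lt hc T hε] with n hn i hi
    have hle : (grid T n i : ℝ) ≤ grid T n (i + 1) := by exact_mod_cast grid_mono T n i.le_succ
    rw [← intervalIntegral.integral_const_mul, ← intervalIntegral.integral_sub
      ((intervalIntegrable_grid hF hi).const_mul _) (intervalIntegrable_grid hcF hi),
      ← intervalIntegral.integral_const_mul, ← Real.norm_eq_abs]
    refine intervalIntegral.norm_integral_le_of_norm_le hle (ae_of_all _ fun s hs => ?_)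
      ((intervalIntegrable_grid hF hi).abs.const_mul _)
    rw [← sub_mul, norm_mul, Real.norm_eq_abs, Real.norm_eq_abs]
    refine mul_le_mul_of_nonneg_right (hn i hi _ ⟨?_, ?_⟩).le (abs_nonneg _)
    · exact NNReal.le_toNNReal_of_coe_le hs.1.le
    · exact Real.toNNReal_le_iff_le_coe.2 hs.2
  have h2 := h1.add_const (∫ s in (0 : ℝ)..T, c s.toNNReal * F s)
  rw [zero_add] at h2
  refine h2.congr fun n => ?_
  rw [Finset.sum_sub_distrib, sum_integral_grid hcF, sub_add_cancel]

/-- Riemann sums along dyadic grids. -/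
theorem tendsto_sum_mul_mesh (hT : 0 < T) {x : ℝ≥0 → ℝ} {R : ℝ}
    (hR : ∀ n i, i ≤ 2 ^ n → |x (grid T n i)| ≤ R)
    (h : ∀ᵐ s ∂(volume.restrict (Set.Icc (0 : ℝ) T)),
      Tendsto (fun n => x (dfloor T n s.toNNReal)) atTop (𝓝 (x s.toNNReal))) :
    Tendsto (fun n => ∑ i ∈ Finset.range (2 ^ n),
      x (grid T n i) * ((grid T n (i + 1) : ℝ) - grid T n i)) atTop
      (𝓝 (∫ s in (0 : ℝ)..T, x s.toNNReal)) := by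
  have hmeas : ∀ n, Measurable fun s : ℝ => x (dfloor T n s.toNNReal) := by
    intro n
    have h1 : Measurable fun s : ℝ≥0 => ⌊s * 2 ^ n / T⌋₊ :=
      Nat.measurable_floor.comp ((measurable_id.mul_const _).div_const _)
    exact ((measurable_from_nat (f := fun i => x (grid T n i))).comp h1).comp
      measurable_real_toNNReal
  have hbd : ∀ n, ∀ᵐ s ∂(volume.restrict (Set.Icc (0 : ℝ) T)),
      ‖x (dfloor T n s.toNNReal)‖ ≤ R := by
    intro n
    filter_upwards [ae_nondyadic T] with s hs
    obtain ⟨i, hi, hd⟩ := exists_dfloor_eq_of_le hT n hs.1.le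
    rw [hd]
    exact hR n i hi
  have hlim := tendsto_integral_of_dominated_convergence (fun _ => R)
    (fun n => (hmeas n).aestronglyMeasurable) (integrable_const R) hbd h
  have hconv : ∀ f : ℝ → ℝ, ∫ s in (0 : ℝ)..T, f s = ∫ s in Set.Icc (0 : ℝ) T, f s := fun f => by
    rw [intervalIntegral.integral_of_le T.coe_nonneg, integral_Icc_eq_integral_Ioc]
  rw [hconv]
  refine hlim.congr fun n => ?_
  have hint : IntervalIntegrable (fun s : ℝ => x (dfloor T n s.toNNReal)) volume 0 T := by
    rw [intervalIntegrable_iff_integrableOn_Icc_of_le T.coe_nonneg]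
    exact Integrable.of_bound (hmeas n).aestronglyMeasurable R (hbd n)
  rw [← hconv, ← sum_integral_grid hint n]
  refine Finset.sum_congr rfl fun i hi => ?_
  have hle : (grid T n i : ℝ) ≤ grid T n (i + 1) := by exact_mod_cast grid_mono T n i.le_succ
  have h1 : ∫ s in (grid T n i : ℝ)..grid T n (i + 1), x (dfloor T n s.toNNReal) =
      ∫ s in (grid T n i : ℝ)..grid T n (i + 1), x (grid T n i) := by
    rw [intervalIntegral.integral_of_le hle, intervalIntegral.integral_of_le hle,
      integral_Ioc_eq_integral_Ioo, integral_Ioc_eq_integral_Ioo]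
    refine setIntegral_congr_fun measurableSet_Ioo fun s hs => ?_
    rw [dfloor_eq_grid hT (NNReal.le_toNNReal_of_coe_le hs.1.le)
      ((Real.toNNReal_lt_iff_lt_coe ((NNReal.coe_nonneg _).trans hs.1.le)).2 hs.2)]
  rw [h1, intervalIntegral.integral_const, smul_eq_mul, mul_comm]

/-- With `x = ΔN`, the factor `(1 + x) e^{-x}` combines the linear growth of `y` with the decay of
`e^{-N}`. Its second-order term is the Itô correction, and the cubic error vanishes when summed. -/
theorem abs_one_sub_one_add_mul_exp_le {x : ℝ} (hx : |x| ≤ 1) :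
    |1 - (1 + x) * Real.exp (-x) - x ^ 2 / 2| ≤ |x| * x ^ 2 := by
  have h := Real.exp_bound (x := -x) (by rwa [abs_neg]) (n := 3) (by norm_num)
  simp only [Finset.sum_range_succ, Finset.sum_range_zero, Nat.factorial] at h
  norm_num at h
  set e := Real.exp (-x)
  have h1 : 1 - (1 + x) * e - x ^ 2 / 2 = -((1 + x) * (e - (1 + -x + x ^ 2 / 2))) - x ^ 3 / 2 := by
    ring
  rw [h1]
  have h2 : |(1 + x) * (e - (1 + -x + x ^ 2 / 2))| ≤ 2 * (|x| ^ 3 * (2 / 9)) := by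
    rw [abs_mul]
    refine mul_le_mul ?_ h (abs_nonneg _) (by norm_num)
    refine (abs_add_le _ _).trans ?_
    rw [abs_one]
    linarith
  have h3 : |x ^ 3 / 2| = |x| ^ 3 / 2 := by rw [abs_div, abs_pow]; norm_num
  have h4 : |x| * x ^ 2 = |x| ^ 3 := by rw [← sq_abs]; ring
  rw [h4]
  refine (abs_sub _ _).trans ?_
  rw [abs_neg, h3]
  have : 0 ≤ |x| ^ 3 := by positivity
  linarith

end PathwiseLimits


/-- Itô's formula for `e^{-N} y` along one path, given the limits of the error terms along a
sequence of dyadic grids. -/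
theorem exp_neg_mul_eq_of_tendsto {T : ℝ≥0} (hT : 0 < T) {l : Filter ℕ} [l.NeBot] (hl : l ≤ atTop)
    {y N a β : ℝ≥0 → ℝ} {F : ℝ → ℝ} {η ρ r σ s : ℕ → ℕ → ℝ} {Ry : ℝ}
    (hN : Continuous N) (ha : Continuous a)
    (hyb : ∀ n i, i ≤ 2 ^ n → |y (grid T n i)| ≤ Ry)
    (hylim : ∀ᵐ s ∂(volume.restrict (Set.Icc (0 : ℝ) T)),
      Tendsto (fun n => y (dfloor T n s.toNNReal)) atTop (𝓝 (y s.toNNReal)))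
    (hF : IntervalIntegrable F volume 0 T)
    (hy : ∀ n, ∀ i < 2 ^ n, gridInc y T n i =
      (∫ s in (grid T n i : ℝ)..grid T n (i + 1), F s) +
        y (grid T n i) * (a (grid T n i) * gridInc β T n i + η n i) + ρ n i + σ n i)
    (hNi : ∀ n, ∀ i < 2 ^ n, gridInc N T n i =
      a (grid T n i) * gridInc β T n i + η n i + r n i + s n i)
    (hη : Tendsto (fun n => ∑ i ∈ Finset.range (2 ^ n), η n i ^ 2) l (𝓝 0))
    (hσ : Tendsto (fun n => ∑ i ∈ Finset.range (2 ^ n), |σ n i|) l (𝓝 0))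
    (hs : Tendsto (fun n => ∑ i ∈ Finset.range (2 ^ n), |s n i|) l (𝓝 0))
    (hρ : Tendsto (fun n => ∑ i ∈ Finset.range (2 ^ n), ρ n i ^ 2) l (𝓝 0))
    (hr : Tendsto (fun n => ∑ i ∈ Finset.range (2 ^ n), r n i ^ 2) l (𝓝 0))
    (hcρ : Tendsto (fun n => ∑ i ∈ Finset.range (2 ^ n),
      Real.exp (-N (grid T n i)) * ρ n i) l (𝓝 0))
    (hcr : Tendsto (fun n => ∑ i ∈ Finset.range (2 ^ n),
      Real.exp (-N (grid T n i)) * y (grid T n i) * r n i) l (𝓝 0))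
    (hβ : Tendsto (fun n => ∑ i ∈ Finset.range (2 ^ n),
      (gridInc β T n i ^ 2 - ((grid T n (i + 1) : ℝ) - grid T n i))) l (𝓝 0))
    (hwβ : Tendsto (fun n => ∑ i ∈ Finset.range (2 ^ n),
      Real.exp (-N (grid T n i)) * y (grid T n i) * a (grid T n i) ^ 2 *
        (gridInc β T n i ^ 2 - ((grid T n (i + 1) : ℝ) - grid T n i))) l (𝓝 0)) :
    Real.exp (-N T) * y T = Real.exp (-N 0) * y 0 +
      (∫ s in (0 : ℝ)..T, Real.exp (-N s.toNNReal) * F s) -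
      1 / 2 * ∫ s in (0 : ℝ)..T,
        Real.exp (-N s.toNNReal) * y s.toNNReal * a s.toNNReal ^ 2 := by
  set c : ℝ≥0 → ℝ := fun t => Real.exp (-N t) with hc
  have hcc : Continuous c := Real.continuous_exp.comp hN.neg
  have hc0 : ∀ t, 0 < c t := fun t => Real.exp_pos _
  obtain ⟨Cb, hCb⟩ := (isCompact_Icc (a := (0 : ℝ≥0)) (b := T)).exists_bound_of_continuousOn
    hcc.continuousOn
  obtain ⟨Ab, hAb⟩ := (isCompact_Icc (a := (0 : ℝ≥0)) (b := T)).exists_bound_of_continuousOn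
    ha.continuousOn
  have hCg : ∀ n i, i ≤ 2 ^ n → |c (grid T n i)| ≤ Cb := fun n i hi =>
    hCb _ ⟨zero_le, grid_le hi⟩
  have hAg : ∀ n i, i ≤ 2 ^ n → |a (grid T n i)| ≤ Ab := fun n i hi =>
    hAb _ ⟨zero_le, grid_le hi⟩
  have hCb0 : 0 ≤ Cb := (abs_nonneg _).trans (hCg 0 0 (by simp))
  have hAb0 : 0 ≤ Ab := (abs_nonneg _).trans (hAg 0 0 (by simp))
  have hRy0 : 0 ≤ Ry := (abs_nonneg _).trans (hyb 0 0 (by simp))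
  have hwg : ∀ n i, i ≤ 2 ^ n → |c (grid T n i) * y (grid T n i)| ≤ Cb * Ry := fun n i hi => by
    rw [abs_mul]
    exact mul_le_mul (hCg n i hi) (hyb n i hi) (abs_nonneg _) hCb0
  set x : ℕ → ℕ → ℝ := gridInc N T with hx
  set ab : ℕ → ℕ → ℝ := fun n i => a (grid T n i) * gridInc β T n i with hab
  -- `ΔN = ab + e`: the Brownian part `ab` has bounded quadratic sums and everything else has
  -- vanishing ones.
  set e : ℕ → ℕ → ℝ := fun n i => η n i + r n i + s n i with he
  have hsmall : ∀ ε > 0, ∀ᶠ n in l, ∀ i < 2 ^ n, |x n i| < ε := fun ε hε =>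
    ((eventually_abs_sub_lt hN T hε).filter_mono hl).mono fun n hn i hi =>
      hn i hi _ ⟨le_rfl, grid_mono T n i.le_succ⟩
  have hs2 : Tendsto (fun n => ∑ i ∈ Finset.range (2 ^ n), s n i ^ 2) l (𝓝 0) := by
    have h1 := hs.pow 2
    rw [zero_pow two_ne_zero] at h1
    refine squeeze_zero (fun n => Finset.sum_nonneg fun _ _ => sq_nonneg _) (fun n => ?_) h1
    have := Finset.sum_sq_le_sq_sum_of_nonneg (s := Finset.range (2 ^ n)) (f := fun i => |s n i|)
      fun i _ => abs_nonneg _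
    simpa only [sq_abs] using this
  have he2 : Tendsto (fun n => ∑ i ∈ Finset.range (2 ^ n), e n i ^ 2) l (𝓝 0) := by
    have h1 := ((hη.add hr).add hs2).const_mul 3
    simp only [add_zero, mul_zero] at h1
    refine squeeze_zero (fun n => Finset.sum_nonneg fun _ _ => sq_nonneg _) (fun n => ?_) h1
    rw [← Finset.sum_add_distrib, ← Finset.sum_add_distrib, Finset.mul_sum]
    refine Finset.sum_le_sum fun i _ => ?_
    simp only [he]
    nlinarith [sq_nonneg (η n i - r n i), sq_nonneg (η n i - s n i), sq_nonneg (r n i - s n i)]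
  have hab2 : ∀ᶠ n in l, ∑ i ∈ Finset.range (2 ^ n), ab n i ^ 2 ≤ Ab ^ 2 * (T + 1) := by
    filter_upwards [hβ.eventually (gt_mem_nhds one_pos)] with n hn
    rw [Finset.sum_sub_distrib] at hn
    have h1 : ∑ i ∈ Finset.range (2 ^ n), ((grid T n (i + 1) : ℝ) - grid T n i) = T := by
      have := sum_gridInc (fun t => (t : ℝ)) T n (2 ^ n)
      rw [grid_last, NNReal.coe_zero, sub_zero] at this
      exact this
    rw [h1] at hn
    calc ∑ i ∈ Finset.range (2 ^ n), ab n i ^ 2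
        ≤ ∑ i ∈ Finset.range (2 ^ n), Ab ^ 2 * gridInc β T n i ^ 2 := by
          refine Finset.sum_le_sum fun i hi => ?_
          simp only [hab]
          rw [mul_pow]
          refine mul_le_mul_of_nonneg_right ?_ (sq_nonneg _)
          rw [← sq_abs]
          exact pow_le_pow_left₀ (abs_nonneg _) (hAg n i (Finset.mem_range.1 hi).le) 2
      _ = Ab ^ 2 * ∑ i ∈ Finset.range (2 ^ n), gridInc β T n i ^ 2 := (Finset.mul_sum _ _ _).symm
      _ ≤ Ab ^ 2 * (T + 1) := by
          refine mul_le_mul_of_nonneg_left ?_ (sq_nonneg _)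
          linarith
  have hx2 : ∀ᶠ n in l, ∑ i ∈ Finset.range (2 ^ n), x n i ^ 2 ≤ 2 * (Ab ^ 2 * (T + 1)) + 2 := by
    filter_upwards [hab2, he2.eventually (gt_mem_nhds one_pos)] with n h1 h2
    have h3 : ∑ i ∈ Finset.range (2 ^ n), x n i ^ 2 ≤
        ∑ i ∈ Finset.range (2 ^ n), (2 * ab n i ^ 2 + 2 * e n i ^ 2) := by
      refine Finset.sum_le_sum fun i hi => ?_
      have h4 : x n i = ab n i + e n i := by
        have h5 := hNi n i (Finset.mem_range.1 hi)
        rw [h5]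
        simp only [hab, he]
        ring
      rw [h4]
      nlinarith [sq_nonneg (ab n i - e n i)]
    rw [Finset.sum_add_distrib, ← Finset.mul_sum, ← Finset.mul_sum] at h3
    linarith
  have hcinc : ∀ n i, c (grid T n (i + 1)) = c (grid T n i) * Real.exp (-x n i) := by
    intro n i
    simp only [hc, hx, gridInc]
    rw [← Real.exp_add]
    congr 1
    ring
  have hcd : ∀ᶠ n in l, ∀ i < 2 ^ n,
      |c (grid T n (i + 1)) - c (grid T n i)| ≤ 2 * Cb * |x n i| := by
    filter_upwards [hsmall 1 one_pos] with n hn i hi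
    have h1 := Real.abs_exp_sub_one_le (x := -x n i) (by rw [abs_neg]; exact (hn i hi).le)
    rw [abs_neg] at h1
    have h2 : c (grid T n (i + 1)) - c (grid T n i) =
        c (grid T n i) * (Real.exp (-x n i) - 1) := by rw [hcinc]; ring
    rw [h2, abs_mul]
    calc |c (grid T n i)| * |Real.exp (-x n i) - 1| ≤ Cb * (2 * |x n i|) :=
          mul_le_mul (hCg n i hi.le) h1 (abs_nonneg _) hCb0
      _ = 2 * Cb * |x n i| := by ring
  -- the limits of the individual error terms
  have z1 := (tendsto_sum_mul_integral hcc hF).mono_left hl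
  have z2 : Tendsto (fun n => ∑ i ∈ Finset.range (2 ^ n),
      c (grid T n (i + 1)) * (σ n i - y (grid T n i) * s n i)) l (𝓝 0) := by
    have h1 : Tendsto (fun n => ∑ i ∈ Finset.range (2 ^ n), c (grid T n (i + 1)) * σ n i)
        l (𝓝 0) := tendsto_sum_of_abs_le (R := Cb) (fun n i hi => by
      rw [abs_mul]
      exact mul_le_mul_of_nonneg_right (hCg n (i + 1) hi) (abs_nonneg _)) hσ
    have h2 : Tendsto (fun n => ∑ i ∈ Finset.range (2 ^ n),
        c (grid T n (i + 1)) * (y (grid T n i) * s n i)) l (𝓝 0) :=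
      tendsto_sum_of_abs_le (R := Cb * Ry) (fun n i hi => by
        rw [abs_mul, abs_mul, ← mul_assoc]
        refine mul_le_mul_of_nonneg_right ?_ (abs_nonneg _)
        exact mul_le_mul (hCg n (i + 1) hi) (hyb n i hi.le) (abs_nonneg _) hCb0) hs
    have h3 := h1.sub h2
    rw [sub_zero] at h3
    refine h3.congr fun n => ?_
    rw [← Finset.sum_sub_distrib]
    exact Finset.sum_congr rfl fun i _ => by ring
  have z5 : Tendsto (fun n => ∑ i ∈ Finset.range (2 ^ n),
      (c (grid T n (i + 1)) - c (grid T n i)) * ρ n i) l (𝓝 0) := by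
    refine tendsto_sum_of_abs_le_mul (R := 2 * Cb) (u := x) (by positivity) ?_ hx2 hρ
    filter_upwards [hcd] with n hn i hi
    rw [abs_mul, ← mul_assoc]
    exact mul_le_mul_of_nonneg_right (hn i hi) (abs_nonneg _)
  have z6 : Tendsto (fun n => ∑ i ∈ Finset.range (2 ^ n),
      (c (grid T n (i + 1)) - c (grid T n i)) * (y (grid T n i) * r n i)) l (𝓝 0) := by
    refine tendsto_sum_of_abs_le_mul (R := 2 * Cb * Ry) (u := x) (by positivity) ?_ hx2 hr
    filter_upwards [hcd] with n hn i hi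
    rw [abs_mul, abs_mul]
    calc _ ≤ 2 * Cb * |x n i| * (Ry * |r n i|) :=
          mul_le_mul (hn i hi) (mul_le_mul_of_nonneg_right (hyb n i hi.le) (abs_nonneg _))
            (by positivity) (by positivity)
      _ = _ := by ring
  have z7 : Tendsto (fun n => ∑ i ∈ Finset.range (2 ^ n), c (grid T n i) * y (grid T n i) *
      (1 - (1 + x n i) * Real.exp (-x n i) - x n i ^ 2 / 2)) l (𝓝 0) := by
    refine tendsto_sum_of_forall_abs_le (v := fun n i => Cb * Ry * x n i ^ 2)
      (K := Cb * Ry * (2 * (Ab ^ 2 * (T + 1)) + 2)) (fun ε hε => ?_) ?_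
    · filter_upwards [hsmall 1 one_pos, hsmall ε hε] with n h1 h2 i hi
      rw [abs_mul]
      calc _ ≤ Cb * Ry * (ε * x n i ^ 2) := by
            refine mul_le_mul (hwg n i hi.le)
              ((abs_one_sub_one_add_mul_exp_le (h1 i hi).le).trans ?_) (abs_nonneg _)
              (by positivity)
            exact mul_le_mul_of_nonneg_right (h2 i hi).le (sq_nonneg _)
        _ = _ := by ring
    · filter_upwards [hx2] with n hn
      rw [← Finset.mul_sum]
      exact mul_le_mul_of_nonneg_left hn (by positivity)
  have z8 : Tendsto (fun n => ∑ i ∈ Finset.range (2 ^ n),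
      c (grid T n i) * y (grid T n i) * (x n i * e n i)) l (𝓝 0) := by
    refine tendsto_sum_of_abs_le_mul (R := Cb * Ry) (u := x) (by positivity)
      (Eventually.of_forall fun n i hi => ?_) hx2 he2
    rw [abs_mul, abs_mul (x n i)]
    exact mul_le_mul_of_nonneg_right (hwg n i hi.le) (by positivity)
  have z9 : Tendsto (fun n => ∑ i ∈ Finset.range (2 ^ n),
      c (grid T n i) * y (grid T n i) * (ab n i * e n i)) l (𝓝 0) := by
    refine tendsto_sum_of_abs_le_mul (R := Cb * Ry) (u := ab) (by positivity)
      (Eventually.of_forall fun n i hi => ?_) hab2 he2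
    rw [abs_mul, abs_mul (ab n i)]
    exact mul_le_mul_of_nonneg_right (hwg n i hi.le) (by positivity)
  have z11 : Tendsto (fun n => ∑ i ∈ Finset.range (2 ^ n),
      c (grid T n i) * y (grid T n i) * a (grid T n i) ^ 2 *
        ((grid T n (i + 1) : ℝ) - grid T n i)) l
      (𝓝 (∫ s in (0 : ℝ)..T, c s.toNNReal * y s.toNNReal * a s.toNNReal ^ 2)) := by
    refine (tendsto_sum_mul_mesh hT (x := fun t => c t * y t * a t ^ 2) (R := Cb * Ry * Ab ^ 2)
      (fun n i hi => ?_) ?_).mono_left hl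
    · rw [abs_mul, abs_pow]
      exact mul_le_mul (hwg n i hi) (pow_le_pow_left₀ (abs_nonneg _) (hAg n i hi) 2)
        (by positivity) (by positivity)
    · filter_upwards [hylim] with t ht
      have h1 := tendsto_dfloor hT t.toNNReal
      exact (((hcc.tendsto _).comp h1).mul ht).mul (((ha.tendsto _).comp h1).pow 2)
  -- On each cell, with `x = ΔN` and `Δy = ∫F + y(x - r - s) + ρ + σ`, one has exactly `Δ(cy) =
  -- c_{i+1}∫F + c_{i+1}(σ - ys) + c_{i+1}(ρ - yr) - c_i y (1 - (1 + x)e^{-x})`. In the martingale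
  -- terms `c_{i+1}` is split into the adapted `c_i` and its increment. The last bracket is `x²/2`
  -- up to `z7`, while `x² = xe + ab·e + ab²` and `ab² = a²(Δβ² - Δt) + a²Δt`.
  have hsum := ((((((((z1.add z2).add hcρ).sub hcr).add z5).sub z6).sub z7).sub
    (z8.const_mul (1 / 2))).sub (z9.const_mul (1 / 2))).sub (hwβ.const_mul (1 / 2)) |>.sub
    (z11.const_mul (1 / 2))
  have hconst : Tendsto (fun _ : ℕ => c T * y T - c 0 * y 0) l (𝓝 (c T * y T - c 0 * y 0)) :=
    tendsto_const_nhds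
  have heq := tendsto_nhds_unique (hsum.congr fun n => ?_) hconst
  · simp only [mul_zero, add_zero, sub_zero] at heq
    linarith
  · have h1 := sum_gridInc (fun t => c t * y t) T n (2 ^ n)
    rw [grid_last] at h1
    rw [← h1]
    simp only [Finset.mul_sum]
    simp only [← Finset.sum_add_distrib, ← Finset.sum_sub_distrib]
    refine Finset.sum_congr rfl fun i hi => ?_
    have hi := Finset.mem_range.1 hi
    have e1 : y (grid T n (i + 1)) = y (grid T n i) +
        ((∫ s in (grid T n i : ℝ)..grid T n (i + 1), F s) +
        y (grid T n i) * (a (grid T n i) * gridInc β T n i + η n i) + ρ n i + σ n i) := by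
      rw [← hy n i hi, gridInc]; ring
    have e2 : x n i = a (grid T n i) * gridInc β T n i + η n i + r n i + s n i := hNi n i hi
    have e3 : gridInc (fun t => c t * y t) T n i =
        c (grid T n (i + 1)) * y (grid T n (i + 1)) - c (grid T n i) * y (grid T n i) := rfl
    have e4 : Real.exp (-N (grid T n i)) = c (grid T n i) := rfl
    rw [e3, e4, e1, hcinc]
    simp only [hab, he]
    generalize Real.exp (-x n i) = E
    rw [e2]
    ring


/-! ### Adaptedness and initial values of the integrals -/

section Adapted

variable {Ω : Type*} {m : MeasurableSpace Ω} {P : Measure Ω} {𝓕 : Filtration ℝ≥0 m}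
  {B : ℝ≥0 → Ω → ℝ}

theorem IsSimple.measurable_integral {Z W : ℝ≥0 → Ω → ℝ} (h : IsSimple 𝓕 B Z W)
    (hB : ∀ t, Measurable[𝓕 t] (B t)) (t : ℝ≥0) : Measurable[𝓕 t] (W t) := by
  obtain ⟨ι, I, s, e, c, h1, h2, -, h4⟩ := h
  have h5 : W t = fun ω => ∑ i ∈ I, c i ω * (B (min (e i) t) ω - B (min (s i) t) ω) := by
    ext ω; exact h4 t ω
  rw [h5]
  refine Finset.measurable_fun_sum _ fun i hi => ?_
  rcases le_total (s i) t with hst | hst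
  · refine ((h2 i hi).mono (𝓕.mono hst) le_rfl).mul (Measurable.sub ?_ ?_)
    · exact (hB _).mono (𝓕.mono (min_le_right _ _)) le_rfl
    · exact (hB _).mono (𝓕.mono (min_le_right _ _)) le_rfl
  · rw [min_eq_right hst, min_eq_right (hst.trans (h1 i hi))]
    simp only [sub_self, mul_zero]
    exact measurable_const

/-- The filtration is not assumed complete, so the limit itself may fail to be `m'`-measurable; the
`limsup` is a measurable version. -/
theorem aestronglyMeasurable_of_ae_tendsto {m' : MeasurableSpace Ω} {f : ℕ → Ω → ℝ} {g : Ω → ℝ}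
    (hf : ∀ n, Measurable[m'] (f n))
    (h : ∀ᵐ ω ∂P, Tendsto (fun n => f n ω) atTop (𝓝 (g ω))) : AEStronglyMeasurable[m'] g P :=
  ⟨fun ω => limsup (fun n => f n ω) atTop,
    (Measurable.limsup hf).stronglyMeasurable,
    h.mono fun _ hω => hω.limsup_eq.symm⟩

theorem tendsto_of_tendsto_ofReal_abs {ι : Type*} {l : Filter ι} {f : ι → ℝ}
    (h : Tendsto (fun n => ENNReal.ofReal |f n|) l (𝓝 0)) : Tendsto f l (𝓝 0) := by
  have h1 := (ENNReal.tendsto_toReal ENNReal.zero_ne_top).comp h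
  rw [ENNReal.toReal_zero] at h1
  refine squeeze_zero_norm (fun n => ?_) h1
  simp [Function.comp, ENNReal.toReal_ofReal]

theorem HasItoIntegralOn.aestronglyMeasurable [IsProbabilityMeasure P]
    (hB : ∀ t, Measurable[𝓕 t] (B t)) {X : ℝ≥0 → Ω → ℝ} {t : ℝ≥0} {J : Ω → ℝ}
    (h : HasItoIntegralOn P 𝓕 B X t Set.univ J) : AEStronglyMeasurable[𝓕 t] J P := by
  obtain ⟨Y, -, hY⟩ := h.exists_negl MeasurableSet.univ
  rw [Measure.restrict_univ] at hY
  obtain ⟨φ, -, hφ⟩ := hY.exists_subseq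
  refine aestronglyMeasurable_of_ae_tendsto (f := fun n => (Y (φ n)).integral B t)
    (fun n => (Y (φ n)).isSimple.measurable_integral hB t) ?_
  filter_upwards [hφ] with ω hω
  have h1 := (tendsto_of_tendsto_ofReal_abs hω).add_const (J ω)
  simpa using h1

theorem HasItoIntegralOn.ae_eq_zero {X : ℝ≥0 → Ω → ℝ} {A : Set Ω} {J : Ω → ℝ}
    (h : HasItoIntegralOn P 𝓕 B X 0 A J) (hA : MeasurableSet A) : ∀ᵐ ω ∂(P.restrict A), J ω = 0 := by
  obtain ⟨Y, -, hY⟩ := h.exists_negl hA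
  obtain ⟨φ, -, hφ⟩ := hY.exists_subseq
  filter_upwards [hφ] with ω hω
  have h0 : ∀ n, (Y (φ n)).integral B 0 ω = 0 := fun n => by
    simp [ElementaryProcess.integral]
  have h1 := tendsto_of_tendsto_ofReal_abs hω
  simp only [h0, zero_sub] at h1
  have := tendsto_nhds_unique h1 tendsto_const_nhds
  linarith

theorem aestronglyMeasurable_stieltjes {X : ℝ≥0 → Ω → ℝ} (hX : ∀ t, Measurable[𝓕 t] (X t))
    {f : ℝ≥0 → ℝ} {t : ℝ≥0} {J : Ω → ℝ}
    (h : ∀ᵐ ω ∂P, HasStieltjesIntegral f (fun s => X s ω) t (J ω)) :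
    AEStronglyMeasurable[𝓕 t] J P := by
  refine aestronglyMeasurable_of_ae_tendsto
    (f := fun n ω => gridSum f (fun s => X s ω) t (0 + n) (2 ^ n * 1)) (fun n => ?_) ?_
  · unfold gridSum gridInc
    refine Finset.measurable_fun_sum _ fun k hk => ?_
    have hk := Finset.mem_range.1 hk
    rw [mul_one] at hk
    refine measurable_const.mul (Measurable.sub ?_ ?_)
    · exact (hX _).mono (𝓕.mono (grid_le (by rw [zero_add]; exact hk))) le_rfl
    · exact (hX _).mono (𝓕.mono (grid_le (by rw [zero_add]; exact hk.le))) le_rfl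
  · filter_upwards [h] with ω hω
    refine tendsto_gridSum (T := t) (n := 0) (i := 1) ?_
    have : grid t 0 1 = t := by simp [grid]
    rwa [this]

/-- Each `N t` is determined only up to null sets by integrals of the past. The weights in the
martingale estimates have to be adapted, hence this version. -/
theorem IsMixedNoise.exists_adapted [IsProbabilityMeasure P] {a b : ℝ → ℝ}
    {BH N : ℝ≥0 → Ω → ℝ} (hN : IsMixedNoise P 𝓕 a b B BH N)
    (hB : ∀ t, Measurable[𝓕 t] (B t)) (hBH : ∀ t, Measurable[𝓕 t] (BH t)) :
    ∃ N' : ℝ≥0 → Ω → ℝ, (∀ t, Measurable[𝓕 t] (N' t)) ∧ ∀ t, ∀ᵐ ω ∂P, N t ω = N' t ω := by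
  have h1 : ∀ t, AEStronglyMeasurable[𝓕 t] (N t) P := by
    intro t
    obtain ⟨I, J, hI, hJ, h⟩ := hN.eq_integrals t
    exact ((hI.aestronglyMeasurable hB).add (aestronglyMeasurable_stieltjes hBH hJ)).congr
      (h.mono fun ω hω => hω.symm)
  exact ⟨fun t => (h1 t).mk, fun t => (h1 t).stronglyMeasurable_mk.measurable,
    fun t => (h1 t).ae_eq_mk⟩

theorem IsMixedNoise.ae_zero {a b : ℝ → ℝ} {BH N : ℝ≥0 → Ω → ℝ}
    (hN : IsMixedNoise P 𝓕 a b B BH N) : ∀ᵐ ω ∂P, N 0 ω = 0 := by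
  obtain ⟨I, J, hI, hJ, h⟩ := hN.eq_integrals 0
  have h1 := hI.ae_eq_zero MeasurableSet.univ
  rw [Measure.restrict_univ] at h1
  filter_upwards [h1, hJ, h] with ω h2 h3 h4
  rw [h4, h2, h3.eq_zero, add_zero]

end Adapted

/-! ### Dyadic regularity -/

section Regularity

variable {T : ℝ≥0}

/-- Every dyadic value differs by less than `1` from one of the finitely many values on a
sufficiently fine grid. -/
theorem exists_bound_of_uniformContinuousOn (hT : 0 < T) {f : ℝ≥0 → ℝ}
    (hf : UniformContinuousOn f (Set.range (dyadicSeq T))) :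
    ∃ R, ∀ n i, i ≤ 2 ^ n → |f (grid T n i)| ≤ R := by
  obtain ⟨δ, hδ, hd⟩ := Metric.uniformContinuousOn_iff.1 hf 1 one_pos
  have h1 : Tendsto (fun n : ℕ => ((T / 2 ^ n : ℝ≥0) : ℝ)) atTop (𝓝 ((0 : ℝ≥0) : ℝ)) :=
    (NNReal.continuous_coe.tendsto 0).comp (tendsto_mesh T)
  obtain ⟨k, hk⟩ := (h1.eventually (gt_mem_nhds (by simpa using hδ))).exists
  refine ⟨∑ j ∈ Finset.range (2 ^ k + 1), |f (grid T k j)| + 1, fun n i hi => ?_⟩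
  obtain ⟨j, hj, hjs⟩ := exists_dfloor_eq_of_le hT k (grid_le (T := T) hi)
  have h2 := dfloor_le hT k (grid T n i)
  have h3 := lt_dfloor_add hT k (grid T n i)
  rw [hjs] at h2 h3
  have h4 := hd (grid T n i) (exists_dyadicSeq_eq T hi) (grid T k j) (exists_dyadicSeq_eq T hj) (by
    have h2' : (grid T k j : ℝ) ≤ grid T n i := by exact_mod_cast h2
    have h3' : (grid T n i : ℝ) < grid T k j + (T / 2 ^ k : ℝ≥0) := by exact_mod_cast h3
    rw [NNReal.dist_eq, abs_of_nonneg (by linarith)]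
    linarith)
  rw [Real.dist_eq] at h4
  have h5 : |f (grid T k j)| ≤ ∑ j ∈ Finset.range (2 ^ k + 1), |f (grid T k j)| :=
    Finset.single_le_sum (f := fun j => |f (grid T k j)|) (fun _ _ => abs_nonneg _)
      (Finset.mem_range.2 (Nat.lt_succ_of_le hj))
  have h6 := abs_sub_abs_le_abs_sub (f (grid T n i)) (f (grid T k j))
  linarith

theorem exists_abs_le_of_holderOnWith {f : ℝ≥0 → ℝ} {M γ : ℝ≥0}
    (hf : HolderOnWith M γ f (Set.Icc 0 T)) : ∃ R, ∀ t ≤ T, |f t| ≤ R := by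
  refine ⟨|f 0| + M * (T : ℝ) ^ (γ : ℝ), fun t ht => ?_⟩
  have h1 := hf.dist_le ⟨zero_le, ht⟩ ⟨le_rfl, zero_le⟩
  rw [Real.dist_eq, NNReal.dist_eq, NNReal.coe_zero, sub_zero, abs_of_nonneg t.coe_nonneg] at h1
  have h2 : (t : ℝ) ^ (γ : ℝ) ≤ (T : ℝ) ^ (γ : ℝ) :=
    Real.rpow_le_rpow t.coe_nonneg (by exact_mod_cast ht) γ.coe_nonneg
  have h3 := abs_sub_abs_le_abs_sub (f t) (f 0)
  have h4 := mul_le_mul_of_nonneg_left h2 M.coe_nonneg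
  linarith

theorem continuousOn_integral_toReal {F : ℝ → ℝ} (hF : IntervalIntegrable F volume 0 T) :
    ContinuousOn (fun t : ℝ≥0 => ∫ s in (0 : ℝ)..t, F s) (Set.Icc 0 T) := by
  have h1 : ContinuousOn (fun t : ℝ => ∫ s in (0 : ℝ)..t, F s) (Set.uIcc 0 (T : ℝ)) := by
    refine intervalIntegral.continuousOn_primitive_interval ?_
    rwa [Set.uIcc_of_le T.coe_nonneg, ← intervalIntegrable_iff_integrableOn_Icc_of_le T.coe_nonneg]
  refine h1.comp NNReal.continuous_coe.continuousOn fun t ht => ?_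
  rw [Set.uIcc_of_le T.coe_nonneg]
  exact ⟨t.coe_nonneg, by exact_mod_cast ht.2⟩

end Regularity


/-! ### Itô's formula for the mixed noise -/

section ItoFormula

variable {Ω : Type*} {m : MeasurableSpace Ω} {P : Measure Ω} [IsProbabilityMeasure P]
  {𝓕 : Filtration ℝ≥0 m} {B BH : ℝ≥0 → Ω → ℝ} {H : ℝ} {a b : ℝ → ℝ} {T : ℝ≥0} {A : Set Ω}
  {y I J : ℝ≥0 → Ω → ℝ} {F : ℝ → Ω → ℝ} {p : ℝ}

/-- Dyadic regularity of a mixed integral process. -/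
theorem ae_dyadic_regular (hT : 0 < T) (hB : IsFilteredBrownian P 𝓕 B)
    (hBH : IsFractionalBrownian P 𝓕 H BH) (hH : 0 < H) (hA : MeasurableSet A)
    {X f : ℝ≥0 → Ω → ℝ} (hX : ∀ ω, Measurable fun r => X r ω)
    (hI : ∀ t ≤ T, HasItoIntegralOn P 𝓕 B X t A (I t))
    (hF : ∀ᵐ ω ∂(P.restrict A), IntervalIntegrable (fun s => F s ω) volume 0 T)
    (hf : ∀ᵐ ω ∂(P.restrict A), ∃ γ M : ℝ≥0, 1 - H < γ ∧
      HolderOnWith M γ (fun s => f s ω) (Set.Icc 0 T))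
    (hJ : ∀ t ≤ T, ∀ᵐ ω ∂(P.restrict A),
      HasStieltjesIntegral (fun s => f s ω) (fun s => BH s ω) t (J t ω))
    (hy : ∀ t ≤ T, ∀ᵐ ω ∂(P.restrict A),
      y t ω = p + (∫ s in (0 : ℝ)..t, F s ω) + (I t ω + J t ω)) :
    (∀ᵐ ω ∂(P.restrict A), ∃ R, ∀ n i, i ≤ 2 ^ n → |y (grid T n i) ω| ≤ R) ∧
    (∀ s ≤ T, ∀ᵐ ω ∂(P.restrict A), Tendsto (fun n => y (dfloor T n s) ω) atTop (𝓝 (y s ω))) ∧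
    ∀ᵐ ω ∂(P.restrict A), Tendsto (fun n => ∑ i ∈ Finset.range (2 ^ n),
      |youngRem (fun t => f t ω) (fun t => BH t ω) (fun t => J t ω) T n i|) atTop (𝓝 0) := by
  have hJg : ∀ᵐ ω ∂(P.restrict A), ∀ n i, i ≤ 2 ^ n → HasStieltjesIntegral (fun s => f s ω)
      (fun s => BH s ω) (grid T n i) (J (grid T n i) ω) :=
    ae_all_iff.2 fun n => ae_all_iff.2 fun i => by
      by_cases hi : i ≤ 2 ^ n
      · filter_upwards [hJ _ (grid_le hi)] with ω hω _ using hω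
      · exact ae_of_all _ fun ω h => absurd h hi
  have hyg : ∀ᵐ ω ∂(P.restrict A), ∀ n i, i ≤ 2 ^ n → y (grid T n i) ω =
      p + (∫ s in (0 : ℝ)..grid T n i, F s ω) + (I (grid T n i) ω + J (grid T n i) ω) :=
    ae_all_iff.2 fun n => ae_all_iff.2 fun i => by
      by_cases hi : i ≤ 2 ^ n
      · filter_upwards [hy _ (grid_le hi)] with ω hω _ using hω
      · exact ae_of_all _ fun ω h => absurd h hi
  have hYoung : ∀ᵐ ω ∂(P.restrict A), Tendsto (fun n => ∑ i ∈ Finset.range (2 ^ n),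
      |youngRem (fun t => f t ω) (fun t => BH t ω) (fun t => J t ω) T n i|) atTop (𝓝 0) := by
    filter_upwards [hJg, hf, ae_restrict_of_ae (hBH.ae_forall_tendsto_youngRem hH T)]
      with ω h1 h2 h3
    obtain ⟨γ, M, hγ, hM⟩ := h2
    exact h3 _ (fun t => J t ω) γ M hγ hM h1
  refine ⟨?_, fun s hs => ?_, hYoung⟩
  · filter_upwards [hJg, hyg, hf, hF, ae_restrict_of_ae hBH.cont, hJ T le_rfl,
      ae_uniformContinuousOn_ito hB hA hX hI (dyadicSeq_le T)] with ω h1 h2 h3 h4 h5 h6 h7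
    obtain ⟨γ, M, -, hM⟩ := h3
    obtain ⟨R1, hR1⟩ := exists_bound_of_uniformContinuousOn hT h7
    obtain ⟨R, hR⟩ := exists_abs_le_of_holderOnWith hM
    obtain ⟨R2, hR2⟩ := exists_bound_stieltjes (J := fun t => J t ω) hR h5 h6 h1
    obtain ⟨R3, hR3⟩ := (isCompact_Icc (a := (0 : ℝ≥0)) (b := T)).exists_bound_of_continuousOn
      (continuousOn_integral_toReal h4)
    refine ⟨|p| + R3 + (R1 + R2), fun n i hi => ?_⟩
    rw [h2 n i hi]
    exact (abs_add_le _ _).trans (add_le_add ((abs_add_le _ _).trans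
      (add_le_add le_rfl (hR3 _ ⟨zero_le, grid_le hi⟩))) ((abs_add_le _ _).trans
      (add_le_add (hR1 n i hi) (hR2 n i hi))))
  -- The time `s` is adjoined to the dyadic points, so that uniform continuity along `q` links `I s`
  -- with the dyadic values.
  · set q : ℕ → ℝ≥0 := fun j => if j = 0 then s else dyadicSeq T (j - 1) with hq
    have hqT : ∀ j, q j ≤ T := by
      intro j
      simp only [hq]
      split_ifs
      · exact hs
      · exact dyadicSeq_le T _
    filter_upwards [hJg, hyg, hf, hF, ae_restrict_of_ae hBH.cont, hJ s hs, hy s hs, hYoung,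
      ae_uniformContinuousOn_ito hB hA hX hI hqT] with ω h1 h2 h3 h4 h5 h6 h7 h8 h9
    obtain ⟨γ, M, -, hM⟩ := h3
    obtain ⟨R, hR⟩ := exists_abs_le_of_holderOnWith hM
    have hJ0 : J 0 ω = 0 := by
      have := h1 0 0 (by simp)
      rw [grid_zero] at this
      exact this.eq_zero
    have t1 := tendsto_stieltjes_dfloor (J := fun t => J t ω) hT hR h5 hs hJ0 h8 h6
    have hd : ∀ n, dfloor T n s ∈ Set.range q := by
      intro n
      obtain ⟨i, hi, hdi⟩ := exists_dfloor_eq_of_le hT n hs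
      obtain ⟨j, hj⟩ := exists_dyadicSeq_eq T hi
      exact ⟨j + 1, by simp only [hq]; rw [if_neg (Nat.succ_ne_zero j), Nat.add_sub_cancel, hj, hdi]⟩
    have hsr : s ∈ Set.range q := ⟨0, by simp [hq]⟩
    have t2 : Tendsto (fun n => I (dfloor T n s) ω) atTop (𝓝 (I s ω)) :=
      (h9.continuousOn s hsr).tendsto.comp (tendsto_nhdsWithin_iff.2
        ⟨tendsto_dfloor hT s, Eventually.of_forall hd⟩)
    have t3 : Tendsto (fun n => ∫ r in (0 : ℝ)..(dfloor T n s), F r ω) atTop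
        (𝓝 (∫ r in (0 : ℝ)..s, F r ω)) :=
      (continuousOn_integral_toReal h4 s ⟨zero_le, hs⟩).tendsto.comp (tendsto_nhdsWithin_iff.2
        ⟨tendsto_dfloor hT s, Eventually.of_forall fun n =>
          ⟨zero_le, (dfloor_le hT n s).trans hs⟩⟩)
    have t4 := (t3.const_add p).add (t2.add t1)
    rw [h7]
    refine t4.congr fun n => ?_
    obtain ⟨i, hi, hdi⟩ := exists_dfloor_eq_of_le hT n hs
    rw [hdi]
    exact (h2 n i hi).symm

/-- Itô's formula for `e^{-N} y`, where `dy = F dt + y dN`. -/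
theorem ae_exp_neg_mul_eq (hT : 0 < T) (hB : IsFilteredBrownian P 𝓕 B)
    (hBH : IsFractionalBrownian P 𝓕 H BH) (hH : 1 / 2 < H)
    (ha : ContinuousOn a (Set.Ici 0))
    {α : ℝ≥0} (hα : 1 - H < α) (hb : ∀ T : ℝ, ∃ M : ℝ≥0, HolderOnWith M α b (Set.Icc 0 T))
    {N : ℝ≥0 → Ω → ℝ} (hN : IsMixedNoise P 𝓕 a b B BH N) (hA : MeasurableSet A)
    (hym : Measurable (Function.uncurry y)) (hya : ∀ t, Measurable[𝓕 t] (y t))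
    (hI : ∀ t ≤ T, HasItoIntegralOn P 𝓕 B (fun s ω => y s ω * a s) t A (I t))
    (hF : ∀ᵐ ω ∂(P.restrict A), IntervalIntegrable (fun s => F s ω) volume 0 T)
    (hf : ∀ᵐ ω ∂(P.restrict A), ∃ γ M : ℝ≥0, 1 - H < γ ∧
      HolderOnWith M γ (fun s : ℝ≥0 => b s * y s ω) (Set.Icc 0 T))
    (hJ : ∀ t ≤ T, ∀ᵐ ω ∂(P.restrict A),
      HasStieltjesIntegral (fun s : ℝ≥0 => b s * y s ω) (fun s => BH s ω) t (J t ω))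
    (hy : ∀ t ≤ T, ∀ᵐ ω ∂(P.restrict A),
      y t ω = p + (∫ s in (0 : ℝ)..t, F s ω) + (I t ω + J t ω)) :
    ∀ᵐ ω ∂(P.restrict A), Real.exp (-N T ω) * y T ω = Real.exp (-N 0 ω) * y 0 ω +
      (∫ s in (0 : ℝ)..T, Real.exp (-N s.toNNReal ω) * F s ω) -
      1 / 2 * ∫ s in (0 : ℝ)..T,
        Real.exp (-N s.toNNReal ω) * y s.toNNReal ω * a (s.toNNReal : ℝ) ^ 2 := by
  have hH0 : 0 < H := by linarith
  have hac : Continuous fun t : ℝ≥0 => a t :=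
    ha.comp_continuous NNReal.continuous_coe fun t => t.coe_nonneg
  obtain ⟨Ab, hAb⟩ := (isCompact_Icc (a := (0 : ℝ≥0)) (b := T)).exists_bound_of_continuousOn
    hac.continuousOn
  have hAg : ∀ n i, i ≤ 2 ^ n → |a (grid T n i)| ≤ Ab := fun n i hi =>
    hAb _ ⟨zero_le, grid_le hi⟩
  have hAb0 : 0 ≤ Ab := (abs_nonneg _).trans (hAg 0 0 (by simp))
  obtain ⟨Mb, hMb⟩ := hb T
  have hbH : HolderOnWith Mb α (fun s : ℝ≥0 => b s) (Set.Icc 0 T) := fun s hs t ht =>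
    hMb s ⟨s.coe_nonneg, by exact_mod_cast hs.2⟩ t ⟨t.coe_nonneg, by exact_mod_cast ht.2⟩
  obtain ⟨Bb, hBb⟩ := exists_abs_le_of_holderOnWith hbH
  have ham : Measurable (Function.uncurry fun (s : ℝ≥0) (_ : Ω) => a s) :=
    hac.measurable.comp measurable_fst
  have hXm : Measurable (Function.uncurry fun (s : ℝ≥0) ω => y s ω * a s) := hym.mul ham
  obtain ⟨N', hN'a, hN'⟩ := hN.exists_adapted (fun t => (hB.adapted t).measurable)
    fun t => (hBH.adapted t).measurable
  choose IN JN hIN hJN hNeq using hN.eq_integrals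
  have hIN' : ∀ t ≤ T, HasItoIntegralOn P 𝓕 B (fun s _ => a s) t A (IN t) := fun t _ =>
    (hIN t).mono (Set.subset_univ _)
  -- regularity of `y` and of the noise
  obtain ⟨hyb, hylim, hyY⟩ := ae_dyadic_regular hT hB hBH hH0 hA
    (fun ω => hXm.comp measurable_prodMk_right) hI hF hf hJ hy
  have hNY : ∀ᵐ ω ∂(P.restrict A), Tendsto (fun n => ∑ i ∈ Finset.range (2 ^ n),
      |youngRem (fun t => b t) (fun t => BH t ω) (fun t => JN t ω) T n i|) atTop (𝓝 0) :=
    -- The regularity lemma is applied to the noise itself; the process is chosen to be the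
    -- right-hand side, so its equation holds by definition.
    (ae_dyadic_regular (F := fun _ _ => 0) (p := 0)
      (y := fun t ω => 0 + (∫ s in (0 : ℝ)..t, 0) + (IN t ω + JN t ω))
      (f := fun s _ => b s) hT hB hBH hH0 hA
      (fun ω => hac.measurable) hIN' (ae_of_all _ fun ω => intervalIntegrable_const)
      (ae_of_all _ fun ω => ⟨α, Mb, hα, hbH⟩) (fun t _ => ae_restrict_of_ae (hJN t))
      fun t _ => ae_of_all _ fun ω => rfl).2.2
  have hylim' : ∀ᵐ ω ∂(P.restrict A), ∀ᵐ s ∂(volume.restrict (Set.Icc (0 : ℝ) T)),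
      Tendsto (fun n => y (dfloor T n s.toNNReal) ω) atTop (𝓝 (y s.toNNReal ω)) := by
    rw [ae_restrict_iff' hA]
    exact ae_ae_tendsto_dfloor hym hA fun s hs => (ae_restrict_iff' hA).1 (hylim s hs)
  have hN'g : ∀ᵐ ω ∂(P.restrict A), ∀ n i, N' (grid T n i) ω = N (grid T n i) ω :=
    ae_restrict_of_ae (ae_all_iff.2 fun n => ae_all_iff.2 fun i =>
      (hN' _).mono fun ω hω => hω.symm)
  have hcb : ∀ᵐ ω ∂(P.restrict A), ∃ R, ∀ n i, i ≤ 2 ^ n →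
      |Real.exp (-N' (grid T n i) ω)| ≤ R := by
    filter_upwards [hN'g, ae_restrict_of_ae hN.cont] with ω h1 h2
    obtain ⟨R, hR⟩ := (isCompact_Icc (a := (0 : ℝ≥0)) (b := T)).exists_bound_of_continuousOn
      h2.neg.rexp.continuousOn
    refine ⟨R, fun n i hi => ?_⟩
    rw [h1]
    exact hR _ ⟨zero_le, grid_le hi⟩
  have hcyb : ∀ᵐ ω ∂(P.restrict A), ∃ R, ∀ n i, i ≤ 2 ^ n →
      |Real.exp (-N' (grid T n i) ω) * y (grid T n i) ω| ≤ R := by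
    filter_upwards [hcb, hyb] with ω h1 h2
    obtain ⟨R1, hR1⟩ := h1
    obtain ⟨R2, hR2⟩ := h2
    refine ⟨R1 * R2, fun n i hi => ?_⟩
    rw [abs_mul]
    exact mul_le_mul (hR1 n i hi) (hR2 n i hi) (abs_nonneg _) ((abs_nonneg _).trans (hR1 n i hi))
  have hcya : ∀ᵐ ω ∂(P.restrict A), ∃ R, ∀ n i, i ≤ 2 ^ n →
      |Real.exp (-N' (grid T n i) ω) * y (grid T n i) ω * a (grid T n i) ^ 2| ≤ R := by
    filter_upwards [hcyb] with ω h1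
    obtain ⟨R1, hR1⟩ := h1
    refine ⟨R1 * Ab ^ 2, fun n i hi => ?_⟩
    rw [abs_mul, abs_pow]
    exact mul_le_mul (hR1 n i hi) (pow_le_pow_left₀ (abs_nonneg _) (hAg n i hi) 2)
      (by positivity) ((abs_nonneg _).trans (hR1 n i hi))
  have hc'a : ∀ t, Measurable[𝓕 t] fun ω => Real.exp (-N' t ω) := fun t =>
    Real.measurable_exp.comp (hN'a t).neg
  have hcy'a : ∀ t, Measurable[𝓕 t] fun ω => Real.exp (-N' t ω) * y t ω := fun t =>
    (hc'a t).mul (hya t)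
  have hXstep : Negl (P.restrict A) fun n ω =>
      sqDist T (stepProc T n fun s ω => y s ω * a s) (fun s ω => y s ω * a s) ω := by
    refine negl_sqDist_stepProc hT hXm ?_ ?_
    · filter_upwards [hyb] with ω h1
      obtain ⟨R1, hR1⟩ := h1
      refine dyadicSup_ne_top (R := R1 * Ab) fun n i hi => ?_
      rw [abs_mul]
      exact mul_le_mul (hR1 n i hi) (hAg n i hi) (abs_nonneg _)
        ((abs_nonneg _).trans (hR1 n i hi))
    · filter_upwards [hylim'] with ω h1
      filter_upwards [h1] with s hs
      exact hs.mul ((hac.tendsto _).comp (tendsto_dfloor hT s.toNNReal))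
  have hastep : Negl (P.restrict A) fun n ω =>
      sqDist T (stepProc T n fun s _ => a s) (fun s _ => a s) ω :=
    negl_sqDist_stepProc hT ham (ae_of_all _ fun ω => dyadicSup_ne_top hAg)
      (ae_of_all _ fun ω => ae_of_all _ fun s =>
        (hac.tendsto _).comp (tendsto_dfloor hT s.toNNReal))
  have hXa : ∀ t : ℝ≥0, Measurable[𝓕 t] fun ω => y t ω * a t := fun t => (hya t).mul_const _
  have hXp : ∀ ω, Measurable fun r : ℝ≥0 => y r ω * a r := fun ω =>
    hXm.comp measurable_prodMk_right
  -- the error terms that vanish in probability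
  have n1 := negl_sum_mul_itoRem hB hA hXa hXp hI hXstep hc'a
    (hcb.mono fun ω ⟨R, hR⟩ => dyadicSup_ne_top hR)
  have n2 := negl_sum_mul_itoRem hB hA (fun _ => measurable_const) (fun _ => hac.measurable)
    hIN' hastep hcy'a (hcyb.mono fun ω ⟨R, hR⟩ => dyadicSup_ne_top hR)
  have n3 := negl_sum_sq_itoRem hB hA hXa hXp hI hXstep
  have n4 := negl_sum_sq_itoRem hB hA (fun _ => measurable_const) (fun _ => hac.measurable)
    hIN' hastep
  have n5 := negl_sum_mul_sq_sub (A := A) (T := T) hB (ζ := fun _ _ => 1)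
    (fun _ => measurable_const)
    (ae_of_all _ fun ω => dyadicSup_ne_top (R := 1) fun _ _ _ => by simp)
  have n6 := negl_sum_mul_sq_sub (A := A) (T := T) hB
    (ζ := fun t ω => Real.exp (-N' t ω) * y t ω * a t ^ 2) (fun t => (hcy'a t).mul_const _)
    (hcya.mono fun ω ⟨R, hR⟩ => dyadicSup_ne_top hR)
  -- Adding the six nonnegative errors yields a single subsequence along which each of them tends to
  -- zero almost surely; `hpick` later recovers them one by one.
  obtain ⟨φ, hφ, hlim⟩ := (((((n1.add n2).add n3).add n4).add n5).add n6).exists_subseq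
  have hygrid : ∀ᵐ ω ∂(P.restrict A), ∀ n i, i ≤ 2 ^ n → y (grid T n i) ω =
      p + (∫ s in (0 : ℝ)..grid T n i, F s ω) + (I (grid T n i) ω + J (grid T n i) ω) :=
    ae_all_iff.2 fun n => ae_all_iff.2 fun i => by
      by_cases hi : i ≤ 2 ^ n
      · filter_upwards [hy _ (grid_le hi)] with ω hω _ using hω
      · exact ae_of_all _ fun ω h => absurd h hi
  have hNgrid : ∀ᵐ ω ∂(P.restrict A), ∀ n i,
      N (grid T n i) ω = IN (grid T n i) ω + JN (grid T n i) ω :=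
    ae_restrict_of_ae (ae_all_iff.2 fun n => ae_all_iff.2 fun i => hNeq _)
  filter_upwards [hlim, hygrid, hNgrid, hN'g, hyb, hylim', hF, hyY, hNY,
    ae_restrict_of_ae hN.cont, ae_restrict_of_ae (hBH.ae_tendsto_sum_sq hH T)]
    with ω h0 h1 h2 h3 h4 h5 h6 h7 h8 h9 h10
  obtain ⟨Ry, hRy⟩ := h4
  have hl : Filter.map φ atTop ≤ atTop := hφ.tendsto_atTop
  have h0' : Tendsto (fun n => ENNReal.ofReal |∑ i ∈ Finset.range (2 ^ n),
        Real.exp (-N' (grid T n i) ω) * itoRem B (fun s ω => y s ω * a s) I T n i ω| +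
      ENNReal.ofReal |∑ i ∈ Finset.range (2 ^ n), Real.exp (-N' (grid T n i) ω) *
        y (grid T n i) ω * itoRem B (fun s _ => a s) IN T n i ω| +
      ENNReal.ofReal (∑ i ∈ Finset.range (2 ^ n),
        itoRem B (fun s ω => y s ω * a s) I T n i ω ^ 2) +
      ENNReal.ofReal (∑ i ∈ Finset.range (2 ^ n), itoRem B (fun s _ => a s) IN T n i ω ^ 2) +
      ENNReal.ofReal |∑ i ∈ Finset.range (2 ^ n), 1 * ((B (grid T n (i + 1)) ω -
        B (grid T n i) ω) ^ 2 - ((grid T n (i + 1) : ℝ) - grid T n i))| +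
      ENNReal.ofReal |∑ i ∈ Finset.range (2 ^ n), Real.exp (-N' (grid T n i) ω) *
        y (grid T n i) ω * a (grid T n i) ^ 2 * ((B (grid T n (i + 1)) ω -
        B (grid T n i) ω) ^ 2 - ((grid T n (i + 1) : ℝ) - grid T n i))|)
      (Filter.map φ atTop) (𝓝 0) := tendsto_map'_iff.2 h0
  simp only [h3, one_mul] at h0'
  have hpick := fun (f : ℕ → ℝ≥0∞) hf => tendsto_of_tendsto_of_tendsto_of_le_of_le (f := f)
    tendsto_const_nhds h0' (fun _ => zero_le) hf
  refine exp_neg_mul_eq_of_tendsto (l := Filter.map φ atTop) (β := fun t => B t ω)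
    (y := fun t => y t ω) (N := fun t => N t ω) (a := fun t => a t) (F := fun s => F s ω)
    (η := fun n i => b (grid T n i) * gridInc (fun t => BH t ω) T n i)
    (ρ := fun n i => itoRem B (fun s ω => y s ω * a s) I T n i ω)
    (r := fun n i => itoRem B (fun s _ => a s) IN T n i ω)
    (σ := fun n i => youngRem (fun t => b t * y t ω) (fun t => BH t ω) (fun t => J t ω) T n i)
    (s := fun n i => youngRem (fun t => b t) (fun t => BH t ω) (fun t => JN t ω) T n i)
    hT hl h9 hac hRy h5 h6 ?_ ?_ ?_ (h7.mono_left hl) (h8.mono_left hl) ?_ ?_ ?_ ?_ ?_ ?_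
  · intro n i hi
    have e1 : (∫ s in (grid T n i : ℝ)..grid T n (i + 1), F s ω) =
        (∫ s in (0 : ℝ)..grid T n (i + 1), F s ω) - ∫ s in (0 : ℝ)..grid T n i, F s ω := by
      have hsub : ∀ j ≤ 2 ^ n, IntervalIntegrable (fun s => F s ω) volume 0 (grid T n j) :=
        fun j hj => h6.mono_set (by
          rw [Set.uIcc_of_le (NNReal.coe_nonneg _), Set.uIcc_of_le (NNReal.coe_nonneg _)]
          exact Set.Icc_subset_Icc_right (by exact_mod_cast grid_le hj))
      rw [intervalIntegral.integral_interval_sub_left (hsub _ hi) (hsub _ hi.le)]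
    rw [e1]
    simp only [gridInc, itoRem, youngRem]
    rw [h1 n (i + 1) hi]
    nth_rewrite 1 [h1 n i hi.le]
    ring
  · intro n i hi
    simp only [gridInc, itoRem, youngRem]
    rw [h2 n (i + 1), h2 n i]
    ring
  · have e1 := (h10.const_mul (Bb ^ 2)).mono_left hl
    rw [mul_zero] at e1
    refine squeeze_zero (fun n => Finset.sum_nonneg fun _ _ => sq_nonneg _) (fun n => ?_) e1
    rw [Finset.mul_sum]
    refine Finset.sum_le_sum fun i hi => ?_
    rw [mul_pow]
    refine mul_le_mul_of_nonneg_right ?_ (sq_nonneg _)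
    rw [← sq_abs]
    exact pow_le_pow_left₀ (abs_nonneg _) (hBb _ (grid_le (Finset.mem_range.1 hi).le)) 2
  · refine tendsto_of_tendsto_ofReal_abs (hpick _ fun n => ?_)
    rw [abs_of_nonneg (Finset.sum_nonneg fun _ _ => sq_nonneg _)]
    exact le_add_right (le_add_right (le_add_right le_add_self))
  · refine tendsto_of_tendsto_ofReal_abs (hpick _ fun n => ?_)
    rw [abs_of_nonneg (Finset.sum_nonneg fun _ _ => sq_nonneg _)]
    exact le_add_right (le_add_right le_add_self)
  · refine tendsto_of_tendsto_ofReal_abs (hpick _ fun n => ?_)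
    exact le_add_right (le_add_right (le_add_right (le_add_right le_self_add)))
  · refine tendsto_of_tendsto_ofReal_abs (hpick _ fun n => ?_)
    exact le_add_right (le_add_right (le_add_right (le_add_right le_add_self)))
  · refine tendsto_of_tendsto_ofReal_abs (hpick _ fun n => ?_)
    exact le_add_right le_add_self
  · exact tendsto_of_tendsto_ofReal_abs (hpick _ fun n => le_add_self)

end ItoFormula


/-! ### The stochastic equation -/

section Stochastic

variable {d : ℕ} {D : Set (EuclideanSpace ℝ (Fin d))} {Ω : Type*} {m : MeasurableSpace Ω}
  {P : Measure Ω} [IsProbabilityMeasure P] {𝓕 : Filtration ℝ≥0 m}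

/-- Itô's formula brings `w = e^{-N} y`, `y = ⟨u, φ₀⟩`, into the scalar form already met for the
random equation. Jensen gives `e^{-N} G ≥ C e^{-N} y₊^{1+β} = C e^{βN} w₊^{1+β}`. No statement that
`e^{-N} u` solves the random equation for all test functions is needed. -/
theorem IsWeakSolutionSPDE.ae_le_tauStar {L : L2 D →ₗ.[ℝ] L2 D}
    {lam : ℝ} (hlam : 0 < lam) {φ₀ : L.adjoint.domain}
    (hφ₀eig : L.adjoint φ₀ = -(lam • (φ₀ : L2 D)))
    (hφ₀pos : ∀ᵐ x ∂(volume.restrict D), 0 < (φ₀ : L2 D) x)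
    (hφ₀int : ∫ x in D, (φ₀ : L2 D) x = 1)
    {φ : EuclideanSpace ℝ (Fin d) → ℝ} (hφ0 : ∀ᵐ x ∂(volume.restrict D), 0 ≤ φ x)
    {g : ℝ → ℝ} (hg0 : ∀ z, 0 ≤ g z)
    {C β : ℝ} (hC : 0 < C) (hβ : 0 < β) (hgC : ∀ z, 0 < z → C * z ^ (1 + β) ≤ g z)
    {H : ℝ} (hH : 1 / 2 < H) {k a b : ℝ → ℝ}
    (hk : ∀ t : ℝ, 0 ≤ t → IntervalIntegrable (fun r => k r ^ 2) volume 0 t)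
    (ha : ContinuousOn a (Set.Ici 0))
    {α : ℝ≥0} (hα : 1 - H < α) (hb : ∀ T : ℝ, ∃ M : ℝ≥0, HolderOnWith M α b (Set.Icc 0 T))
    {B BH N : ℝ≥0 → Ω → ℝ} (hB : IsFilteredBrownian P 𝓕 B) (hBH : IsFractionalBrownian P 𝓕 H BH)
    (hN : IsMixedNoise P 𝓕 a b B BH N)
    {u : ℝ≥0 → Ω → L2 D} {τ : Ω → ℝ≥0∞}
    (hu : IsWeakSolutionSPDE P 𝓕 D L k a b H g φ B BH u τ) :
    ∀ᵐ ω ∂P, τ ω ≤ tauStar k a C β lam (pairing D φ (φ₀ : L2 D)) N ω := by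
  set y : ℝ≥0 → Ω → ℝ := fun t ω => pairing D (u t ω) (φ₀ : L2 D) with hy
  set G : ℝ → Ω → ℝ := fun s ω => pairing D (fun x => g (u s.toNNReal ω x)) (φ₀ : L2 D) with hG
  set p := pairing D φ (φ₀ : L2 D) with hp
  have hym : Measurable (Function.uncurry y) := hu.measurable_pairing _
  have hya : ∀ t, Measurable[𝓕 t] (y t) := hu.adapted_pairing _
  have hτ := hu.measurableSet_lt
  choose I J hI hw using fun t => hu.weak t φ₀
  have hy0 : ∀ᵐ ω ∂P, y 0 ω = p := by
    have h0 := (hI 0).ae_eq_zero (hτ 0)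
    rw [ae_restrict_iff' (hτ 0)] at h0
    filter_upwards [h0, hw 0, hu.pos] with ω h1 h2 h3
    obtain ⟨-, -, -, -, -, hJ, heq⟩ := h2 h3
    refine heq.trans ?_
    rw [h1 h3, hJ.eq_zero]
    simp [hp]
  refine MixedSPDE.ae_le_tauStar (w := fun t ω => Real.exp (-N t ω) * y t ω) (y := y)
    (Γ := fun s ω => Real.exp (-N s.toNNReal ω) * G s ω) hC hβ (pairing_nonneg hφ0 hφ₀pos) hk
    (intervalIntegrable_sq_of_continuousOn ha) hN.cont hym
    (hN.cont.mono fun ω hω => ⟨fun t => Real.exp (N t ω), hω.rexp, fun t => Real.exp_pos _,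
      fun t => by rw [← mul_assoc, ← Real.exp_add, add_neg_cancel, Real.exp_zero, one_mul]⟩)
    hτ fun T => ?_
  set A := {ω | (T : ℝ≥0∞) < τ ω} with hA
  set F : ℝ → Ω → ℝ := fun s ω => -(1 / 2 * lam) * (k s ^ 2 * y s.toNNReal ω) + G s ω with hF
  have hTm : Set.uIcc (0 : ℝ) T = Set.Icc 0 (T : ℝ) := Set.uIcc_of_le T.coe_nonneg
  have hky : ∀ᵐ ω ∂P, (T : ℝ≥0∞) < τ ω →
      IntervalIntegrable (fun s => k s ^ 2 * y s.toNNReal ω) volume 0 T := by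
    filter_upwards [hw T] with ω h1 hωA
    have h2 := (h1 hωA).2.2.1
    simp only [hφ₀eig, pairing_neg_smul] at h2
    refine (h2.const_mul (-lam⁻¹)).congr fun s _ => ?_
    simp only [hy]
    field_simp
  have hsub : ∀ t ≤ T, A ⊆ {ω | (t : ℝ≥0∞) < τ ω} := fun t ht ω hω => by
    simp only [hA, Set.mem_ofPred_eq] at hω ⊢
    exact (ENNReal.coe_le_coe.2 ht).trans_lt hω
  have hFint : ∀ᵐ ω ∂P, (T : ℝ≥0∞) < τ ω → IntervalIntegrable (fun s => F s ω) volume 0 T := by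
    filter_upwards [hky, hw T] with ω h1 h2 hωA
    exact ((h1 hωA).const_mul _).add (h2 hωA).2.2.2.2.1
  have hito : ∀ᵐ ω ∂P, (T : ℝ≥0∞) < τ ω → Real.exp (-N T ω) * y T ω =
      p + (∫ s in (0 : ℝ)..T, Real.exp (-N s.toNNReal ω) * F s ω) -
      1 / 2 * ∫ s in (0 : ℝ)..T,
        Real.exp (-N s.toNNReal ω) * y s.toNNReal ω * a (s.toNNReal : ℝ) ^ 2 := by
    rcases eq_zero_or_pos T with hT0 | hT
    · filter_upwards [hy0, hN.ae_zero] with ω h1 h2 _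
      rw [hT0, h1, h2]
      simp
    · have h1 := ae_exp_neg_mul_eq (y := y) (F := F) (I := I) (J := J) (p := p) hT hB hBH hH ha hα
        hb hN (hτ T) hym hya (fun t ht => (hI t).mono (hsub t ht))
        ((ae_restrict_iff' (hτ T)).2 hFint)
        ((ae_restrict_iff' (hτ T)).2 ((hw T).mono fun ω h hωA => (h hωA).2.1))
        (fun t ht => (ae_restrict_iff' (hτ T)).2 ((hw t).mono fun ω h hωA =>
          (h (hsub t ht hωA)).2.2.2.2.2.1))
        fun t ht => (ae_restrict_iff' (hτ T)).2 ((hw t).mono fun ω h hωA => by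
          refine (h (hsub t ht hωA)).2.2.2.2.2.2.trans ?_
          congr 2
          refine intervalIntegral.integral_congr fun s _ => ?_
          simp only [hF, hG, hy, hφ₀eig, pairing_neg_smul]
          ring)
      rw [ae_restrict_iff' (hτ T)] at h1
      filter_upwards [h1, hy0, hN.ae_zero] with ω h2 h3 h4 h5
      rw [h2 h5, h3, h4]
      simp
  filter_upwards [hky, hFint, hito, hw T, hN.cont] with ω h1 h2 h3 h4 hNc hωA
  replace h1 := h1 hωA
  replace h2 := h2 hωA
  replace h3 := h3 hωA
  obtain ⟨hsq, -, -, hg1, hg2, -, -⟩ := h4 hωA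
  have hec : Continuous fun s : ℝ => Real.exp (-N s.toNNReal ω) :=
    (hNc.comp continuous_real_toNNReal).neg.rexp
  have hyp : Measurable fun s : ℝ => y s.toNNReal ω :=
    (hym.comp measurable_prodMk_right).comp measurable_real_toNNReal
  -- The integrability condition for the Itô integral controls this term through `|y| ≤ 1 + y²`.
  have hay : IntervalIntegrable (fun s => a s ^ 2 * y s.toNNReal ω) volume 0 T := by
    refine hsq.mono_fun' ((intervalIntegrable_sq_of_continuousOn ha T
      T.coe_nonneg).def'.aestronglyMeasurable.mul hyp.aestronglyMeasurable) (ae_of_all _ fun s => ?_)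
    beta_reduce
    rw [norm_mul, Real.norm_of_nonneg (sq_nonneg _), Real.norm_eq_abs]
    refine mul_le_mul_of_nonneg_left ?_ (sq_nonneg _)
    change |y s.toNNReal ω| ≤ 1 + y s.toNNReal ω ^ 2
    nlinarith [sq_abs (y s.toNNReal ω), sq_nonneg (|y s.toNNReal ω| - 1)]
  have hky' := h1.continuousOn_mul hec.continuousOn
  have hay' := hay.continuousOn_mul hec.continuousOn
  have hG' : IntervalIntegrable (fun s => Real.exp (-N s.toNNReal ω) * G s ω) volume 0 T :=
    hg2.continuousOn_mul hec.continuousOn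
  refine ⟨?_, hG', ?_, ?_⟩
  · refine ((hky'.const_mul (1 / 2 * lam)).add (hay'.const_mul (1 / 2))).congr fun s _ => ?_
    ring
  · filter_upwards [hg1] with s hs
    have h5 := rpow_integral_le_integral_comp (ν := volume.restrict D) hC hβ hg0 hgC
      (h := fun x => u s.toNNReal ω x) (ψ := (φ₀ : L2 D))
      (hφ₀pos.mono fun x hx => hx.le) (integrable_of_integral_eq_one hφ₀int) hφ₀int
      (integrable_mul_L2 (u s.toNNReal ω) (φ₀ : L2 D)) hs
    change C * max (y s.toNNReal ω) 0 ^ (1 + β) ≤ G s ω at h5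
    have h6 : max (Real.exp (-N s.toNNReal ω) * y s.toNNReal ω) 0 =
        Real.exp (-N s.toNNReal ω) * max (y s.toNNReal ω) 0 := by
      rw [mul_max_of_nonneg _ _ (Real.exp_pos _).le, mul_zero]
    rw [h6, Real.mul_rpow (Real.exp_pos _).le (le_max_right _ _), ← Real.exp_mul]
    have h7 : Real.exp (-N s.toNNReal ω) =
        Real.exp (β * N s.toNNReal ω) * Real.exp (-N s.toNNReal ω * (1 + β)) := by
      rw [← Real.exp_add]; ring_nf
    calc _ = Real.exp (β * N s.toNNReal ω) * Real.exp (-N s.toNNReal ω * (1 + β)) *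
          (C * max (y s.toNNReal ω) 0 ^ (1 + β)) := by ring
      _ = Real.exp (-N s.toNNReal ω) * (C * max (y s.toNNReal ω) 0 ^ (1 + β)) := by rw [← h7]
      _ ≤ _ := mul_le_mul_of_nonneg_left h5 (Real.exp_pos _).le
  · have e1 : (∫ s in (0 : ℝ)..T, Real.exp (-N s.toNNReal ω) * F s ω) =
        -(1 / 2 * lam) * (∫ s in (0 : ℝ)..T,
          Real.exp (-N s.toNNReal ω) * (k s ^ 2 * y s.toNNReal ω)) +
        ∫ s in (0 : ℝ)..T, Real.exp (-N s.toNNReal ω) * G s ω := by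
      rw [← intervalIntegral.integral_const_mul,
        ← intervalIntegral.integral_add (hky'.const_mul _) hG']
      refine intervalIntegral.integral_congr fun s _ => ?_
      simp only [hF]
      ring
    have e2 : (∫ s in (0 : ℝ)..T, Real.exp (-N s.toNNReal ω) * y s.toNNReal ω *
        a (s.toNNReal : ℝ) ^ 2) =
        ∫ s in (0 : ℝ)..T, Real.exp (-N s.toNNReal ω) * (a s ^ 2 * y s.toNNReal ω) := by
      refine intervalIntegral.integral_congr fun s hs => ?_
      rw [hTm] at hs
      rw [Real.coe_toNNReal _ hs.1]
      ring
    have e3 : (∫ s in (0 : ℝ)..T, (1 / 2 * lam * k s ^ 2 + 1 / 2 * a s ^ 2) *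
          (Real.exp (-N s.toNNReal ω) * y s.toNNReal ω)) =
        1 / 2 * lam * (∫ s in (0 : ℝ)..T,
          Real.exp (-N s.toNNReal ω) * (k s ^ 2 * y s.toNNReal ω)) +
        1 / 2 * ∫ s in (0 : ℝ)..T,
          Real.exp (-N s.toNNReal ω) * (a s ^ 2 * y s.toNNReal ω) := by
      rw [← intervalIntegral.integral_const_mul, ← intervalIntegral.integral_const_mul,
        ← intervalIntegral.integral_add (hky'.const_mul _) (hay'.const_mul _)]
      refine intervalIntegral.integral_congr fun s _ => ?_
      ring
    rw [h3, e1, e2, e3]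
    ring

end Stochastic

end MixedSPDE

end

/-! ### The main theorem -/

theorem theorem3p1 {d : ℕ} (D : Set (EuclideanSpace ℝ (Fin d)))
    (hDo : IsOpen D) (hDb : Bornology.IsBounded D)
    -- the generator of a strongly continuous contraction semigroup on `L²(D)`
    (S : ℝ≥0 → MixedSPDE.L2 D →L[ℝ] MixedSPDE.L2 D) (L : MixedSPDE.L2 D →ₗ.[ℝ] MixedSPDE.L2 D)
    (hS : MixedSPDE.IsContractionSemigroup S) (hL : MixedSPDE.IsGenerator S L)
    -- positive normalised eigenfunction of the adjoint
    (lam : ℝ) (hlam : 0 < lam) (φ₀ : L.adjoint.domain)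
    (hφ₀eig : L.adjoint φ₀ = -(lam • (φ₀ : MixedSPDE.L2 D)))
    (hφ₀pos : ∀ᵐ x ∂(volume.restrict D), 0 < (φ₀ : MixedSPDE.L2 D) x)
    (hφ₀int : ∫ x in D, (φ₀ : MixedSPDE.L2 D) x = 1)
    -- initial value
    (φ : EuclideanSpace ℝ (Fin d) → ℝ) (hφ : MemLp φ ⊤ (volume.restrict D))
    (hφ0 : ∀ᵐ x ∂(volume.restrict D), 0 ≤ φ x)
    -- nonlinearity
    (g : ℝ → ℝ) (hg : LocallyLipschitz g) (hg0 : ∀ z, 0 ≤ g z)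
    (C β : ℝ) (hC : 0 < C) (hβ : 0 < β) (hgC : ∀ z, 0 < z → C * z ^ (1 + β) ≤ g z)
    -- coefficients
    (H : ℝ) (hH : 1 / 2 < H) (hH1 : H < 1) (k a b : ℝ → ℝ)
    (hk : ∀ t : ℝ, 0 ≤ t → IntervalIntegrable (fun r => k r ^ 2) volume 0 t)
    (ha : ContinuousOn a (Set.Ici 0))
    (α : ℝ≥0) (hα : 1 - H < α) (hb : ∀ T : ℝ, ∃ M : ℝ≥0, HolderOnWith M α b (Set.Icc 0 T))
    -- filtered probability space and noise
    {Ω : Type*} [m : MeasurableSpace Ω] (P : Measure Ω) [IsProbabilityMeasure P]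
    (𝓕 : Filtration ℝ≥0 m) (B BH N : ℝ≥0 → Ω → ℝ)
    (hB : MixedSPDE.IsFilteredBrownian P 𝓕 B)
    (hBH : MixedSPDE.IsFractionalBrownian P 𝓕 H BH)
    (hN : MixedSPDE.IsMixedNoise P 𝓕 a b B BH N)
    (τstar : Ω → ℝ≥0∞)
    (hτstar : τstar = MixedSPDE.tauStar k a C β lam
      (MixedSPDE.pairing D φ (φ₀ : MixedSPDE.L2 D)) N) :
    (∀ (v : ℝ≥0 → Ω → MixedSPDE.L2 D) (τ : Ω → ℝ≥0∞),
      MixedSPDE.IsWeakSolutionRPDE P 𝓕 D L k a g φ N v τ →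
      (∀ᵐ ω ∂P, τ ω ≤ τstar ω) ∧
      (MixedSPDE.IsBlowupTime P D v τ → ∀ᵐ ω ∂P, τstar ω < ⊤ →
        τ ω < ⊤ ∧
        MixedSPDE.BlowsUpAt D (fun t => v t ω) (τ ω).toNNReal ∧
        MixedSPDE.BlowsUpAt D (fun t => Real.exp (N t ω) • v t ω) (τ ω).toNNReal)) ∧
    (∀ (u : ℝ≥0 → Ω → MixedSPDE.L2 D) (τ : Ω → ℝ≥0∞),
      MixedSPDE.IsWeakSolutionSPDE P 𝓕 D L k a b H g φ B BH u τ →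
      (∀ᵐ ω ∂P, τ ω ≤ τstar ω) ∧
      (MixedSPDE.IsBlowupTime P D u τ → ∀ᵐ ω ∂P, τstar ω < ⊤ →
        τ ω < ⊤ ∧
        MixedSPDE.BlowsUpAt D (fun t => u t ω) (τ ω).toNNReal ∧
        MixedSPDE.BlowsUpAt D (fun t => Real.exp (-N t ω) • u t ω) (τ ω).toNNReal)) := by
  have hp := MixedSPDE.IsMixedNoise.cont hN
  subst hτstar
  refine ⟨fun v τ hv => ?_, fun u τ hu => ?_⟩
  · have h := hv.ae_le_tauStar hlam hφ₀eig hφ₀pos hφ₀int hφ0 hg0 hC hβ hgC hk ha hp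
    exact ⟨h, MixedSPDE.blowup_of_le_tauStar hp h⟩
  · have h := hu.ae_le_tauStar hlam hφ₀eig hφ₀pos hφ₀int hφ0 hg0 hC hβ hgC hH hk ha hα hb hB hBH hN
    exact ⟨h, MixedSPDE.blowup_of_le_tauStar (N := fun t ω => -N t ω)
      (hp.mono fun ω hω => hω.neg) h⟩
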